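/- Conventions. $\mathcal H^1,\mathcal H^2$ are Hausdorff measures, normalized to agree with Lebesgue measure on $\mathbb R^1,\mathbb R^2$. A \emph{metric surface} is a metric space in which every point has an open neighbourhood homeomorphic to an open subset of $\mathbb R^2$ and in which $\mathcal H^2$ is finite on compact sets. It is \emph{$2$-rectifiable} if it is covered, up to an $\mathcal H^2$-null set, by countably many Lipschitz images of Borel subsets of $\mathbb R^2$. For a path $\gamma\colon[a,b]\to X$ and a Borel $\rho\colon X\to[0,\infty]$ let $\int_\gamma\rho\,ds=\int_X\#(\gamma^{-1}(x))\,\rho(x)\,d\mathcal H^1(x)$. For $1\le p<\infty$ the $p$-modulus of a family $\Gamma$ of paths is the infimum of $\int_X\rho^p\,d\mathcal H^2$ (for $p=\infty$: of $\|\rho\|_{L^\infty(\mathcal H^2)}$) over all Borel $\rho\colon X\to[0,\infty]$ with $\int_\gamma\rho\,ds\ge1$ for all $\gamma\in\Gamma$. A Borel $\rho\colon X\to[0,\infty]$ is a \emph{$p$-weak upper gradient} of $u\colon X\to\mathbb R$ if $|u(\gamma(a))-u(\gamma(b))|\le\int_\gamma\rho\,ds$ for all rectifiable paths $\gamma\colon[a,b]\to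 X$ outside a family of $p$-modulus zero. A \emph{$p$-minimal upper gradient} $\rho_{u,p}$ is a $p$-weak upper gradient in $L^p(\mathcal H^2)$ that is $\mathcal H^2$-a.e. at most every other $p$-weak upper gradient in $L^p(\mathcal H^2)$. For $K\subset X$ and $x\in K$, $\operatorname{lip}(u|_K)(x)=\inf_{r>0}\sup_{0<s\le r}\sup_{y\in B(x,s)\cap K}|u(y)-u(x)|/s$. Theorem. There exist a $2$-rectifiable metric surface $X\subset\mathbb R^3$ (with the Euclidean distance) with $\mathcal H^2(X)<\infty$ and a closed subset $C\subset X$, homeomorphic to the Cantor set, with $\mathcal H^2(C)>0$, such that every rectifiable path in $X$ that meets $C$ is constant, and such that the following hold. (1) For every Lipschitz $u\colon X\to\mathbb R$ and every $1\le p\le\infty$, a $p$-minimal upper gradient of $u$ exists, and every such $\rho_{u,p}$ satisfies $\rho_{u,p}(x)=0$ for $\mathcal H^2$-a.e. $x\in C$. (2) For every Lipschitz $u\colon X\to\mathbb R$, every Borel set $E\subset X$ and every $1\le p\le\infty$, the function $t\mapsto\mathcal H^1(u^{-1}(t)\cap E)$ is Lebesgue measurable and $$\int_{\mathbb R}\mathcal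 H^1(u^{-1}(t)\cap E)\,dt=\int_E\chi_C\operatorname{lip}(u|_C)\,d\mathcal H^2+\int_E\chi_{X\setminus C}\,\rho_{u,p}\,d\mathcal H^2 .$$ (3) The coordinate projection $u(x_1,x_2,x_3)=x_1$, which is Lipschitz on $X$, satisfies $$\int_{\mathbb R}\mathcal H^1(u^{-1}(t)\cap C)\,dt>0\quad\text{and}\quad\operatorname{lip}(u|_C)(x)=1\ \text{ for }\mathcal H^2\text{-a.e. }x\in C .$$ In particular every coarea inequality fails for the pair $(u,\rho_{u,p})$: for all $1\le p\le\infty$ and $0\le\kappa<\infty$ there is a Borel $g\colon X\to[0,\infty]$ with $$\int_{\mathbb R}\int_{u^{-1}(t)}g\,d\mathcal H^1\,dt>\kappa\int_X g\,\rho_{u,p}\,d\mathcal H^2 .$$ -/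

import Mathlib

open MeasureTheory Set
open scoped ENNReal NNReal

namespace MetricSurface

/-- A path in `X`: a continuous map from a compact interval `[a, b]` to `X`. -/
structure CurvePath (X : Type*) [TopologicalSpace X] where
  a : ℝ
  b : ℝ
  le : a ≤ b
  map : C(Icc a b, X)

namespace CurvePath

/-- The initial point `γ(a)`. -/
def source {X : Type*} [TopologicalSpace X] (γ : CurvePath X) : X :=
  γ.map ⟨γ.a, left_mem_Icc.2 γ.le⟩

/-- The end point `γ(b)`. -/
def target {X : Type*} [TopologicalSpace X] (γ : CurvePath X) : X :=
  γ.map ⟨γ.b, right_mem_Icc.2 γ.le⟩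

/-- The length `ℓ(γ)`. -/
noncomputable def length {X : Type*} [MetricSpace X] (γ : CurvePath X) : ℝ≥0∞ :=
  eVariationOn (fun t => γ.map t) univ

/-- A path of finite length. -/
def Rectifiable {X : Type*} [MetricSpace X] (γ : CurvePath X) : Prop :=
  γ.length < ∞

/-- The path integral `∫_γ ρ ds = ∫_X #(γ⁻¹(x)) ρ(x) dℋ¹(x)`, for Borel `ρ`. -/
noncomputable def pathIntegral {X : Type*} [MetricSpace X] [MeasurableSpace X] [BorelSpace X]
    (γ : CurvePath X) (ρ : X → ℝ≥0∞) : ℝ≥0∞ :=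
  ∫⁻ x, ((γ.map ⁻¹' {x}).encard : ℝ≥0∞) * ρ x ∂(μHE[1] : Measure X)

end CurvePath

section

variable {X : Type*} [MetricSpace X] [MeasurableSpace X] [BorelSpace X]

/-- A Borel function `ρ : X → [0, ∞]` is admissible for the path family `Γ` if
`∫_γ ρ ds ≥ 1` for all `γ ∈ Γ`. -/
def Admissible (ρ : X → ℝ≥0∞) (Γ : Set (CurvePath X)) : Prop :=
  Measurable ρ ∧ ∀ γ ∈ Γ, 1 ≤ γ.pathIntegral ρ

/-- The `p`-modulus of a path family with respect to `ℋ²`, for `1 ≤ p ≤ ∞`. -/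
noncomputable def modulus (p : ℝ≥0∞) (Γ : Set (CurvePath X)) : ℝ≥0∞ :=
  if p = ∞ then
    ⨅ (ρ : X → ℝ≥0∞) (_ : Admissible ρ Γ), essSup ρ (μHE[2] : Measure X)
  else
    ⨅ (ρ : X → ℝ≥0∞) (_ : Admissible ρ Γ), ∫⁻ x, ρ x ^ p.toReal ∂(μHE[2] : Measure X)

/-- `ρ` is a `p`-weak upper gradient of `u`: it is Borel, and the upper gradient inequality
holds along every rectifiable path outside a family of `p`-modulus zero. -/
def IsWeakUpperGradient (p : ℝ≥0∞) (u : X → ℝ) (ρ : X → ℝ≥0∞) : Prop :=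
  Measurable ρ ∧ ∃ Γ : Set (CurvePath X), modulus p Γ = 0 ∧
    ∀ γ : CurvePath X, γ.Rectifiable → γ ∉ Γ →
      edist (u γ.source) (u γ.target) ≤ γ.pathIntegral ρ

/-- `ρ` is a `p`-integrable `p`-weak upper gradient of `u`. -/
def IsIntegrableWeakUpperGradient (p : ℝ≥0∞) (u : X → ℝ) (ρ : X → ℝ≥0∞) : Prop :=
  IsWeakUpperGradient p u ρ ∧ eLpNorm ρ p (μHE[2] : Measure X) < ∞

/-- `ρ` is a minimal `p`-weak upper gradient `ρ_{u,p}` of `u`: a `p`-integrable `p`-weak upper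
gradient that is, `ℋ²`-almost everywhere, at most every other one. -/
def IsMinimalWeakUpperGradient (p : ℝ≥0∞) (u : X → ℝ) (ρ : X → ℝ≥0∞) : Prop :=
  IsIntegrableWeakUpperGradient p u ρ ∧
    ∀ ρ' : X → ℝ≥0∞, IsIntegrableWeakUpperGradient p u ρ' →
      ∀ᵐ x ∂(μHE[2] : Measure X), ρ x ≤ ρ' x

/-- The pointwise Lipschitz constant `lip(u|_K)(x)` of the restriction of `u` to `K`
(meaningful for `x ∈ K`). -/
noncomputable def lipOn {X : Type*} [MetricSpace X] (u : X → ℝ) (K : Set X) (x : X) : ℝ≥0∞ :=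
  ⨅ (r : ℝ) (_ : 0 < r), ⨆ (s : ℝ) (_ : s ∈ Ioc 0 r), ⨆ (y : X) (_ : y ∈ Metric.ball x s ∩ K),
    ENNReal.ofReal (|u y - u x| / s)

end

/-- A metric surface: a metric space in which every point has an open neighbourhood homeomorphic
to an open subset of the plane, and for which `ℋ²` is finite on compact sets. -/
def IsMetricSurface (X : Type*) [MetricSpace X] [MeasurableSpace X] [BorelSpace X] : Prop :=
  (∀ x : X, ∃ U : Set X, IsOpen U ∧ x ∈ U ∧
    ∃ V : Set (EuclideanSpace ℝ (Fin 2)), IsOpen V ∧ Nonempty (U ≃ₜ V)) ∧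
  ∀ K : Set X, IsCompact K → (μHE[2] : Measure X) K < ∞

/-- `2`-rectifiability: up to an `ℋ²`-null set, the space is covered by countably many Lipschitz
images of Borel subsets of the plane. -/
def IsTwoRectifiable (X : Type*) [MetricSpace X] [MeasurableSpace X] [BorelSpace X] : Prop :=
  ∃ (A : ℕ → Set (EuclideanSpace ℝ (Fin 2))) (f : (i : ℕ) → A i → X),
    (∀ i, MeasurableSet (A i)) ∧ (∀ i, ∃ L : ℝ≥0, LipschitzWith L (f i)) ∧
    (μHE[2] : Measure X) (⋃ i, range (f i))ᶜ = 0

end MetricSurface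

open MetricSurface

/-! The surface is an open square from which tubes grow. A tube of generation `n` is about `16⁻ⁿ`
thick, climbs by `2⁻ⁿ` and zigzags sideways on the way, with `4ⁿ` periods of amplitude `2⁻ⁿ`; on its
top stand four tubes of the next generation. Its length is of order `2ⁿ` and its area of order
`8⁻ⁿ`, so the `4ⁿ` tubes of generation `n` have total area of order `2⁻ⁿ`, which is summable
(`measure_surface_lt_top`). A path that leaves the end of an infinite chain of tubes traverses
complete tubes of all large generations, hence has infinite length (`eVariationOn_eq_top`).

These ends, the tips, are coded by pairs of sign sequences and all have height 2. Horizontally they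
form a product of two fat Cantor sets: the cells of generation `n` have size of order `2⁻ⁿ`, but the
gaps between them only `4⁻ⁿ` (`pos_code`, `tips_pos`). Upper gradients test functions only along
rectifiable paths and therefore ignore the tips, whereas level sets of a coordinate still see their
area.

Away from the tips the surface is polyhedral: outside a null set it consists of countably many open
planar pieces. `IsPiecewisePlanar` isolates what the analysis needs. For such a space the pointwise
Lipschitz constant, set to zero on `C`, is the minimal upper gradient for every `p`
(`IsPiecewisePlanar.isMinimal`). It is an upper gradient because paths meeting `C` are constant, and
on the remaining rectifiable paths the image of `u` is controlled by the integral of the slope. It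
is minimal because Fubini over parallel segments in a planar piece forces every competitor to
dominate the norm of the derivative.

The coarea equality (`IsPiecewisePlanar.coarea`) is the planar coarea formula applied to Lipschitz
extensions from each planar piece and from `C`. At density points of a planar set the slope of a
restriction is the norm of the derivative of any Lipschitz extension, and Eilenberg's inequality
removes the null set. -/

open MetricSurface
open Filter Topology Measure

/-! ### Distance-preserving maps on subsets. -/

section IsometryOn

variable {X Y : Type*} [MetricSpace X] [MetricSpace Y]

/-- A map that preserves distances between the points of `s`. -/
def IsometryOn (f : X → Y) (s : Set X) : Prop :=
  ∀ x ∈ s, ∀ y ∈ s, dist (f x) (f y) = dist x y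

theorem IsometryOn.mono {f : X → Y} {s t : Set X} (h : IsometryOn f s) (hts : t ⊆ s) :
    IsometryOn f t := fun x hx y hy => h x (hts hx) y (hts hy)

theorem IsometryOn.injOn {f : X → Y} {s : Set X} (h : IsometryOn f s) : InjOn f s := by
  intro x hx y hy hxy
  rw [← dist_eq_zero, ← h x hx y hy, hxy, dist_self]

theorem IsometryOn.lipschitzOnWith {f : X → Y} {s : Set X} (h : IsometryOn f s) :
    LipschitzOnWith 1 f s :=
  LipschitzOnWith.of_dist_le_mul fun x hx y hy => by simp [h x hx y hy]

theorem IsometryOn.of_leftInvOn {f : X → Y} {s : Set X} (h : IsometryOn f s) {g : Y → X}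
    (hg : LeftInvOn g f s) : IsometryOn g (f '' s) := by
  rintro _ ⟨x, hx, rfl⟩ _ ⟨y, hy, rfl⟩
  rw [hg hx, hg hy, h x hx y hy]

end IsometryOn

/-! ### Hausdorff measures and Eilenberg's inequality. -/

section HausdorffBasics

variable {X Y : Type*} [MetricSpace X] [MeasurableSpace X] [BorelSpace X]
  [MetricSpace Y] [MeasurableSpace Y] [BorelSpace Y]

/-- On `ℝ` both `μHE[1]` and `μH[1]` are Lebesgue measure, so evaluating on the unit interval
determines the constant. -/
theorem addHaarScalarFactor_volume_hausdorffMeasure_one :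
    addHaarScalarFactor (volume : Measure (EuclideanSpace ℝ (Fin 1))) μH[(1 : ℕ)] = 1 := by
  have h := InnerProductSpace.euclideanHausdorffMeasure_eq_volume (V := ℝ)
  rw [Module.finrank_self, euclideanHausdorffMeasure_def] at h
  have h1 := congrArg (fun μ : Measure ℝ => μ (Icc 0 1)) h
  simp only [Nat.cast_one, hausdorffMeasure_real, Measure.smul_apply, Real.volume_Icc] at h1
  simpa [ENNReal.smul_def] using h1

theorem euclideanHausdorffMeasure_one : (μHE[1] : Measure X) = μH[1] := by
  rw [euclideanHausdorffMeasure_def, addHaarScalarFactor_volume_hausdorffMeasure_one]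
  simp

theorem euclideanHausdorffMeasure_eq_mul (d : ℕ) (s : Set X) :
    (μHE[d] : Measure X) s =
      (addHaarScalarFactor (volume : Measure (EuclideanSpace ℝ (Fin d))) μH[d] : ℝ≥0∞) *
        μH[d] s := by
  rw [euclideanHausdorffMeasure_def, Measure.smul_apply, ENNReal.smul_def, smul_eq_mul]

theorem LipschitzOnWith.euclideanHausdorffMeasure_image_le {K : ℝ≥0} {f : X → Y} {s : Set X}
    (h : LipschitzOnWith K f s) (d : ℕ) : μHE[d] (f '' s) ≤ (K : ℝ≥0∞) ^ d * μHE[d] s := by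
  rw [euclideanHausdorffMeasure_eq_mul, euclideanHausdorffMeasure_eq_mul, mul_left_comm]
  gcongr
  simpa using h.hausdorffMeasure_image_le (d := d) (by positivity)

theorem IsometryOn.euclideanHausdorffMeasure_image {f : X → Y} {s : Set X} (h : IsometryOn f s)
    (d : ℕ) : μHE[d] (f '' s) = μHE[d] s := by
  apply le_antisymm
  · simpa using h.lipschitzOnWith.euclideanHausdorffMeasure_image_le d
  · rcases isEmpty_or_nonempty X with hX | hX
    · simp [Set.eq_empty_of_isEmpty s]
    have hl := h.injOn.leftInvOn_invFunOn
    have := (h.of_leftInvOn hl).lipschitzOnWith.euclideanHausdorffMeasure_image_le d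
    rw [hl.image_image] at this
    simpa using this

/-- Eilenberg's inequality, in a form that does not need measurability of the left hand side. -/
theorem exists_measurable_ge_hausdorffMeasure_slice {u : X → ℝ} {A : Set X} {L : ℝ≥0}
    (hu : LipschitzOnWith L u A) (hA : μH[2] A ≠ ∞) :
    ∃ g : ℝ → ℝ≥0∞, Measurable g ∧ (∀ t, μH[1] (u ⁻¹' {t} ∩ A) ≤ g t) ∧
      ∫⁻ t, g t ≤ L * μH[2] A := by
  -- Fine covers whose sums of squared diameters nearly realise `μH[2] A`; finiteness of `μH[2] A`
  -- gives the room `1 / n`.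
  have hcov : ∀ n : ℕ, ∃ t : ℕ → Set X, A ⊆ ⋃ i, t i ∧
      (∀ i, Metric.ediam (t i) ≤ (n : ℝ≥0∞)⁻¹) ∧
      ∑' i, Metric.ediam (t i) ^ (2 : ℝ) ≤ μH[2] A + (n : ℝ≥0∞)⁻¹ := by
    intro n
    have hlt : μH[2] A < μH[2] A + (n : ℝ≥0∞)⁻¹ :=
      ENNReal.lt_add_right hA (by simp)
    have hle := hausdorffMeasure_apply 2 A
    have h2 : (⨅ (t : ℕ → Set X) (_ : A ⊆ ⋃ i, t i)
        (_ : ∀ i, Metric.ediam (t i) ≤ (n : ℝ≥0∞)⁻¹),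
        ∑' i, ⨆ _ : (t i).Nonempty, Metric.ediam (t i) ^ (2 : ℝ)) <
        μH[2] A + (n : ℝ≥0∞)⁻¹ := by
      refine lt_of_le_of_lt ?_ hlt
      rw [hle]
      exact le_iSup₂_of_le (n : ℝ≥0∞)⁻¹ (by simp) le_rfl
    simp only [iInf_lt_iff] at h2
    obtain ⟨t, h1, h2, h3⟩ := h2
    refine ⟨t, h1, h2, le_trans (ENNReal.tsum_le_tsum fun i => ?_) h3.le⟩
    rcases (t i).eq_empty_or_nonempty with h | h
    · simp [h]
    · exact le_iSup_of_le h le_rfl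
  choose t hA1 ht hsum using hcov
  set S : ℕ → ℕ → Set X := fun n i => t n i ∩ A with hS
  have hSle : ∀ n i, Metric.ediam (S n i) ≤ Metric.ediam (t n i) :=
    fun n i => Metric.ediam_mono inter_subset_left
  -- Adds up the diameters of the covering sets that can meet the level `s`. Taking closures of the
  -- images makes this a Borel function of `s`, whatever `A` is.
  set g : ℕ → ℝ → ℝ≥0∞ := fun n s =>
    ∑' i, (closure (u '' S n i)).indicator (fun _ => Metric.ediam (S n i)) s with hg
  have hgm : ∀ n, Measurable (g n) := fun n =>
    Measurable.tsum fun i => measurable_const.indicator isClosed_closure.measurableSet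
  refine ⟨fun s => liminf (fun n => g n s) atTop, Measurable.liminf hgm, fun s => ?_, ?_⟩
  · refine (hausdorffMeasure_le_liminf_tsum (l := atTop) 1 _ (fun n : ℕ => (n : ℝ≥0∞)⁻¹)
      ENNReal.tendsto_inv_nat_nhds_zero (fun n i => S n i ∩ u ⁻¹' {s})
      (Eventually.of_forall fun n i => (Metric.ediam_mono inter_subset_left).trans
        ((hSle n i).trans (ht n i))) (Eventually.of_forall fun n x hx => ?_)).trans ?_
    · obtain ⟨i, hi⟩ := mem_iUnion.1 (hA1 n hx.2)
      exact mem_iUnion.2 ⟨i, ⟨hi, hx.2⟩, hx.1⟩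
    · refine liminf_le_liminf (Eventually.of_forall fun n => ?_)
      refine ENNReal.tsum_le_tsum fun i => ?_
      rw [ENNReal.rpow_one]
      rcases (S n i ∩ u ⁻¹' {s}).eq_empty_or_nonempty with h | ⟨x, hx, hxs⟩
      · simp [h]
      · rw [indicator_of_mem]
        · exact Metric.ediam_mono inter_subset_left
        · exact subset_closure ⟨x, hx, hxs⟩
  -- Fatou's lemma. A covering set contributes its diameter times the length of its image, at most
  -- `L` times the squared diameter.
  · refine (lintegral_liminf_le hgm).trans ?_
    have hb : ∀ n, ∫⁻ s, g n s ≤ L * (μH[2] A + (n : ℝ≥0∞)⁻¹) := by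
      intro n
      rw [lintegral_tsum fun i =>
        (measurable_const.indicator isClosed_closure.measurableSet).aemeasurable]
      refine le_trans (ENNReal.tsum_le_tsum fun i => ?_)
        ((ENNReal.tsum_mul_left (a := (L : ℝ≥0∞))).trans_le (mul_le_mul_right (hsum n) _))
      rw [lintegral_indicator_const isClosed_closure.measurableSet]
      have h1 : volume (closure (u '' S n i)) ≤ L * Metric.ediam (t n i) := by
        refine (Real.volume_le_diam _).trans ?_
        rw [Metric.ediam_closure]
        have h2 : Metric.ediam (u '' S n i) ≤ L * Metric.ediam (S n i) :=
          Metric.ediam_image_le_iff.2 fun x hx y hy =>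
            (hu hx.2 hy.2).trans (by gcongr; exact Metric.edist_le_ediam_of_mem hx hy)
        exact h2.trans (by gcongr; exact inter_subset_left)
      calc _ ≤ Metric.ediam (t n i) * (L * Metric.ediam (t n i)) := by
            gcongr; exact inter_subset_left
        _ = _ := by
            rw [show (2 : ℝ) = (2 : ℕ) by norm_num, ENNReal.rpow_natCast]; ring
    have hlim : Tendsto (fun n : ℕ => (L : ℝ≥0∞) * (μH[2] A + (n : ℝ≥0∞)⁻¹)) atTop
        (𝓝 (L * (μH[2] A + 0))) :=
      ENNReal.Tendsto.const_mul (tendsto_const_nhds.add ENNReal.tendsto_inv_nat_nhds_zero)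
        (Or.inr ENNReal.coe_ne_top)
    rw [add_zero] at hlim
    exact (liminf_le_liminf (Eventually.of_forall hb)).trans hlim.liminf_eq.le

/-- Almost every level set of a Lipschitz function meets an `ℋ²`-null set in an `ℋ¹`-null set. -/
theorem ae_hausdorffMeasure_slice_eq_zero {u : X → ℝ} {A : Set X} {L : ℝ≥0}
    (hu : LipschitzOnWith L u A) (hA : μHE[2] A = 0) :
    ∀ᵐ t : ℝ, μHE[1] (u ⁻¹' {t} ∩ A) = 0 := by
  have hA' : μH[2] A = 0 := by
    rw [euclideanHausdorffMeasure_eq_mul] at hA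
    have h0 := addHaarScalarFactor_volume_hausdorffMeasure_ne_zero 2
    simpa using (mul_eq_zero.1 hA).resolve_left (by simpa using h0)
  obtain ⟨g, hgm, hg, hgi⟩ := exists_measurable_ge_hausdorffMeasure_slice hu (by simp [hA'])
  rw [hA', mul_zero, nonpos_iff_eq_zero, lintegral_eq_zero_iff hgm] at hgi
  filter_upwards [hgi] with t ht
  rw [euclideanHausdorffMeasure_one]
  exact le_antisymm ((hg t).trans ht.le) (by simp)

end HausdorffBasics

/-- The Euclidean plane. -/
abbrev Plane : Type := EuclideanSpace ℝ (Fin 2)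

/-! ### Coarea estimates where a function is nearly affine. -/

section Coarea

/-- The hypothesis says that `f` is injective on `s` with a `K`-Lipschitz inverse; neither
continuity of `f` nor measurability of `s` plays a role. -/
theorem euclideanHausdorffMeasure_le_mul_image {X Y : Type*} [MetricSpace X] [MeasurableSpace X]
    [BorelSpace X] [MetricSpace Y] [MeasurableSpace Y] [BorelSpace Y] {f : X → Y} {s : Set X}
    {K : ℝ≥0} (h : ∀ x ∈ s, ∀ y ∈ s, dist x y ≤ K * dist (f x) (f y)) (d : ℕ) :
    μHE[d] s ≤ (K : ℝ≥0∞) ^ d * μHE[d] (f '' s) := by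
  rcases isEmpty_or_nonempty X with hX | hX
  · simp [Set.eq_empty_of_isEmpty s]
  have hinj : InjOn f s := fun x hx y hy hxy => by
    have := h x hx y hy
    rw [hxy, dist_self, mul_zero] at this
    exact dist_le_zero.1 this
  have hl := hinj.leftInvOn_invFunOn
  have hlip : LipschitzOnWith K (Function.invFunOn f s) (f '' s) := by
    refine LipschitzOnWith.of_dist_le_mul ?_
    rintro _ ⟨x, hx, rfl⟩ _ ⟨y, hy, rfl⟩
    rw [hl hx, hl hy]
    exact h x hx y hy
  have := hlip.euclideanHausdorffMeasure_image_le d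
  rwa [hl.image_image] at this

theorem volume_eq_lintegral_slice {B : Set Plane} (hB : MeasurableSet B) :
    Measurable (fun t : ℝ => volume {s : ℝ | !₂[t, s] ∈ B}) ∧
      volume B = ∫⁻ t : ℝ, volume {s : ℝ | !₂[t, s] ∈ B} := by
  have h1 := (EuclideanSpace.volume_preserving_symm_measurableEquiv_toLp (Fin 2)).symm
  have h2 := (MeasureTheory.volume_preserving_finTwoArrow ℝ).symm
  have h3 := h1.comp h2
  have hm := h3.measurable hB
  have hv := h3.measure_preimage hB.nullMeasurableSet
  have hset : ∀ t : ℝ, Prod.mk t ⁻¹' ((⇑(MeasurableEquiv.toLp 2 (Fin 2 → ℝ)).symm.symm ∘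
      ⇑MeasurableEquiv.finTwoArrow.symm) ⁻¹' B) = {s : ℝ | !₂[t, s] ∈ B} := fun t => rfl
  refine ⟨?_, ?_⟩
  · have := measurable_measure_prodMk_left (ν := (volume : Measure ℝ)) hm
    simpa only [hset] using this
  · rw [← hv, Measure.volume_eq_prod, Measure.prod_apply hm]
    simp only [hset]

/-- Two-sided coarea estimate on a set where the function is the first component of a map that is
bi-Lipschitz up to scaling. -/
theorem exists_coarea_sandwich_of_bilipschitz {f : Plane → Plane} (hf : Continuous f)
    {S : Set Plane} (hS : MeasurableSet S) {a c : ℝ≥0} (ha : a ≠ 0)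
    (hle : ∀ x ∈ S, ∀ y ∈ S, dist (f x) (f y) ≤ a * c * dist x y)
    (hge : ∀ x ∈ S, ∀ y ∈ S, dist x y ≤ a⁻¹ * c * dist (f x) (f y)) :
    ∃ G : ℝ → ℝ≥0∞, Measurable G ∧
      (∀ t, μHE[1] ((fun x => f x 0) ⁻¹' {t} ∩ S) ≤ c * G t) ∧
      (∀ t, G t ≤ c * μHE[1] ((fun x => f x 0) ⁻¹' {t} ∩ S)) ∧
      ∫⁻ t, G t ≤ c ^ 2 * (a * volume S) ∧ a * volume S ≤ c ^ 2 * ∫⁻ t, G t := by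
  have hinj : InjOn f S := fun x hx y hy hxy => by
    have := hge x hx y hy
    rw [hxy, dist_self, mul_zero] at this
    exact dist_le_zero.1 this
  have hfS : MeasurableSet (f '' S) := hS.image_of_continuousOn_injOn hf.continuousOn hinj
  obtain ⟨hm, hv⟩ := volume_eq_lintegral_slice hfS
  have ha' : (a : ℝ≥0∞) ≠ 0 := by simpa using ha
  -- The vertical slices of `f '' S` are the pictures of the level sets under the second component,
  -- which has the same distances as `f` there.
  have himg : ∀ t, (fun x => f x 1) '' ((fun x => f x 0) ⁻¹' {t} ∩ S) =
      {s : ℝ | !₂[t, s] ∈ f '' S} := by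
    intro t
    ext s
    constructor
    · rintro ⟨x, ⟨hx0, hxS⟩, rfl⟩
      refine ⟨x, hxS, ?_⟩
      ext i
      fin_cases i
      · exact hx0
      · rfl
    · rintro ⟨x, hxS, hx⟩
      refine ⟨x, ⟨?_, hxS⟩, ?_⟩
      · simp [hx]
      · simp [hx]
  have hdist : ∀ t, ∀ x ∈ (fun x => f x 0) ⁻¹' {t} ∩ S, ∀ y ∈ (fun x => f x 0) ⁻¹' {t} ∩ S,
      dist (f x 1) (f y 1) = dist (f x) (f y) := by
    intro t x hx y hy
    have hx0 : f x 0 = t := hx.1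
    have hy0 : f y 0 = t := hy.1
    rw [EuclideanSpace.dist_eq, Fin.sum_univ_two, hx0, hy0, dist_self]
    simp
  have hvol1 : ∀ s : Set ℝ, (μHE[1] : Measure ℝ) s = volume s := fun s => by
    rw [euclideanHausdorffMeasure_one, hausdorffMeasure_real]
  have hvol2 : ∀ s : Set Plane, (μHE[2] : Measure Plane) s = volume s := fun s => by
    rw [EuclideanSpace.euclideanHausdorffMeasure_eq_volume]
  have hinv : (a : ℝ≥0∞)⁻¹ * a = 1 := ENNReal.inv_mul_cancel ha' ENNReal.coe_ne_top
  have hinv' : (a : ℝ≥0∞) * (a : ℝ≥0∞)⁻¹ = 1 := ENNReal.mul_inv_cancel ha' ENNReal.coe_ne_top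
  have hcinv : ((a⁻¹ : ℝ≥0) : ℝ≥0∞) = (a : ℝ≥0∞)⁻¹ := ENNReal.coe_inv ha
  have hI : ∫⁻ t, (a : ℝ≥0∞)⁻¹ * volume {s : ℝ | !₂[t, s] ∈ f '' S} =
      (a : ℝ≥0∞)⁻¹ * volume (f '' S) := by
    rw [lintegral_const_mul _ hm, ← hv]
  -- Up to `c`, the map scales lengths by `a` and areas by `a²`. Dividing the slice lengths by `a`
  -- recovers the length of the level set and leaves one factor `a` in front of the area.
  refine ⟨fun t => (a : ℝ≥0∞)⁻¹ * volume {s : ℝ | !₂[t, s] ∈ f '' S}, hm.const_mul _,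
    fun t => ?_, fun t => ?_, ?_, ?_⟩
  · have := euclideanHausdorffMeasure_le_mul_image (f := fun x => f x 1)
      (s := (fun x => f x 0) ⁻¹' {t} ∩ S) (K := a⁻¹ * c) (fun x hx y hy => by
        rw [hdist t x hx y hy]; exact_mod_cast hge x hx.2 y hy.2) 1
    rw [himg, hvol1, pow_one, ENNReal.coe_mul, hcinv] at this
    refine this.trans (le_of_eq ?_)
    ring
  · have hl : LipschitzOnWith (a * c) (fun x => f x 1) ((fun x => f x 0) ⁻¹' {t} ∩ S) :=
      LipschitzOnWith.of_dist_le_mul fun x hx y hy => by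
        rw [hdist t x hx y hy]; exact_mod_cast hle x hx.2 y hy.2
    have := hl.euclideanHausdorffMeasure_image_le 1
    rw [himg, hvol1, pow_one, ENNReal.coe_mul] at this
    calc _ ≤ (a : ℝ≥0∞)⁻¹ * (a * c * μHE[1] ((fun x => f x 0) ⁻¹' {t} ∩ S)) :=
          mul_le_mul_right this _
      _ = ((a : ℝ≥0∞)⁻¹ * a) * (c * μHE[1] ((fun x => f x 0) ⁻¹' {t} ∩ S)) := by ring
      _ = _ := by rw [hinv, one_mul]
  · rw [hI]
    have hl : LipschitzOnWith (a * c) f S :=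
      LipschitzOnWith.of_dist_le_mul fun x hx y hy => by exact_mod_cast hle x hx y hy
    have := hl.euclideanHausdorffMeasure_image_le 2
    rw [hvol2, hvol2, ENNReal.coe_mul] at this
    calc _ ≤ (a : ℝ≥0∞)⁻¹ * ((a * c) ^ 2 * volume S) := by gcongr
      _ = ((a : ℝ≥0∞)⁻¹ * a) * (c ^ 2 * (a * volume S)) := by ring
      _ = _ := by rw [hinv, one_mul]
  · rw [hI]
    have := euclideanHausdorffMeasure_le_mul_image (f := f) (s := S) (K := a⁻¹ * c)
      (fun x hx y hy => by exact_mod_cast hge x hx y hy) 2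
    rw [hvol2, hvol2, ENNReal.coe_mul, hcinv] at this
    calc _ ≤ (a : ℝ≥0∞) * (((a : ℝ≥0∞)⁻¹ * c) ^ 2 * volume (f '' S)) := by gcongr
      _ = (a * (a : ℝ≥0∞)⁻¹) * (c ^ 2 * ((a : ℝ≥0∞)⁻¹ * volume (f '' S))) := by ring
      _ = _ := by rw [hinv', one_mul]

/-- Complete `w` to a map `f` of the plane by the linear functional orthogonal to `A`. Then `f`
differs from the similarity `R` of ratio `‖A‖` only by the error of `w`. The tolerance `1 - c⁻¹`
makes the lower distortion exactly `c⁻¹` and the upper one `2 - c⁻¹ ≤ c`. -/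
theorem exists_coarea_sandwich_of_approximatesLinearOn {w : Plane → ℝ} (hw : Continuous w)
    {S : Set Plane} (hS : MeasurableSet S) {A : Plane →L[ℝ] ℝ} (hA : A ≠ 0) {c : ℝ≥0}
    (hc : 1 < c) (hwA : ApproximatesLinearOn w A S ((1 - c⁻¹) * ‖A‖₊)) :
    ∃ G : ℝ → ℝ≥0∞, Measurable G ∧
      (∀ t, μHE[1] (w ⁻¹' {t} ∩ S) ≤ c * G t) ∧
      (∀ t, G t ≤ c * μHE[1] (w ⁻¹' {t} ∩ S)) ∧
      ∫⁻ t, G t ≤ c ^ 2 * (‖A‖ₑ * volume S) ∧ ‖A‖ₑ * volume S ≤ c ^ 2 * ∫⁻ t, G t := by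
  set n : Plane := (InnerProductSpace.toDual ℝ Plane).symm A with hn
  have hAn : ∀ x, A x = n 0 * x 0 + n 1 * x 1 := by
    intro x
    rw [← InnerProductSpace.toDual_symm_apply (x := x) (y := A), ← hn, PiLp.inner_apply,
      Fin.sum_univ_two]
    simp [mul_comm]
  have hnorm : ‖A‖ = ‖n‖ := by rw [hn, LinearIsometryEquiv.norm_map]
  have hsq : ‖A‖ ^ 2 = n 0 ^ 2 + n 1 ^ 2 := by
    rw [hnorm, EuclideanSpace.norm_sq_eq, Fin.sum_univ_two]; simp
  let R : Plane → Plane := fun x => !₂[n 0 * x 0 + n 1 * x 1, -n 1 * x 0 + n 0 * x 1]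
  have hR : ∀ x, ‖R x‖ = ‖A‖ * ‖x‖ := by
    intro x
    have : ‖R x‖ ^ 2 = (‖A‖ * ‖x‖) ^ 2 := by
      rw [mul_pow, hsq, EuclideanSpace.norm_sq_eq, EuclideanSpace.norm_sq_eq, Fin.sum_univ_two,
        Fin.sum_univ_two]
      simp [R]
      ring
    exact (pow_left_inj₀ (norm_nonneg _) (by positivity) two_ne_zero).1 this
  let f : Plane → Plane := fun x => !₂[w x, -n 1 * x 0 + n 0 * x 1]
  have hf : Continuous f := by fun_prop
  have hf0 : (fun x => f x 0) = w := rfl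
  have hc0 : c ≠ 0 := (zero_lt_one.trans hc).ne'
  have hA0 : ‖A‖₊ ≠ 0 := by simpa using hA
  have hcR : (1 : ℝ) < c := by exact_mod_cast hc
  have hci : ((1 - c⁻¹ : ℝ≥0) : ℝ) = 1 - (c : ℝ)⁻¹ := by
    rw [NNReal.coe_sub (by simpa using inv_le_one_of_one_le₀ hc.le)]; simp
  have happ : ∀ x ∈ S, ∀ y ∈ S,
      ‖f x - f y - R (x - y)‖ ≤ (1 - (c : ℝ)⁻¹) * ‖A‖ * ‖x - y‖ := by
    intro x hx y hy
    have h := hwA x hx y hy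
    have he : f x - f y - R (x - y) = !₂[w x - w y - A (x - y), 0] := by
      ext i
      fin_cases i
      · simp [f, R, hAn]
      · simp [f, R]; ring
    rw [he, EuclideanSpace.norm_eq, Fin.sum_univ_two]
    simp only [NNReal.coe_mul, hci, coe_nnnorm] at h
    simpa [Real.sqrt_sq_eq_abs] using h
  have hAp : 0 < ‖A‖ := by simpa using hA
  have hcp : (0 : ℝ) < c := by linarith
  obtain ⟨G, h1, h2, h3, h4, h5⟩ := exists_coarea_sandwich_of_bilipschitz (c := c) hf hS hA0
    (fun x hx y hy => by
      have h := happ x hx y hy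
      have h' := hR (x - y)
      have ht := norm_sub_norm_le (f x - f y) (R (x - y))
      rw [dist_eq_norm, dist_eq_norm, coe_nnnorm]
      have hcc : 1 + (1 - (c : ℝ)⁻¹) ≤ c := by
        have : (2 : ℝ) ≤ c + (c : ℝ)⁻¹ := by
          have h0 : (0:ℝ) ≤ (c - 1) ^ 2 / c := by positivity
          have : (c - 1 : ℝ) ^ 2 / c = c + (c : ℝ)⁻¹ - 2 := by field_simp; ring
          linarith
        linarith
      calc ‖f x - f y‖ ≤ (1 + (1 - (c : ℝ)⁻¹)) * (‖A‖ * ‖x - y‖) := by linarith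
        _ ≤ c * (‖A‖ * ‖x - y‖) := by gcongr
        _ = _ := by ring)
    (fun x hx y hy => by
      have h := happ x hx y hy
      have h' := hR (x - y)
      have ht := norm_sub_norm_le (R (x - y)) (R (x - y) - (f x - f y))
      rw [norm_sub_rev (R (x - y)) (f x - f y), sub_sub_cancel] at ht
      rw [dist_eq_norm, dist_eq_norm]
      have h3 : (c : ℝ)⁻¹ * (‖A‖ * ‖x - y‖) ≤ ‖f x - f y‖ := by linarith
      have h4 : ‖x - y‖ = ‖A‖⁻¹ * c * ((c : ℝ)⁻¹ * (‖A‖ * ‖x - y‖)) := by field_simp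
      rw [h4]
      simp only [NNReal.coe_inv, coe_nnnorm]
      gcongr)
  exact ⟨G, h1, by simpa only [hf0] using h2, by simpa only [hf0] using h3, h4, h5⟩

/-- As `c → 1` the functions `G` converge pointwise to `m`. This produces measurability of `m` as
well as the value of its integral. -/
theorem measurable_and_lintegral_eq_of_sandwich {α : Type*} [MeasurableSpace α] {μ : Measure α}
    {m : α → ℝ≥0∞} {I : ℝ≥0∞}
    (h : ∀ c : ℝ≥0, 1 < c → ∃ G : α → ℝ≥0∞, Measurable G ∧ (∀ t, m t ≤ c * G t) ∧
      (∀ t, G t ≤ c * m t) ∧ ∫⁻ t, G t ∂μ ≤ c ^ 3 * I ∧ I ≤ c ^ 3 * ∫⁻ t, G t ∂μ) :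
    Measurable m ∧ ∫⁻ t, m t ∂μ = I := by
  let c : ℕ → ℝ≥0 := fun n => 1 + ((n : ℝ≥0) + 1)⁻¹
  have hc : ∀ n, 1 < c n := fun n => by simp only [c]; exact lt_add_of_pos_right _ (by positivity)
  have hlim : Tendsto c atTop (𝓝 1) := by
    have : Tendsto (fun n : ℕ => 1 + ((n : ℝ≥0) + 1)⁻¹) atTop (𝓝 (1 + 0)) := by
      refine tendsto_const_nhds.add ?_
      have := tendsto_one_div_add_atTop_nhds_zero_nat (𝕜 := ℝ≥0)
      simpa using this
    simpa using this
  have hlim' : Tendsto (fun n => (c n : ℝ≥0∞)) atTop (𝓝 1) := by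
    rw [← ENNReal.coe_one]
    exact ENNReal.tendsto_coe.2 hlim
  choose G hG h1 h2 h3 h4 using fun n => h (c n) (hc n)
  have hm : Measurable m := by
    refine measurable_of_tendsto_metrizable hG (tendsto_pi_nhds.2 fun t => ?_)
    have hlow : Tendsto (fun n => ((c n : ℝ≥0∞))⁻¹ * m t) atTop (𝓝 (1⁻¹ * m t)) :=
      ENNReal.Tendsto.mul_const (tendsto_inv_iff.2 hlim') (Or.inl (by simp))
    have hup : Tendsto (fun n => (c n : ℝ≥0∞) * m t) atTop (𝓝 (1 * m t)) :=
      ENNReal.Tendsto.mul_const hlim' (Or.inl one_ne_zero)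
    rw [inv_one, one_mul] at hlow
    rw [one_mul] at hup
    refine tendsto_of_tendsto_of_tendsto_of_le_of_le hlow hup (fun n => ?_) fun n => h2 n t
    have hc0 : (c n : ℝ≥0∞) ≠ 0 := by simpa using (zero_lt_one.trans (hc n)).ne'
    calc _ ≤ (c n : ℝ≥0∞)⁻¹ * (c n * G n t) := by gcongr; exact h1 n t
      _ = G n t := by rw [← mul_assoc, ENNReal.inv_mul_cancel hc0 ENNReal.coe_ne_top, one_mul]
  have hpow : ∀ J : ℝ≥0∞, Tendsto (fun n => (c n : ℝ≥0∞) ^ 4 * J) atTop (𝓝 J) := by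
    intro J
    have := ENNReal.Tendsto.mul_const (b := J) (ENNReal.Tendsto.pow (n := 4) hlim') (Or.inl (by simp))
    simpa using this
  refine ⟨hm, le_antisymm (ge_of_tendsto' (hpow I) fun n => ?_)
    (ge_of_tendsto' (hpow _) fun n => ?_)⟩
  · calc ∫⁻ t, m t ∂μ ≤ ∫⁻ t, c n * G n t ∂μ := lintegral_mono (h1 n)
      _ = c n * ∫⁻ t, G n t ∂μ := lintegral_const_mul _ (hG n)
      _ ≤ c n * (c n ^ 3 * I) := by gcongr; exact h3 n
      _ = _ := by ring
  · calc I ≤ c n ^ 3 * ∫⁻ t, G n t ∂μ := h4 n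
      _ ≤ c n ^ 3 * ∫⁻ t, c n * m t ∂μ := by gcongr; exact h2 n _
      _ = c n ^ 3 * (c n * ∫⁻ t, m t ∂μ) := by rw [lintegral_const_mul _ hm]
      _ = _ := by ring

end Coarea

/-! ### The coarea formula for Lipschitz functions on the plane. -/

section PlaneCoarea

theorem euclideanHausdorffMeasure_two_plane (s : Set Plane) :
    (μHE[2] : Measure Plane) s = volume s := by
  rw [EuclideanSpace.euclideanHausdorffMeasure_eq_volume]

/-- `‖A‖` and the norms of the derivatives on `S` lie in one shell of ratio `c`. Replacing `‖A‖ₑ *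
volume S` by the integral thus costs one more factor `c`. -/
theorem exists_coarea_sandwich_of_mem_Ico {w : Plane → ℝ} (hw : Continuous w)
    {S : Set Plane} (hS : MeasurableSet S) {A : Plane →L[ℝ] ℝ} {c : ℝ≥0}
    (hc : 1 < c) (hwA : ApproximatesLinearOn w A S ((1 - c⁻¹) * ‖A‖₊)) {k : ℤ}
    (hk : ‖A‖₊ ∈ Ico (c ^ k) (c ^ (k + 1)))
    (hD : ∀ x ∈ S, ‖fderiv ℝ w x‖₊ ∈ Ico (c ^ k) (c ^ (k + 1))) :
    ∃ G : ℝ → ℝ≥0∞, Measurable G ∧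
      (∀ t, μHE[1] (w ⁻¹' {t} ∩ S) ≤ c * G t) ∧
      (∀ t, G t ≤ c * μHE[1] (w ⁻¹' {t} ∩ S)) ∧
      ∫⁻ t, G t ≤ c ^ 3 * ∫⁻ x in S, ‖fderiv ℝ w x‖ₑ ∧
      ∫⁻ x in S, ‖fderiv ℝ w x‖ₑ ≤ c ^ 3 * ∫⁻ t, G t := by
  have hc0 : c ≠ 0 := (zero_lt_one.trans hc).ne'
  have hA : A ≠ 0 := by
    rintro rfl
    have := hk.1
    rw [nnnorm_zero, nonpos_iff_eq_zero] at this
    exact (zpow_ne_zero k hc0) this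
  obtain ⟨G, h1, h2, h3, h4, h5⟩ :=
    exists_coarea_sandwich_of_approximatesLinearOn hw hS hA hc hwA
  have hI1 : ‖A‖ₑ * volume S ≤ c * ∫⁻ x in S, ‖fderiv ℝ w x‖ₑ := by
    rw [← setLIntegral_const, ← lintegral_const_mul' _ _ ENNReal.coe_ne_top]
    refine setLIntegral_mono' hS fun x hx => ?_
    have hx1 := (hD x hx).1
    have : ‖A‖₊ ≤ c * ‖fderiv ℝ w x‖₊ := by
      refine hk.2.le.trans ?_
      rw [zpow_add₀ hc0, zpow_one, mul_comm]
      gcongr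
    change (‖A‖₊ : ℝ≥0∞) ≤ c * (‖fderiv ℝ w x‖₊ : ℝ≥0∞)
    exact_mod_cast this
  have hI2 : ∫⁻ x in S, ‖fderiv ℝ w x‖ₑ ≤ c * (‖A‖ₑ * volume S) := by
    rw [← setLIntegral_const, ← lintegral_const_mul' _ _ ENNReal.coe_ne_top]
    refine setLIntegral_mono' hS fun x hx => ?_
    have hx1 := (hD x hx).2
    have : ‖fderiv ℝ w x‖₊ ≤ c * ‖A‖₊ := by
      refine hx1.le.trans ?_
      rw [zpow_add₀ hc0, zpow_one, mul_comm]
      gcongr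
      exact hk.1
    change (‖fderiv ℝ w x‖₊ : ℝ≥0∞) ≤ c * (‖A‖₊ : ℝ≥0∞)
    exact_mod_cast this
  refine ⟨G, h1, h2, h3, h4.trans ?_, hI2.trans ?_⟩
  · calc _ ≤ (c : ℝ≥0∞) ^ 2 * (c * ∫⁻ x in S, ‖fderiv ℝ w x‖ₑ) := by gcongr
      _ = _ := by ring
  · calc _ ≤ (c : ℝ≥0∞) * (c ^ 2 * ∫⁻ t, G t) := by gcongr
      _ = _ := by ring

open scoped Classical in
/-- The coarea formula on the set of regular points. -/
theorem coarea_of_fderiv_ne_zero {w : Plane → ℝ} (hw : Continuous w) {s : Set Plane}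
    (hs : MeasurableSet s) (hd : ∀ x ∈ s, DifferentiableAt ℝ w x)
    (h0 : ∀ x ∈ s, fderiv ℝ w x ≠ 0) :
    Measurable (fun t => (μHE[1] : Measure Plane) (w ⁻¹' {t} ∩ s)) ∧
      ∫⁻ t, (μHE[1] : Measure Plane) (w ⁻¹' {t} ∩ s) = ∫⁻ x in s, ‖fderiv ℝ w x‖ₑ := by
  refine measurable_and_lintegral_eq_of_sandwich fun c hc => ?_
  have hc0 : c ≠ 0 := (zero_lt_one.trans hc).ne'
  -- Geometric shells for the size of the derivative; each shell is then cut into pieces on which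
  -- `w` is close to a single affine function.
  let sk : ℤ → Set Plane := fun k => {x ∈ s | ‖fderiv ℝ w x‖₊ ∈ Ico (c ^ k) (c ^ (k + 1))}
  have hsk : ∀ k, MeasurableSet (sk k) := fun k =>
    hs.inter ((measurable_fderiv ℝ w).nnnorm measurableSet_Ico)
  have hpart := fun k => exists_partition_approximatesLinearOn_of_hasFDerivWithinAt w (sk k)
    (fderiv ℝ w) (fun x hx => (hd x hx.1).hasFDerivAt.hasFDerivWithinAt)
    -- The partition theorem wants a nonzero tolerance for every `A`; the value at `A = 0` is a
    -- dummy, as the derivatives chosen on nonempty shells do not vanish.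
    (fun A => if A = 0 then 1 else (1 - c⁻¹) * ‖A‖₊) (fun A => by
      split_ifs with hA
      · exact one_ne_zero
      · refine mul_ne_zero (tsub_pos_of_lt (inv_lt_one_of_one_lt₀ hc)).ne' (by simpa using hA))
  choose t A hdisj hmeas hcov happ hex using hpart
  let P : ℤ × ℕ → Set Plane := fun p => sk p.1 ∩ t p.1 p.2
  have hP : ∀ p, MeasurableSet (P p) := fun p => (hsk p.1).inter (hmeas p.1 p.2)
  have hPd : Pairwise (Function.onFun Disjoint P) := by
    rintro ⟨k, n⟩ ⟨k', n'⟩ hne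
    rw [Function.onFun, Set.disjoint_left]
    rintro x ⟨hx, hxt⟩ ⟨hx', hxt'⟩
    have hkk : k = k' := by
      have h1 := hx.2
      have h2 := hx'.2
      have a1 := (zpow_lt_zpow_iff_right₀ hc).1 (h1.1.trans_lt h2.2)
      have a2 := (zpow_lt_zpow_iff_right₀ hc).1 (h2.1.trans_lt h1.2)
      omega
    subst hkk
    have hnn : n ≠ n' := fun h => hne (by rw [h])
    exact Set.disjoint_left.1 (hdisj k hnn) hxt hxt'
  have hPU : s = ⋃ p, P p := by
    ext x
    constructor
    · intro hx
      obtain ⟨k, hk⟩ := exists_mem_Ico_zpow (x := ‖fderiv ℝ w x‖₊) (y := c)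
        (by simpa using h0 x hx) hc
      have hxk : x ∈ sk k := ⟨hx, hk⟩
      obtain ⟨n, hn⟩ := mem_iUnion.1 (hcov k hxk)
      exact mem_iUnion.2 ⟨(k, n), hxk, hn⟩
    · intro hx
      obtain ⟨p, hp⟩ := mem_iUnion.1 hx
      exact hp.1.1
  have hpiece : ∀ p, ∃ G : ℝ → ℝ≥0∞, Measurable G ∧
      (∀ t, μHE[1] (w ⁻¹' {t} ∩ P p) ≤ c * G t) ∧
      (∀ t, G t ≤ c * μHE[1] (w ⁻¹' {t} ∩ P p)) ∧
      ∫⁻ t, G t ≤ c ^ 3 * ∫⁻ x in P p, ‖fderiv ℝ w x‖ₑ ∧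
      ∫⁻ x in P p, ‖fderiv ℝ w x‖ₑ ≤ c ^ 3 * ∫⁻ t, G t := by
    rintro ⟨k, n⟩
    rcases (sk k).eq_empty_or_nonempty with he | hne
    · refine ⟨fun _ => 0, measurable_const, ?_⟩
      simp [P, he]
    · obtain ⟨y, hy, hAy⟩ := hex k hne n
      have hAm : ‖A k n‖₊ ∈ Ico (c ^ k) (c ^ (k + 1)) := by rw [hAy]; exact hy.2
      have hA0 : A k n ≠ 0 := by rw [hAy]; exact h0 y hy.1
      have ha := happ k n
      simp only [hA0, if_false] at ha
      exact exists_coarea_sandwich_of_mem_Ico hw (hP (k, n)) hc ha hAm fun x hx => hx.1.2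
  choose G hG h1 h2 h3 h4 using hpiece
  have hm : ∀ r, μHE[1] (w ⁻¹' {r} ∩ s) = ∑' p, μHE[1] (w ⁻¹' {r} ∩ P p) := by
    intro r
    conv_lhs => rw [hPU, inter_iUnion]
    rw [measure_iUnion]
    · exact fun p q hpq => (hPd hpq).mono inter_subset_right inter_subset_right
    · exact fun p => (hw.measurable (measurableSet_singleton r)).inter (hP p)
  have hI : ∫⁻ x in s, ‖fderiv ℝ w x‖ₑ = ∑' p, ∫⁻ x in P p, ‖fderiv ℝ w x‖ₑ := by
    conv_lhs => rw [hPU]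
    exact lintegral_iUnion hP hPd _
  refine ⟨fun r => ∑' p, G p r, Measurable.tsum hG, fun r => ?_, fun r => ?_, ?_, ?_⟩
  · rw [hm, ← ENNReal.tsum_mul_left]
    exact ENNReal.tsum_le_tsum fun p => h1 p r
  · rw [hm, ← ENNReal.tsum_mul_left]
    exact ENNReal.tsum_le_tsum fun p => h2 p r
  · rw [hI, ← ENNReal.tsum_mul_left, lintegral_tsum fun p => (hG p).aemeasurable]
    exact ENNReal.tsum_le_tsum fun p => h3 p
  · rw [hI, lintegral_tsum fun p => (hG p).aemeasurable, ← ENNReal.tsum_mul_left]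
    exact ENNReal.tsum_le_tsum fun p => h4 p

/-- Almost every level set meets the set of critical points in an `ℋ¹`-null set. -/
theorem ae_slice_eq_zero_of_fderiv_eq_zero {w : Plane → ℝ} {s : Set Plane} (hs : MeasurableSet s)
    (hd : ∀ x ∈ s, HasFDerivAt w (0 : Plane →L[ℝ] ℝ) x) :
    ∀ᵐ t : ℝ, (μHE[1] : Measure Plane) (w ⁻¹' {t} ∩ s) = 0 := by
  have main : ∀ s : Set Plane, MeasurableSet s → μH[2] s ≠ ∞ →
      (∀ x ∈ s, HasFDerivAt w (0 : Plane →L[ℝ] ℝ) x) →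
      ∀ᵐ t : ℝ, (μHE[1] : Measure Plane) (w ⁻¹' {t} ∩ s) = 0 := by
    intro s hs hfin hd
    -- Zero derivative lets `s` be cut into pieces on which `w` is `1 / (n + 1)`-Lipschitz;
    -- Eilenberg's inequality on the pieces then makes the total slice integral small.
    have hδ : ∀ n : ℕ, ∃ g : ℝ → ℝ≥0∞, Measurable g ∧
        (∀ t, (μHE[1] : Measure Plane) (w ⁻¹' {t} ∩ s) ≤ g t) ∧
        ∫⁻ t, g t ≤ (((n : ℝ≥0) + 1)⁻¹ : ℝ≥0) * μH[2] s := by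
      intro n
      rcases s.eq_empty_or_nonempty with rfl | hne
      · exact ⟨0, measurable_zero, by simp, by simp⟩
      obtain ⟨t, A, hdisj, hmeas, hcov, happ, hex⟩ :=
        exists_partition_approximatesLinearOn_of_hasFDerivWithinAt w s (fun _ => 0)
          (fun x hx => (hd x hx).hasFDerivWithinAt) (fun _ => ((n : ℝ≥0) + 1)⁻¹)
          (fun _ => by positivity)
      have hlip : ∀ i, LipschitzOnWith ((n : ℝ≥0) + 1)⁻¹ w (s ∩ t i) := by
        intro i
        refine LipschitzOnWith.of_dist_le_mul fun x hx y hy => ?_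
        obtain ⟨_, _, hA⟩ := hex hne i
        have := happ i x hx y hy
        rw [hA] at this
        rw [dist_eq_norm, dist_eq_norm]
        simpa using this
      choose g hg h1 h2 using fun i => exists_measurable_ge_hausdorffMeasure_slice (hlip i)
        (ne_top_of_le_ne_top hfin (measure_mono inter_subset_left))
      have hsU : s = ⋃ i, s ∩ t i := by rw [← inter_iUnion, inter_eq_left.2 hcov]
      refine ⟨fun r => ∑' i, g i r, Measurable.tsum hg, fun r => ?_, ?_⟩
      · conv_lhs => rw [hsU, inter_iUnion]
        refine (measure_iUnion_le _).trans (ENNReal.tsum_le_tsum fun i => ?_)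
        rw [euclideanHausdorffMeasure_one]
        exact h1 i r
      · rw [lintegral_tsum fun p => (hg p).aemeasurable]
        refine (ENNReal.tsum_le_tsum h2).trans ?_
        rw [ENNReal.tsum_mul_left]
        refine mul_le_mul_right ?_ _
        rw [← measure_iUnion (fun i j hij => (hdisj hij).mono inter_subset_right
          inter_subset_right) fun i => hs.inter (hmeas i), ← hsU]
    choose g hg h1 h2 using hδ
    have hzero : ∫⁻ t, ⨅ n, g n t = 0 := by
      refine le_antisymm (ge_of_tendsto' (b := ∫⁻ t, ⨅ n, g n t) (x := atTop) (a := 0)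
        (f := fun n : ℕ => ((((n : ℝ≥0) + 1)⁻¹ : ℝ≥0) : ℝ≥0∞) * μH[2] s) ?_ fun n =>
          (lintegral_mono fun t => iInf_le _ n).trans (h2 n)) bot_le
      have h3 : Tendsto (fun n : ℕ => ((((n : ℝ≥0) + 1)⁻¹ : ℝ≥0) : ℝ≥0∞)) atTop (𝓝 0) := by
        rw [← ENNReal.coe_zero]
        refine ENNReal.tendsto_coe.2 ?_
        simpa using tendsto_one_div_add_atTop_nhds_zero_nat (𝕜 := ℝ≥0)
      simpa using ENNReal.Tendsto.mul_const h3 (Or.inr hfin)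
    rw [lintegral_eq_zero_iff (Measurable.iInf hg)] at hzero
    filter_upwards [hzero] with t ht
    exact le_antisymm ((le_iInf fun n => h1 n t).trans ht.le) bot_le
  have hall : ∀ᵐ t : ℝ, ∀ n : ℕ,
      (μHE[1] : Measure Plane) (w ⁻¹' {t} ∩ (s ∩ Metric.ball 0 n)) = 0 := by
    refine ae_all_iff.2 fun n => main _ (hs.inter Metric.isOpen_ball.measurableSet) ?_
      fun x hx => hd x hx.1
    have hv : (μHE[2] : Measure Plane) (s ∩ Metric.ball 0 n) ≠ ∞ := by
      rw [euclideanHausdorffMeasure_two_plane]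
      exact ne_top_of_le_ne_top measure_ball_lt_top.ne (measure_mono inter_subset_right)
    rw [euclideanHausdorffMeasure_eq_mul] at hv
    intro htop
    refine hv ?_
    have htop' : μH[((2 : ℕ) : ℝ)] (s ∩ Metric.ball 0 (n : ℝ)) = ∞ := by exact_mod_cast htop
    rw [htop', ENNReal.mul_top]
    simpa using addHaarScalarFactor_volume_hausdorffMeasure_ne_zero 2
  filter_upwards [hall] with t ht
  have : w ⁻¹' {t} ∩ s = ⋃ n : ℕ, w ⁻¹' {t} ∩ (s ∩ Metric.ball 0 n) := by
    rw [← inter_iUnion, ← inter_iUnion, Metric.iUnion_ball_nat, inter_univ]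
  rw [this]
  exact measure_iUnion_null ht

/-- The coarea formula for Lipschitz functions on the plane. -/
theorem coarea_plane {w : Plane → ℝ} {L : ℝ≥0} (hw : LipschitzWith L w) {E : Set Plane}
    (hE : MeasurableSet E) :
    AEMeasurable (fun t => (μHE[1] : Measure Plane) (w ⁻¹' {t} ∩ E)) ∧
      ∫⁻ t, (μHE[1] : Measure Plane) (w ⁻¹' {t} ∩ E) = ∫⁻ x in E, ‖fderiv ℝ w x‖ₑ := by
  have hDm : MeasurableSet {x | DifferentiableAt ℝ w x} := measurableSet_of_differentiableAt ℝ w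
  have hZm : MeasurableSet {x | fderiv ℝ w x = 0} :=
    (measurable_fderiv ℝ w) (measurableSet_singleton 0)
  set E0 := E ∩ {x | DifferentiableAt ℝ w x} ∩ {x | fderiv ℝ w x = 0} with hE0
  set E1 := (E ∩ {x | DifferentiableAt ℝ w x}) \ {x | fderiv ℝ w x = 0} with hE1
  set N := E \ {x | DifferentiableAt ℝ w x} with hN
  have hE1m : MeasurableSet E1 := (hE.inter hDm).diff hZm
  have hN0 : volume N = 0 := by
    refine measure_mono_null (fun x hx => hx.2) (hw.ae_differentiableAt (μ := volume))
  have h0 := ae_slice_eq_zero_of_fderiv_eq_zero (w := w) (s := E0) ((hE.inter hDm).inter hZm)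
    (fun x hx => by
      have := hx.1.2.hasFDerivAt
      rwa [show fderiv ℝ w x = 0 from hx.2] at this)
  have h1 := ae_hausdorffMeasure_slice_eq_zero (u := w) (A := N) (hw.lipschitzOnWith)
    (by rw [euclideanHausdorffMeasure_two_plane, hN0])
  obtain ⟨hm, hi⟩ := coarea_of_fderiv_ne_zero hw.continuous hE1m (fun x hx => hx.1.2)
    (fun x hx => hx.2)
  have heq : (fun t => (μHE[1] : Measure Plane) (w ⁻¹' {t} ∩ E)) =ᵐ[volume]
      fun t => (μHE[1] : Measure Plane) (w ⁻¹' {t} ∩ E1) := by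
    filter_upwards [h0, h1] with t ht0 ht1
    refine le_antisymm ?_ (measure_mono (inter_subset_inter_right _ fun x hx => hx.1.1))
    have hsub : w ⁻¹' {t} ∩ E ⊆ (w ⁻¹' {t} ∩ E1) ∪ (w ⁻¹' {t} ∩ E0) ∪ (w ⁻¹' {t} ∩ N) := by
      rintro x ⟨hxt, hxE⟩
      by_cases hxd : DifferentiableAt ℝ w x
      · by_cases hxz : fderiv ℝ w x = 0
        · exact Or.inl (Or.inr ⟨hxt, ⟨hxE, hxd⟩, hxz⟩)
        · exact Or.inl (Or.inl ⟨hxt, ⟨hxE, hxd⟩, hxz⟩)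
      · exact Or.inr ⟨hxt, hxE, hxd⟩
    refine (measure_mono hsub).trans ((measure_union_le _ _).trans ?_)
    refine (add_le_add_left (measure_union_le _ _) _).trans ?_
    rw [ht0, ht1, add_zero, add_zero]
  refine ⟨hm.aemeasurable.congr heq.symm, ?_⟩
  rw [lintegral_congr_ae heq, hi, ← lintegral_indicator hE1m, ← lintegral_indicator hE]
  refine lintegral_congr fun x => ?_
  by_cases hxE : x ∈ E
  · by_cases hx1 : x ∈ E1
    · rw [indicator_of_mem hx1, indicator_of_mem hxE]
    · rw [indicator_of_notMem hx1, indicator_of_mem hxE]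
      -- `fderiv` takes the value zero where `w` is not differentiable, so the integrand vanishes on
      -- all of `E \ E1`.
      have : fderiv ℝ w x = 0 := by
        by_contra hne
        exact hx1 ⟨⟨hxE, by_contra fun h => hne (fderiv_zero_of_not_differentiableAt h)⟩, hne⟩
      rw [this]; exact (enorm_zero (E := Plane →L[ℝ] ℝ)).symm
  · rw [indicator_of_notMem hxE, indicator_of_notMem fun h => hxE h.1.1]

end PlaneCoarea

/-! ### Pointwise Lipschitz constants. -/

section PointwiseLipschitz

variable {X Y : Type*} [MetricSpace X] [MetricSpace Y]

/-- `u` satisfies a Lipschitz estimate with constant `c` based at `x`, on `K` and near `x`. -/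
def LipBoundAt (u : X → ℝ) (K : Set X) (x : X) (c : ℝ≥0) : Prop :=
  ∃ r > 0, ∀ y ∈ K, dist y x < r → |u y - u x| ≤ c * dist y x

theorem lipOn_le_of_lipBoundAt {u : X → ℝ} {K : Set X} {x : X} {c : ℝ≥0}
    (h : LipBoundAt u K x c) : lipOn u K x ≤ c := by
  obtain ⟨r, hr, h⟩ := h
  refine iInf₂_le_of_le r hr (iSup₂_le fun s hs => iSup₂_le fun y hy => ?_)
  rw [← ENNReal.ofReal_coe_nnreal]
  refine ENNReal.ofReal_le_ofReal ?_
  rw [div_le_iff₀ hs.1]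
  have hd : dist y x < s := hy.1
  refine (h y hy.2 (hd.trans_le hs.2)).trans ?_
  gcongr

/-- `lipOn` compares the oscillation with radii `s` strictly larger than `dist y x`; letting `s`
decrease to the distance gives the bound in terms of `dist y x`. -/
theorem lipBoundAt_of_lipOn_lt {u : X → ℝ} {K : Set X} {x : X} {c : ℝ≥0}
    (h : lipOn u K x < c) : LipBoundAt u K x c := by
  unfold lipOn at h
  simp only [iInf_lt_iff] at h
  obtain ⟨r, hr, h⟩ := h
  refine ⟨r, hr, fun y hy hd => ?_⟩
  have key : ∀ s ∈ Ioo (dist y x) r, |u y - u x| ≤ c * s := by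
    intro s hs
    have hs0 : 0 < s := dist_nonneg.trans_lt hs.1
    have h1 : ENNReal.ofReal (|u y - u x| / s) ≤ c := by
      refine le_trans ?_ h.le
      refine le_iSup₂_of_le s ⟨hs0, hs.2.le⟩ ?_
      exact le_iSup₂_of_le (f := fun y _ => ENNReal.ofReal (|u y - u x| / s)) y
        ⟨Metric.mem_ball.2 hs.1, hy⟩ le_rfl
    rw [← ENNReal.ofReal_coe_nnreal] at h1
    exact (div_le_iff₀ hs0).1 ((ENNReal.ofReal_le_ofReal_iff c.2).1 h1)
  have hlim : Tendsto (fun s : ℝ => c * s) (𝓝[>] dist y x) (𝓝 (c * dist y x)) :=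
    ((continuous_const.mul continuous_id).tendsto _).mono_left nhdsWithin_le_nhds
  refine ge_of_tendsto hlim ?_
  filter_upwards [Ioo_mem_nhdsGT hd] with s hs using key s hs

theorem lipOn_le_lipOn_of_forall {u : X → ℝ} {K : Set X} {x : X} {v : Y → ℝ} {K' : Set Y} {x' : Y}
    (h : ∀ c, LipBoundAt v K' x' c → LipBoundAt u K x c) : lipOn u K x ≤ lipOn v K' x' := by
  refine le_of_forall_gt_imp_ge_of_dense fun a ha => ?_
  obtain ⟨c, hc, hca⟩ := ENNReal.lt_iff_exists_nnreal_btwn.1 ha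
  exact (lipOn_le_of_lipBoundAt (h c (lipBoundAt_of_lipOn_lt hc))).trans hca.le

theorem lipOn_le_of_lipschitzWith {u : X → ℝ} {L : ℝ≥0} (hu : LipschitzWith L u) (K : Set X)
    (x : X) : lipOn u K x ≤ L :=
  lipOn_le_of_lipBoundAt ⟨1, one_pos, fun y _ _ => by
    simpa [Real.dist_eq] using hu.dist_le_mul y x⟩

theorem lipOn_mono (u : X → ℝ) {K K' : Set X} (h : K ⊆ K') (x : X) :
    lipOn u K x ≤ lipOn u K' x :=
  lipOn_le_lipOn_of_forall fun _ ⟨r, hr, H⟩ => ⟨r, hr, fun y hy => H y (h hy)⟩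

theorem lipOn_univ_eq_of_isOpen (u : X → ℝ) {P : Set X} (hP : IsOpen P) {x : X} (hx : x ∈ P) :
    lipOn u univ x = lipOn u P x := by
  refine le_antisymm (lipOn_le_lipOn_of_forall ?_) (lipOn_mono u (subset_univ _) x)
  rintro c ⟨r, hr, H⟩
  obtain ⟨r', hr', hb⟩ := Metric.isOpen_iff.1 hP x hx
  exact ⟨min r r', lt_min hr hr', fun y _ hy =>
    H y (hb (Metric.mem_ball.2 (hy.trans_le (min_le_right _ _)))) (hy.trans_le (min_le_left _ _))⟩

theorem lipOn_eq_lipOn_image {j : X → Y} {Q : Set X} (hj : IsometryOn j Q) {u : X → ℝ} {v : Y → ℝ}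
    (huv : ∀ x ∈ Q, v (j x) = u x) {x : X} (hx : x ∈ Q) :
    lipOn u Q x = lipOn v (j '' Q) (j x) := by
  apply le_antisymm
  · refine lipOn_le_lipOn_of_forall ?_
    rintro c ⟨r, hr, H⟩
    refine ⟨r, hr, fun y hy hd => ?_⟩
    have := H (j y) (mem_image_of_mem j hy) (by rwa [hj y hy x hx])
    rwa [hj y hy x hx, huv y hy, huv x hx] at this
  · refine lipOn_le_lipOn_of_forall ?_
    rintro c ⟨r, hr, H⟩
    refine ⟨r, hr, ?_⟩
    rintro _ ⟨y, hy, rfl⟩ hd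
    rw [hj y hy x hx] at hd
    rw [hj y hy x hx, huv y hy, huv x hx]
    exact H y hy hd

/-- At a fixed scale `r` the supremum is lower semicontinuous in the centre, since a good competitor
`y` remains one for nearby centres. It is monotone in `r`, so countably many scales suffice. -/
theorem measurable_lipOn_univ [MeasurableSpace X] [BorelSpace X] {u : X → ℝ} (hu : Continuous u) :
    Measurable (lipOn u univ) := by
  let F : ℝ → X → ℝ≥0∞ := fun r x => ⨆ (s : ℝ) (_ : s ∈ Ioc 0 r), ⨆ (y : X)
    (_ : y ∈ Metric.ball x s ∩ univ), ENNReal.ofReal (|u y - u x| / s)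
  have hF : ∀ r, Measurable (F r) := by
    intro r
    refine LowerSemicontinuous.measurable fun x c hc => ?_
    simp only [F, lt_iSup_iff] at hc
    obtain ⟨s, hs, y, hy, hlt⟩ := hc
    have h1 : ∀ᶠ x' in 𝓝 x, c < ENNReal.ofReal (|u y - u x'| / s) := by
      have hcont : Continuous fun x' => ENNReal.ofReal (|u y - u x'| / s) :=
        ENNReal.continuous_ofReal.comp (by fun_prop)
      exact hcont.continuousAt.eventually (lt_mem_nhds hlt)
    have h2 : ∀ᶠ x' in 𝓝 x, y ∈ Metric.ball x' s := by
      have : Continuous fun x' => dist y x' := by fun_prop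
      exact this.continuousAt.eventually (gt_mem_nhds hy.1)
    filter_upwards [h1, h2] with x' h1 h2
    exact h1.trans_le (le_iSup₂_of_le s hs (le_iSup₂_of_le
      (f := fun y _ => ENNReal.ofReal (|u y - u x'| / s)) y ⟨h2, trivial⟩ le_rfl))
  have hmono : ∀ r r', r ≤ r' → ∀ x, F r x ≤ F r' x := fun r r' h x =>
    iSup₂_le fun s hs => le_iSup₂_of_le (f := fun s _ => ⨆ (y : X)
      (_ : y ∈ Metric.ball x s ∩ univ), ENNReal.ofReal (|u y - u x| / s)) s ⟨hs.1, hs.2.trans h⟩ le_rfl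
  have heq : lipOn u univ = fun x => ⨅ n : ℕ, F (1 / ((n : ℝ) + 1)) x := by
    ext x
    apply le_antisymm
    · exact le_iInf fun n => iInf₂_le (f := fun r _ => F r x) _ (by positivity)
    · refine le_iInf₂ fun r hr => ?_
      obtain ⟨n, hn⟩ := exists_nat_one_div_lt hr
      exact iInf_le_of_le n (hmono _ _ hn.le x)
  rw [heq]
  exact Measurable.iInf fun n => hF _

end PointwiseLipschitz

/-! ### Slope of a restriction and derivative at density points. -/

section Differentiability

theorem lipOn_univ_le_of_hasFDerivAt {w : Plane → ℝ} {D : Plane →L[ℝ] ℝ} {x : Plane}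
    (h : HasFDerivAt w D x) (K : Set Plane) : lipOn w K x ≤ ‖D‖ₑ := by
  refine le_of_forall_gt_imp_ge_of_dense fun a ha => ?_
  obtain ⟨c, hc, hca⟩ := ENNReal.lt_iff_exists_nnreal_btwn.1 ha
  have hc' : ‖D‖ < c := by
    have : (‖D‖₊ : ℝ≥0∞) < c := hc
    exact_mod_cast this
  refine le_trans (lipOn_le_of_lipBoundAt ?_) hca.le
  have := h.isLittleO.def (sub_pos.2 hc')
  obtain ⟨r, hr, H⟩ := Metric.eventually_nhds_iff.1 this
  refine ⟨r, hr, fun y _ hy => ?_⟩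
  have h1 := H hy
  have h2 := D.le_opNorm (y - x)
  have h3 := norm_sub_norm_le (w y - w x) (D (y - x))
  rw [Real.norm_eq_abs (w y - w x)] at h3
  rw [dist_eq_norm]
  linarith

/-- At almost every point of `K` the pointwise Lipschitz constant of the restriction of a Lipschitz
function to `K` is the norm of its derivative. -/
theorem ae_lipOn_eq_enorm_fderiv {w : Plane → ℝ} {L : ℝ≥0} (hw : LipschitzWith L w)
    (K : Set Plane) :
    ∀ᵐ x ∂(volume.restrict K), lipOn w K x = ‖fderiv ℝ w x‖ₑ := by
  -- The density theorem is needed for balls not centred at `x`: the ball of radius `s / n` about `x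
  -- + s • v` has `x` in its `n`-fold enlargement, and so meets `K` for small `s`. Thus `K` has
  -- points in nearly every direction `v`.
  have hdens : ∀ᵐ x ∂(volume.restrict K), ∀ n : ℕ, ∀ {ι : Type} {l : Filter ι} (c : ι → Plane)
      (δ : ι → ℝ) (_ : Tendsto δ l (𝓝[>] 0))
      (_ : ∀ᶠ j in l, x ∈ Metric.closedBall (c j) ((n : ℝ) * δ j)),
      Tendsto (fun j => volume (K ∩ Metric.closedBall (c j) (δ j)) /
        volume (Metric.closedBall (c j) (δ j))) l (𝓝 1) :=
    ae_all_iff.2 fun n => IsUnifLocDoublingMeasure.ae_tendsto_measure_inter_div volume K n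
  filter_upwards [hdens, ae_restrict_of_ae hw.ae_differentiableAt] with x hx hdx
  refine le_antisymm (lipOn_univ_le_of_hasFDerivAt hdx.hasFDerivAt K) ?_
  refine le_of_forall_gt_imp_ge_of_dense fun a ha => ?_
  obtain ⟨c, hc, hca⟩ := ENNReal.lt_iff_exists_nnreal_btwn.1 ha
  refine le_trans ?_ hca.le
  obtain ⟨r, hr, H⟩ := lipBoundAt_of_lipOn_lt hc
  set D := fderiv ℝ w x with hD
  suffices h : ‖D‖ ≤ c by
    change (‖D‖₊ : ℝ≥0∞) ≤ c
    exact_mod_cast h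
  refine D.opNorm_le_of_unit_norm c.2 fun v hv => ?_
  -- points of `K` close to `x + s v`
  have key : ∀ n : ℕ, 0 < n → |D v| ≤ c * (1 + (n : ℝ)⁻¹) + (n : ℝ)⁻¹ * (1 + (n : ℝ)⁻¹) +
      ‖D‖ * (n : ℝ)⁻¹ := by
    intro n hn
    have hn0 : (0 : ℝ) < n := by exact_mod_cast hn
    have hlim := hx n (ι := ℝ) (l := 𝓝[>] (0 : ℝ)) (fun s => x + s • v) (fun s => s * (n : ℝ)⁻¹)
      (tendsto_nhdsWithin_iff.2 ⟨by
        have : Tendsto (fun s : ℝ => s * (n : ℝ)⁻¹) (𝓝 0) (𝓝 (0 * (n : ℝ)⁻¹)) :=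
          (continuous_id.mul continuous_const).tendsto _
        rw [zero_mul] at this
        exact this.mono_left nhdsWithin_le_nhds, by
        filter_upwards [self_mem_nhdsWithin] with s hs
        exact mul_pos (show (0 : ℝ) < s from hs) (by positivity : (0 : ℝ) < (n : ℝ)⁻¹)⟩) (by
        filter_upwards [self_mem_nhdsWithin] with s hs
        have hs' : 0 < s := hs
        rw [Metric.mem_closedBall, dist_eq_norm]
        simp only [sub_add_cancel_left, norm_neg, norm_smul, hv, Real.norm_eq_abs, abs_of_pos hs']
        field_simp
        exact le_rfl)
    have hpos : ∀ᶠ s in 𝓝[>] (0 : ℝ), ∃ y ∈ K, dist y (x + s • v) ≤ s * (n : ℝ)⁻¹ := by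
      filter_upwards [hlim.eventually (lt_mem_nhds (by norm_num : (0 : ℝ≥0∞) < 1))] with s hs
      have hne : volume (K ∩ Metric.closedBall (x + s • v) (s * (n : ℝ)⁻¹)) ≠ 0 := by
        intro h0
        rw [h0, ENNReal.zero_div] at hs
        exact lt_irrefl _ hs
      obtain ⟨y, hy⟩ := nonempty_of_measure_ne_zero hne
      exact ⟨y, hy.1, hy.2⟩
    have hlit := hdx.hasFDerivAt.isLittleO.def (inv_pos.2 hn0)
    obtain ⟨r', hr', H'⟩ := Metric.eventually_nhds_iff.1 hlit
    have hm : 0 < min r r' := lt_min hr hr'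
    have hsm : ∀ᶠ s in 𝓝[>] (0 : ℝ), s ∈ Ioo 0 (min r r' / (1 + (n : ℝ)⁻¹)) :=
      Ioo_mem_nhdsGT (by positivity)
    obtain ⟨s, ⟨y, hyK, hy⟩, hs0, hs⟩ := (hpos.and hsm).exists
    rw [lt_div_iff₀ (by positivity)] at hs
    have hz : ‖y - x - s • v‖ ≤ s * (n : ℝ)⁻¹ := by
      rw [sub_sub]; rwa [dist_eq_norm] at hy
    have hyx : ‖y - x‖ ≤ s * (1 + (n : ℝ)⁻¹) := by
      have h1 := norm_add_le (y - x - s • v) (s • v)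
      rw [sub_add_cancel, norm_smul, hv, Real.norm_eq_abs, abs_of_pos hs0] at h1
      linarith
    have hd : dist y x ≤ s * (1 + (n : ℝ)⁻¹) := by rwa [dist_eq_norm]
    rw [← hD] at H'
    have e1 := H y hyK ((hd.trans_lt hs).trans_le (min_le_left _ _))
    have e2 := H' ((hd.trans_lt hs).trans_le (min_le_right _ _))
    have e3 := D.le_opNorm (y - x - s • v)
    have e4 : D (s • v) = s * D v := by simp
    have e5 : D (y - x - s • v) = D (y - x) - s * D v := by rw [map_sub, e4]
    rw [Real.norm_eq_abs] at e2 e3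
    rw [e5] at e3
    have e6 : |s * D v| ≤ c * (s * (1 + (n : ℝ)⁻¹)) + (n : ℝ)⁻¹ * (s * (1 + (n : ℝ)⁻¹)) +
        ‖D‖ * (s * (n : ℝ)⁻¹) := by
      have t1 : |s * D v| ≤ |D (y - x) - s * D v| + |w y - w x - D (y - x)| + |w y - w x| := by
        have a1 := abs_sub_abs_le_abs_sub (s * D v) (D (y - x))
        have a2 := abs_sub_abs_le_abs_sub (D (y - x)) (w y - w x)
        rw [abs_sub_comm] at a1
        rw [abs_sub_comm (D (y - x)) (w y - w x)] at a2
        linarith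
      have t2 : (c : ℝ) * dist y x ≤ c * (s * (1 + (n : ℝ)⁻¹)) := by gcongr
      have t3 : (n : ℝ)⁻¹ * ‖y - x‖ ≤ (n : ℝ)⁻¹ * (s * (1 + (n : ℝ)⁻¹)) := by gcongr
      have t4 : ‖D‖ * ‖y - x - s • v‖ ≤ ‖D‖ * (s * (n : ℝ)⁻¹) := by gcongr
      linarith
    rw [abs_mul, abs_of_pos hs0] at e6
    have e7 : s * |D v| ≤ s * (c * (1 + (n : ℝ)⁻¹) + (n : ℝ)⁻¹ * (1 + (n : ℝ)⁻¹) +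
      ‖D‖ * (n : ℝ)⁻¹) := by linarith
    exact le_of_mul_le_mul_left e7 hs0
  have hn : Tendsto (fun n : ℕ => (n : ℝ)⁻¹) atTop (𝓝 0) := tendsto_inv_atTop_nhds_zero_nat
  have hl : Tendsto (fun n : ℕ => c * (1 + (n : ℝ)⁻¹) + (n : ℝ)⁻¹ * (1 + (n : ℝ)⁻¹) +
      ‖D‖ * (n : ℝ)⁻¹) atTop (𝓝 (c * (1 + 0) + 0 * (1 + 0) + ‖D‖ * 0)) :=
    (((hn.const_add 1).const_mul _).add (hn.mul (hn.const_add 1))).add (hn.const_mul _)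
  simp only [add_zero, mul_one, mul_zero] at hl
  exact ge_of_tendsto hl (by
    filter_upwards [eventually_gt_atTop 0] with n hn using key n hn)

end Differentiability

/-! ### The slope as an upper gradient along rectifiable paths. -/

section UpperGradient

variable {X : Type*} [MetricSpace X] [MeasurableSpace X] [BorelSpace X]

/-- Subdivide the interval into equal parts. The diameter of each arc is at most its variation, and
by uniform continuity the arcs form arbitrarily fine covers. -/
theorem MetricSurface.CurvePath.hausdorffMeasure_range_le (γ : CurvePath X) :
    μH[1] (range γ.map) ≤ γ.length := by
  have hab := γ.le
  set c : ℝ → X := IccExtend hab γ.map with hc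
  have hlen : eVariationOn c (Icc γ.a γ.b) ≤ γ.length := by
    have h1 := eVariationOn.comp_le_of_monotoneOn (fun t => γ.map t) (s := univ)
      (t := Icc γ.a γ.b) (projIcc γ.a γ.b hab) ((monotone_projIcc hab).monotoneOn _)
      (fun _ _ => mem_univ _)
    exact h1
  have hcu : UniformContinuous γ.map := CompactSpace.uniformContinuous_of_continuous γ.map.continuous
  set I : ℕ → ℕ → ℝ := fun n i => γ.a + (γ.b - γ.a) / ((n : ℝ) + 1) * i with hI
  have hba : 0 ≤ γ.b - γ.a := sub_nonneg.2 hab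
  have hImono : ∀ n, Monotone (I n) := fun n i j hij => by
    simp only [hI]
    gcongr
  have hI0 : ∀ n, I n 0 = γ.a := fun n => by simp [hI]
  have hIn : ∀ n, I n (n + 1) = γ.b := fun n => by
    simp only [hI]; push_cast; field_simp; ring
  have hIsub : ∀ n, ∀ i : Fin (n + 1), Icc (I n i) (I n (i + 1)) ⊆ Icc γ.a γ.b := by
    intro n i
    rw [← hI0 n, ← hIn n]
    exact Icc_subset_Icc (hImono n (Nat.zero_le _)) (hImono n i.2)
  let t : ∀ n : ℕ, Fin (n + 1) → Set X := fun n i => c '' Icc (I n i) (I n (i + 1))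
  have hcov : ∀ n, range γ.map ⊆ ⋃ i, t n i := by
    rintro n _ ⟨s, rfl⟩
    have hex : ∃ i : ℕ, (s : ℝ) ≤ I n (i + 1) := ⟨n, by rw [hIn]; exact s.2.2⟩
    classical
    have hi := Nat.find_spec hex
    set i := Nat.find hex with hidef
    have hle : i ≤ n := Nat.find_min' hex (by rw [hIn]; exact s.2.2)
    refine mem_iUnion.2 ⟨⟨i, Nat.lt_succ_of_le hle⟩, s, ⟨?_, hi⟩, ?_⟩
    · rcases Nat.eq_zero_or_pos i with h0 | hpos
      · simp only [h0, hI0]; exact s.2.1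
      · have := Nat.find_min hex (m := i - 1) (by omega)
        rw [Nat.sub_add_cancel hpos] at this
        exact (not_le.1 this).le
    · simp [hc]
  let r : ℕ → ℝ≥0∞ := fun n => ⨆ i, Metric.ediam (t n i)
  have hr : Tendsto r atTop (𝓝 0) := by
    rw [ENNReal.tendsto_nhds_zero]
    intro ε hε
    obtain ⟨δ, hδ, H⟩ := EMetric.uniformContinuous_iff.1 hcu ε hε
    obtain ⟨δ', hδ', hδδ⟩ := ENNReal.lt_iff_exists_nnreal_btwn.1 hδ
    have hl : Tendsto (fun n : ℕ => (γ.b - γ.a) * (1 / ((n : ℝ) + 1))) atTop (𝓝 0) := by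
      simpa using (tendsto_one_div_add_atTop_nhds_zero_nat (𝕜 := ℝ)).const_mul (γ.b - γ.a)
    have hδ'' : (0 : ℝ) < δ' := by exact_mod_cast hδ'
    filter_upwards [hl.eventually (gt_mem_nhds hδ'')] with n hn
    refine iSup_le fun i => Metric.ediam_le ?_
    rintro _ ⟨s, hs, rfl⟩ _ ⟨s', hs', rfl⟩
    have hsI := hIsub n i hs
    have hsI' := hIsub n i hs'
    simp only [hc, IccExtend_of_mem _ _ hsI, IccExtend_of_mem _ _ hsI']
    refine (H (lt_of_le_of_lt ?_ hδδ)).le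
    have hd : |s - s'| ≤ (γ.b - γ.a) * (1 / ((n : ℝ) + 1)) := by
      have := Set.abs_sub_le_of_uIcc_subset_uIcc (a := I n i) (b := I n (i + 1)) (c := s') (d := s)
        (by
          rw [uIcc_of_le (hImono n (Nat.le_succ _))]
          exact uIcc_subset_Icc hs' hs)
      refine this.trans (le_of_eq ?_)
      simp only [hI]
      push_cast
      rw [show γ.a + (γ.b - γ.a) / ((n : ℝ) + 1) * ((i : ℝ) + 1) -
        (γ.a + (γ.b - γ.a) / ((n : ℝ) + 1) * i) = (γ.b - γ.a) * (1 / ((n : ℝ) + 1)) by ring]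
      exact abs_of_nonneg (by positivity)
    rw [Subtype.edist_eq, edist_dist, Real.dist_eq, ← ENNReal.ofReal_coe_nnreal]
    exact ENNReal.ofReal_le_ofReal (hd.trans hn.le)
  refine (hausdorffMeasure_le_liminf_sum 1 _ r hr t (Eventually.of_forall fun n i =>
    le_iSup (fun i => Metric.ediam (t n i)) i) (Eventually.of_forall hcov)).trans ?_
  have hsum : ∀ n, ∑ i, Metric.ediam (t n i) ^ (1 : ℝ) ≤ γ.length := by
    intro n
    refine le_trans ?_ hlen
    rw [← hI0 n, ← hIn n, ← eVariationOn.sum' c (hImono n), Finset.sum_range]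
    refine Finset.sum_le_sum fun i _ => ?_
    rw [ENNReal.rpow_one]
    refine Metric.ediam_le ?_
    rintro _ ⟨s, hs, rfl⟩ _ ⟨s', hs', rfl⟩
    exact eVariationOn.edist_le c hs hs'
  exact (liminf_le_liminf (Eventually.of_forall hsum)).trans (by simp)

/-- Disjoint Borel sets of diameter less than `r` cut `S` into pieces on which `u` is Lipschitz.
Only the cutting sets have to be measurable, not `S`. -/
theorem volume_image_le_of_uniform_local_lipschitz [SecondCountableTopology X] {u : X → ℝ}
    {S : Set X} {c : ℝ≥0} {r : ℝ} (hr : 0 < r)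
    (h : ∀ x ∈ S, ∀ y ∈ S, dist x y < r → |u x - u y| ≤ c * dist x y) :
    volume (u '' S) ≤ c * μHE[1] S := by
  rcases isEmpty_or_nonempty X with hX | hX
  · simp [Set.eq_empty_of_isEmpty S]
  let B : ℕ → Set X := fun i => Metric.ball (TopologicalSpace.denseSeq X i) (r / 2)
  have hB : ⋃ i, disjointed B i = univ := by
    rw [iUnion_disjointed, eq_univ_iff_forall]
    intro x
    obtain ⟨i, hi⟩ := (TopologicalSpace.denseRange_denseSeq X).exists_dist_lt x (half_pos hr)
    exact mem_iUnion.2 ⟨i, hi⟩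
  have hBm : ∀ i, MeasurableSet (disjointed B i) :=
    MeasurableSet.disjointed fun i => Metric.isOpen_ball.measurableSet
  have hpiece : ∀ i, volume (u '' (S ∩ disjointed B i)) ≤ c * μHE[1] (S ∩ disjointed B i) := by
    intro i
    have hl : LipschitzOnWith c u (S ∩ disjointed B i) := by
      refine LipschitzOnWith.of_dist_le_mul fun x hx y hy => ?_
      refine h x hx.1 y hy.1 ?_
      have h1 := Metric.mem_ball.1 (disjointed_subset B i hx.2)
      have h2 := Metric.mem_ball.1 (disjointed_subset B i hy.2)
      have := dist_triangle_right x y (TopologicalSpace.denseSeq X i)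
      linarith
    have := hl.euclideanHausdorffMeasure_image_le 1
    rwa [euclideanHausdorffMeasure_one, hausdorffMeasure_real, pow_one] at this
  have hS : S = ⋃ i, S ∩ disjointed B i := by rw [← inter_iUnion, hB, inter_univ]
  calc volume (u '' S) ≤ ∑' i, volume (u '' (S ∩ disjointed B i)) := by
        conv_lhs => rw [hS, image_iUnion]
        exact measure_iUnion_le _
    _ ≤ ∑' i, c * μHE[1] (S ∩ disjointed B i) := ENNReal.tsum_le_tsum hpiece
    _ = c * ∑' i, (μHE[1] : Measure X).restrict S (disjointed B i) := by
        rw [ENNReal.tsum_mul_left]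
        congr 2
        ext i
        rw [Measure.restrict_apply (hBm i), inter_comm]
    _ = c * μHE[1] S := by
        rw [← measure_iUnion (disjoint_disjointed B) hBm, hB, Measure.restrict_apply_univ]

/-- `S` is the increasing union of the sets on which the slope bound holds at the uniform scale `1 /
(j + 1)`, and measures are continuous along such unions even without measurability. -/
theorem volume_image_le_mul_of_lipOn_lt [SecondCountableTopology X] {u : X → ℝ}
    {S : Set X} {c : ℝ≥0} (h : ∀ x ∈ S, lipOn u univ x < c) :
    volume (u '' S) ≤ c * μHE[1] S := by
  let T : ℕ → Set X := fun j => {x ∈ S | ∀ y, dist y x < 1 / ((j : ℝ) + 1) →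
    |u y - u x| ≤ c * dist y x}
  have hT : Monotone T := by
    intro i j hij x hx
    refine ⟨hx.1, fun y hy => hx.2 y (hy.trans_le ?_)⟩
    gcongr
  have hU : S = ⋃ j, T j := by
    ext x
    constructor
    · intro hx
      obtain ⟨r, hr, H⟩ := lipBoundAt_of_lipOn_lt (h x hx)
      obtain ⟨n, hn⟩ := exists_nat_one_div_lt hr
      exact mem_iUnion.2 ⟨n, hx, fun y hy => H y trivial (hy.trans hn)⟩
    · intro hx
      obtain ⟨j, hj⟩ := mem_iUnion.1 hx
      exact hj.1
  conv_lhs => rw [hU, image_iUnion]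
  rw [Monotone.measure_iUnion fun i j hij => image_mono (hT hij)]
  refine iSup_le fun j => ?_
  refine (volume_image_le_of_uniform_local_lipschitz (r := 1 / ((j : ℝ) + 1)) (c := c)
    (by positivity) fun x hx y hy hd => ?_).trans
    (mul_le_mul_right (measure_mono fun x hx => hx.1) _)
  exact hy.2 x hd

/-- Cut `A` into layers on which the slope varies by at most `η`. The resulting error `η * μHE[1] A`
tends to zero because `A` has finite length. -/
theorem volume_image_le_lintegral_lipOn [SecondCountableTopology X] {u : X → ℝ} {L : ℝ≥0}
    (hu : LipschitzWith L u) {A : Set X} (hA : MeasurableSet A) (hfin : μHE[1] A ≠ ∞) :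
    volume (u '' A) ≤ ∫⁻ x in A, lipOn u univ x ∂μHE[1] := by
  have hlm := measurable_lipOn_univ hu.continuous
  have key : ∀ η : ℝ≥0, 0 < η →
      volume (u '' A) ≤ ∫⁻ x in A, lipOn u univ x ∂μHE[1] + η * μHE[1] A := by
    intro η hη
    let S : ℕ → Set X := fun k => A ∩ lipOn u univ ⁻¹' Ico ((k * η : ℝ≥0) : ℝ≥0∞)
      (((k + 1) * η : ℝ≥0) : ℝ≥0∞)
    have hS : ∀ k, MeasurableSet (S k) := fun k => hA.inter (hlm measurableSet_Ico)
    have hSd : Pairwise (Function.onFun Disjoint S) := by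
      have aux : ∀ k l, k < l → Disjoint (S k) (S l) := by
        intro k l hkl
        rw [Set.disjoint_left]
        intro x hx hx'
        have h1 := hx'.2.1.trans_lt hx.2.2
        have h2 : ((l : ℝ≥0) * η) < (k + 1) * η := by exact_mod_cast h1
        have h3 : (l : ℝ≥0) < k + 1 := lt_of_mul_lt_mul_right h2 (by positivity)
        have h4 : l < k + 1 := by exact_mod_cast h3
        omega
      intro k l hkl
      rcases lt_or_gt_of_ne hkl with h | h
      · exact aux k l h
      · exact (aux l k h).symm
    have hSU : A = ⋃ k, S k := by
      ext x
      constructor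
      · intro hx
        have hne : lipOn u univ x ≠ ∞ :=
          ne_top_of_le_ne_top ENNReal.coe_ne_top (lipOn_le_of_lipschitzWith hu univ x)
        obtain ⟨v, hv⟩ : ∃ v : ℝ≥0, (v : ℝ≥0∞) = lipOn u univ x := ⟨_, ENNReal.coe_toNNReal hne⟩
        refine mem_iUnion.2 ⟨⌊v / η⌋₊, hx, ?_, ?_⟩
        · rw [← hv]
          have := Nat.floor_le (a := v / η) zero_le
          have h2 := (le_div_iff₀ hη).1 this
          exact_mod_cast h2
        · rw [← hv]
          have := Nat.lt_floor_add_one (v / η)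
          have h2 := (div_lt_iff₀ hη).1 this
          exact_mod_cast h2
      · intro hx
        obtain ⟨k, hk⟩ := mem_iUnion.1 hx
        exact hk.1
    calc volume (u '' A) ≤ ∑' k, volume (u '' S k) := by
          conv_lhs => rw [hSU, image_iUnion]
          exact measure_iUnion_le _
      _ ≤ ∑' k, ∫⁻ x in S k, (lipOn u univ x + η) ∂μHE[1] := by
          refine ENNReal.tsum_le_tsum fun k => ?_
          refine (volume_image_le_mul_of_lipOn_lt (c := (k + 1) * η) fun x hx => hx.2.2).trans ?_
          rw [← setLIntegral_const]
          refine setLIntegral_mono' (hS k) fun x hx => ?_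
          rw [add_mul, one_mul, ENNReal.coe_add]
          gcongr
          exact hx.2.1
      _ = ∫⁻ x in A, (lipOn u univ x + η) ∂μHE[1] := by
          conv_rhs => rw [hSU]
          rw [lintegral_iUnion hS hSd]
      _ = _ := by
          rw [lintegral_add_left hlm, setLIntegral_const]
  have hlim : Tendsto (fun n : ℕ => ∫⁻ x in A, lipOn u univ x ∂μHE[1] +
      ((((n : ℝ≥0) + 1)⁻¹ : ℝ≥0) : ℝ≥0∞) * μHE[1] A) atTop
      (𝓝 (∫⁻ x in A, lipOn u univ x ∂μHE[1] + 0 * μHE[1] A)) := by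
    refine tendsto_const_nhds.add (ENNReal.Tendsto.mul_const ?_ (Or.inr hfin))
    rw [← ENNReal.coe_zero]
    refine ENNReal.tendsto_coe.2 ?_
    simpa using tendsto_one_div_add_atTop_nhds_zero_nat (𝕜 := ℝ≥0)
  rw [zero_mul, add_zero] at hlim
  exact ge_of_tendsto' hlim fun n => key _ (by positivity)

/-- The pointwise Lipschitz constant of a Lipschitz function is an upper gradient along rectifiable
paths that avoid `C`. -/
theorem edist_le_pathIntegral_lipOn [SecondCountableTopology X] {u : X → ℝ} {L : ℝ≥0}
    (hu : LipschitzWith L u) {C : Set X} (γ : CurvePath X) (hγ : γ.Rectifiable)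
    (hC : ∀ t, γ.map t ∉ C) :
    edist (u γ.source) (u γ.target) ≤ γ.pathIntegral (Cᶜ.indicator (lipOn u univ)) := by
  have hcomp : IsCompact (range γ.map) := isCompact_range γ.map.continuous
  have hfin : μHE[1] (range γ.map) ≠ ∞ := by
    rw [euclideanHausdorffMeasure_one]
    exact ((CurvePath.hausdorffMeasure_range_le γ).trans_lt hγ).ne
  have hpre : IsPreconnected (u '' range γ.map) := by
    have : PreconnectedSpace (Icc γ.a γ.b) := Subtype.preconnectedSpace isPreconnected_Icc
    exact (isPreconnected_range γ.map.continuous).image _ hu.continuous.continuousOn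
  -- The image of the path under `u` is connected, so its length bounds the increment. It remains to
  -- estimate that length; the multiplicity in the path integral is at least one on the range.
  have hsub : uIcc (u γ.source) (u γ.target) ⊆ u '' range γ.map :=
    hpre.ordConnected.uIcc_subset ⟨_, mem_range_self _, rfl⟩ ⟨_, mem_range_self _, rfl⟩
  have hvol : volume (uIcc (u γ.source) (u γ.target)) = edist (u γ.source) (u γ.target) := by
    rw [Real.volume_interval, edist_dist, Real.dist_eq, abs_sub_comm]
  rw [← hvol]
  refine (measure_mono hsub).trans
    ((volume_image_le_lintegral_lipOn hu hcomp.isClosed.measurableSet hfin).trans ?_)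
  rw [← lintegral_indicator hcomp.isClosed.measurableSet]
  refine lintegral_mono fun x => ?_
  by_cases hx : x ∈ range γ.map
  · rw [indicator_of_mem hx]
    obtain ⟨t, rfl⟩ := hx
    rw [indicator_of_mem (show γ.map t ∈ Cᶜ from hC t)]
    have h1 : (1 : ℝ≥0∞) ≤ ((γ.map ⁻¹' {γ.map t}).encard : ℝ≥0∞) := by
      have : (1 : ℕ∞) ≤ (γ.map ⁻¹' {γ.map t}).encard := one_le_encard_iff_nonempty.2 ⟨t, rfl⟩
      exact_mod_cast this
    calc _ = 1 * lipOn u univ (γ.map t) := (one_mul _).symm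
      _ ≤ _ := by gcongr
  · rw [indicator_of_notMem hx]
    exact bot_le

end UpperGradient

/-! ### Families of modulus zero and planar charts. -/

section Modulus

variable {X : Type*} [MetricSpace X] [MeasurableSpace X] [BorelSpace X]

theorem modulus_empty {p : ℝ≥0∞} (hp : 1 ≤ p) : modulus p (∅ : Set (CurvePath X)) = 0 := by
  have h0 : Admissible (fun _ : X => (0 : ℝ≥0∞)) ∅ := ⟨measurable_const, by simp⟩
  unfold modulus
  split_ifs with h
  · exact le_antisymm (iInf₂_le_of_le _ h0 (le_of_eq (essSup_const_bot (β := ℝ≥0∞)))) bot_le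
  · have : 0 < p.toReal := ENNReal.toReal_pos (zero_lt_one.trans_le hp).ne' h
    exact le_antisymm (iInf₂_le_of_le _ h0 (by simp [this])) bot_le

/-- On a space of finite area Hölder's inequality bounds the `L¹` norm by the `Lᵖ` norm. This
reduces all exponents, including `∞`, to smallness in `L¹`. -/
theorem exists_admissible_lintegral_le_of_modulus_eq_zero {p : ℝ≥0∞} (hp : 1 ≤ p)
    (hfin : (μHE[2] : Measure X) univ ≠ ∞) {Γ : Set (CurvePath X)} (hΓ : modulus p Γ = 0)
    {ε : ℝ≥0∞} (hε : 0 < ε) :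
    ∃ ρ : X → ℝ≥0∞, Admissible ρ Γ ∧ ∫⁻ x, ρ x ∂μHE[2] ≤ ε := by
  set M := (μHE[2] : Measure X) univ ^ (1 / (1 : ℝ≥0∞).toReal - 1 / p.toReal) with hM
  have hexp : 0 ≤ 1 / (1 : ℝ≥0∞).toReal - 1 / p.toReal := by
    rcases eq_or_ne p ∞ with h | h
    · simp [h]
    · have : 1 ≤ p.toReal := by simpa using ENNReal.toReal_mono h hp
      have h2 : 1 / p.toReal ≤ 1 := by rw [div_le_one (by linarith)]; exact this
      simpa using h2
  have hMtop : M ≠ ∞ := ENNReal.rpow_ne_top_of_nonneg hexp hfin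
  -- it suffices to make the `L^p` norm small
  suffices h : ∀ δ : ℝ≥0∞, 0 < δ → ∃ ρ : X → ℝ≥0∞, Admissible ρ Γ ∧ eLpNorm ρ p μHE[2] ≤ δ by
    obtain ⟨δ, hδ, hδM⟩ : ∃ δ : ℝ≥0∞, 0 < δ ∧ δ * M ≤ ε := by
      rcases eq_or_ne ε ∞ with h | h
      · exact ⟨1, one_pos, by simp [h]⟩
      rcases eq_or_ne M 0 with h0 | h0
      · exact ⟨1, one_pos, by simp [h0]⟩
      · exact ⟨ε / M, ENNReal.div_pos hε.ne' hMtop, (ENNReal.div_mul_cancel h0 hMtop).le⟩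
    obtain ⟨ρ, hρ, hle⟩ := h δ hδ
    refine ⟨ρ, hρ, ?_⟩
    have h1 := eLpNorm_le_eLpNorm_mul_rpow_measure_univ (μ := (μHE[2] : Measure X)) (f := ρ) hp
      hρ.1.aestronglyMeasurable
    rw [eLpNorm_one_eq_lintegral_enorm] at h1
    refine le_trans ?_ (h1.trans ((mul_le_mul_left hle _).trans hδM))
    simp
  intro δ hδ
  unfold modulus at hΓ
  split_ifs at hΓ with h
  · have h1 : (⨅ (ρ : X → ℝ≥0∞) (_ : Admissible ρ Γ), essSup ρ (μHE[2] : Measure X)) < δ := by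
      rw [hΓ]; exact hδ
    simp only [iInf_lt_iff] at h1
    obtain ⟨ρ, hρ, hlt⟩ := h1
    refine ⟨ρ, hρ, ?_⟩
    rw [h, eLpNorm_exponent_top]
    exact hlt.le
  · have hp0 : 0 < p.toReal := ENNReal.toReal_pos (zero_lt_one.trans_le hp).ne' h
    have h1 : (⨅ (ρ : X → ℝ≥0∞) (_ : Admissible ρ Γ),
        ∫⁻ x, ρ x ^ p.toReal ∂(μHE[2] : Measure X)) < δ ^ p.toReal := by
      rw [hΓ]; exact ENNReal.rpow_pos_of_nonneg hδ hp0.le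
    simp only [iInf_lt_iff] at h1
    obtain ⟨ρ, hρ, hlt⟩ := h1
    refine ⟨ρ, hρ, ?_⟩
    rw [eLpNorm_eq_lintegral_rpow_enorm_toReal (zero_lt_one.trans_le hp).ne' h]
    refine (ENNReal.rpow_le_rpow hlt.le (by positivity)).trans ?_
    rw [← ENNReal.rpow_mul, mul_one_div_cancel hp0.ne', ENNReal.rpow_one]

theorem pathIntegral_of_isometry (γ : CurvePath X) (hγ : Isometry γ.map) {ρ : X → ℝ≥0∞}
    {F : ℝ → ℝ≥0∞} (hF : ∀ t : Icc γ.a γ.b, F t = ρ (γ.map t)) :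
    γ.pathIntegral ρ = ∫⁻ t in Icc γ.a γ.b, F t := by
  have hemb : MeasurableEmbedding γ.map := hγ.isClosedEmbedding.measurableEmbedding
  have h1 : γ.pathIntegral ρ = ∫⁻ x in range γ.map, ρ x ∂μHE[1] := by
    unfold CurvePath.pathIntegral
    rw [← lintegral_indicator hemb.measurableSet_range]
    refine lintegral_congr fun x => ?_
    by_cases hx : x ∈ range γ.map
    · rw [indicator_of_mem hx]
      obtain ⟨t, rfl⟩ := hx
      have : γ.map ⁻¹' {γ.map t} = {t} := by
        ext s
        simp [hγ.injective.eq_iff]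
      rw [this, encard_singleton]
      simp
    · rw [indicator_of_notMem hx]
      have : γ.map ⁻¹' {x} = ∅ := by
        ext s
        simp only [mem_preimage, mem_singleton_iff, mem_empty_iff_false, iff_false]
        rintro rfl
        exact hx (mem_range_self s)
      rw [this]
      simp
  have h3 : (volume : Measure ℝ).restrict (Icc γ.a γ.b) =
      (μH[1] : Measure (Icc γ.a γ.b)).map Subtype.val := by
    rw [isometry_subtype_coe.map_hausdorffMeasure (Or.inl zero_le_one), Subtype.range_val,
      hausdorffMeasure_real]
  rw [h1, euclideanHausdorffMeasure_one, ← hγ.map_hausdorffMeasure (Or.inl zero_le_one),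
    hemb.lintegral_map, h3, (MeasurableEmbedding.subtype_coe measurableSet_Icc).lintegral_map]
  exact lintegral_congr fun t => (hF t).symm

theorem map_restrict_of_isometryOn {j : X → Plane} (hj : Continuous j) {Q : Set X}
    (hQ : IsometryOn j Q) :
    ((μHE[2] : Measure X).restrict Q).map j = volume.restrict (j '' Q) := by
  ext B hB
  rw [Measure.map_apply hj.measurable hB, Measure.restrict_apply (hj.measurable hB),
    Measure.restrict_apply hB, ← euclideanHausdorffMeasure_two_plane,
    ← (hQ.mono inter_subset_right).euclideanHausdorffMeasure_image, image_preimage_inter]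

end Modulus

section

variable {X : Type*} [MetricSpace X]

/-- `j` restricts to an isometry from `P` onto a subset of the plane, and has inverse `k` there. -/
structure PlanarChart (P : Set X) (j : X → Plane) (k : Plane → X) : Prop where
  continuous : Continuous j
  isometryOn : IsometryOn j P
  leftInv : ∀ x ∈ P, k (j x) = x

namespace PlanarChart

variable {P : Set X} {j : X → Plane} {k : Plane → X}

theorem map_mem (h : PlanarChart P j k) {y : Plane} (hy : y ∈ j '' P) : k y ∈ P := by
  obtain ⟨x, hx, rfl⟩ := hy
  rwa [h.leftInv x hx]

theorem rightInv (h : PlanarChart P j k) {y : Plane} (hy : y ∈ j '' P) : j (k y) = y := by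
  obtain ⟨x, hx, rfl⟩ := hy
  rw [h.leftInv x hx]

theorem isometryOn_symm (h : PlanarChart P j k) : IsometryOn k (j '' P) :=
  h.isometryOn.of_leftInvOn h.leftInv

end PlanarChart

end

/-! ### The upper gradient inequality on almost every segment. -/

section Minimality

variable {X : Type*} [MetricSpace X] [MeasurableSpace X] [BorelSpace X]

namespace PlanarChart

variable {P : Set X} {j : X → Plane} {k : Plane → X}

theorem measurable_indicator (h : PlanarChart P j k) (hO : MeasurableSet (j '' P))
    {ρ : X → ℝ≥0∞} (hρ : Measurable ρ) : Measurable ((j '' P).indicator (ρ ∘ k)) := by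
  have hk : ContinuousOn k (j '' P) := h.isometryOn_symm.lipschitzOnWith.continuousOn
  classical
  have h1 : Measurable ((j '' P).piecewise k fun _ => k 0) :=
    hk.measurable_piecewise continuousOn_const hO
  have h2 := (hρ.comp h1).indicator hO
  convert h2 using 1
  ext y
  by_cases hy : y ∈ j '' P
  · simp [hy]
  · rw [indicator_of_notMem hy, indicator_of_notMem hy]

theorem lintegral_indicator (h : PlanarChart P j k) (hO : MeasurableSet (j '' P))
    {ρ : X → ℝ≥0∞} (hρ : Measurable ρ) (hP : MeasurableSet P) :
    ∫⁻ y, (j '' P).indicator (ρ ∘ k) y = ∫⁻ x in P, ρ x ∂μHE[2] := by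
  have h1 : ∫⁻ y, (j '' P).indicator (ρ ∘ k) y =
      ∫⁻ y in j '' P, (j '' P).indicator (ρ ∘ k) y := by
    rw [MeasureTheory.lintegral_indicator hO]
    exact setLIntegral_congr_fun hO fun y hy => (indicator_of_mem hy _).symm
  rw [h1, ← map_restrict_of_isometryOn h.continuous h.isometryOn,
    lintegral_map (h.measurable_indicator hO hρ) h.continuous.measurable]
  refine setLIntegral_congr_fun hP fun x hx => ?_
  simp [indicator_of_mem (mem_image_of_mem j hx), h.leftInv x hx]

/-- The image in `X` of a segment of the plane. -/
noncomputable def segmentPath (h : PlanarChart P j k) (v : Plane) {l : ℝ} (hl : 0 ≤ l) (y : Plane)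
    (hy : ∀ t ∈ Icc 0 l, y + t • v ∈ j '' P) : CurvePath X where
  a := 0
  b := l
  le := hl
  map := ⟨fun t => k (y + (t : ℝ) • v), by
    have hk : ContinuousOn k (j '' P) := h.isometryOn_symm.lipschitzOnWith.continuousOn
    exact hk.comp_continuous (by fun_prop) fun t => hy t t.2⟩

theorem isometry_segmentPath (h : PlanarChart P j k) {v : Plane} (hv : ‖v‖ = 1) {l : ℝ}
    (hl : 0 ≤ l) {y : Plane} (hy : ∀ t ∈ Icc 0 l, y + t • v ∈ j '' P) :
    Isometry (h.segmentPath v hl y hy).map := by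
  refine Isometry.of_dist_eq fun s t => ?_
  have := h.isometryOn_symm _ (hy s s.2) _ (hy t t.2)
  change dist (k (y + (s : ℝ) • v)) (k (y + (t : ℝ) • v)) = _
  rw [this, dist_add_left, dist_eq_norm, ← sub_smul, norm_smul, hv, mul_one, Subtype.dist_eq,
    Real.dist_eq, Real.norm_eq_abs]

theorem pathIntegral_segmentPath (h : PlanarChart P j k) {v : Plane} (hv : ‖v‖ = 1) {l : ℝ}
    (hl : 0 ≤ l) {y : Plane} (hy : ∀ t ∈ Icc 0 l, y + t • v ∈ j '' P) (ρ : X → ℝ≥0∞) :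
    (h.segmentPath v hl y hy).pathIntegral ρ =
      ∫⁻ t in Icc 0 l, (j '' P).indicator (ρ ∘ k) (y + t • v) :=
  pathIntegral_of_isometry (F := fun t => (j '' P).indicator (ρ ∘ k) (y + t • v)) _
    (h.isometry_segmentPath hv hl hy) fun t => indicator_of_mem (hy t t.2) _

/-- Fubini and translation invariance: averaging over all translates of a segment gives an area
integral, which links path families to modulus. -/
theorem lintegral_lintegral_translate {r : Plane → ℝ≥0∞} (hr : Measurable r) (v : Plane)
    (l : ℝ) :
    Measurable (fun y => ∫⁻ t in Icc 0 l, r (y + t • v)) ∧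
      ∫⁻ y, ∫⁻ t in Icc 0 l, r (y + t • v) = ENNReal.ofReal l * ∫⁻ y, r y := by
  have hm : Measurable (Function.uncurry fun (y : Plane) (t : ℝ) => r (y + t • v)) :=
    hr.comp (by fun_prop)
  refine ⟨hm.lintegral_prod_right', ?_⟩
  rw [lintegral_lintegral_swap hm.aemeasurable]
  simp only [lintegral_add_right_eq_self (μ := (volume : Measure Plane)) r]
  rw [setLIntegral_const, Real.volume_Icc, sub_zero, mul_comm]

/-- Almost every segment of given length and direction satisfies the upper gradient inequality. -/
theorem ae_edist_le (h : PlanarChart P j k) (hP : MeasurableSet P) (hO : MeasurableSet (j '' P))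
    (hfin : (μHE[2] : Measure X) univ ≠ ∞) {p : ℝ≥0∞} (hp : 1 ≤ p) {u : X → ℝ} {ρ : X → ℝ≥0∞}
    (hu : IsWeakUpperGradient p u ρ) {v : Plane} (hv : ‖v‖ = 1) {l : ℝ} (hl : 0 ≤ l) :
    ∀ᵐ y : Plane, (∀ t ∈ Icc 0 l, y + t • v ∈ j '' P) →
      edist (u (k y)) (u (k (y + l • v))) ≤
        ∫⁻ t in Icc 0 l, (j '' P).indicator (ρ ∘ k) (y + t • v) := by
  obtain ⟨hρ, Γ, hΓ, hug⟩ := hu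
  set B : Set Plane := {y | ∃ hy : ∀ t ∈ Icc 0 l, y + t • v ∈ j '' P,
    h.segmentPath v hl y hy ∈ Γ} with hB
  -- A function admissible for `Γ` has integral at least one along each bad segment. By Markov's
  -- inequality the set of their starting points has area at most `l` times the small `L¹` norm; it
  -- need not be measurable for this.
  have hB0 : volume B = 0 := by
    have key : ∀ ε : ℝ≥0, 0 < ε → volume B ≤ ENNReal.ofReal l * ε := by
      intro ε hε
      obtain ⟨ρ', hadm, hle⟩ := exists_admissible_lintegral_le_of_modulus_eq_zero hp hfin hΓ
        (ε := ε) (by exact_mod_cast hε)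
      obtain ⟨hm, hint⟩ := lintegral_lintegral_translate (h.measurable_indicator hO hadm.1) v l
      rw [h.lintegral_indicator hO hadm.1 hP] at hint
      have hsub : B ⊆ {y | 1 ≤ ∫⁻ t in Icc 0 l, (j '' P).indicator (ρ' ∘ k) (y + t • v)} := by
        rintro y ⟨hy, hyΓ⟩
        have := hadm.2 _ hyΓ
        rwa [h.pathIntegral_segmentPath hv hl hy] at this
      calc volume B ≤ _ := measure_mono hsub
        _ ≤ ∫⁻ y, ∫⁻ t in Icc 0 l, (j '' P).indicator (ρ' ∘ k) (y + t • v) := by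
            have := mul_meas_ge_le_lintegral (μ := (volume : Measure Plane)) hm 1
            rwa [one_mul] at this
        _ = ENNReal.ofReal l * ∫⁻ x in P, ρ' x ∂μHE[2] := hint
        _ ≤ _ := by
            gcongr
            exact (setLIntegral_le_lintegral _ _).trans hle
    refine le_antisymm ?_ bot_le
    have hlim : Tendsto (fun n : ℕ => ENNReal.ofReal l * ((((n : ℝ≥0) + 1)⁻¹ : ℝ≥0) : ℝ≥0∞)) atTop
        (𝓝 (ENNReal.ofReal l * 0)) := by
      refine ENNReal.Tendsto.const_mul ?_ (Or.inr ENNReal.ofReal_ne_top)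
      rw [← ENNReal.coe_zero]
      refine ENNReal.tendsto_coe.2 ?_
      simpa using tendsto_one_div_add_atTop_nhds_zero_nat (𝕜 := ℝ≥0)
    rw [mul_zero] at hlim
    exact ge_of_tendsto' hlim fun n => key _ (by positivity)
  filter_upwards [measure_eq_zero_iff_ae_notMem.1 hB0] with y hyB hy
  have hnot : h.segmentPath v hl y hy ∉ Γ := fun hh => hyB ⟨hy, hh⟩
  have hiso := h.isometry_segmentPath hv hl hy
  have hrect : (h.segmentPath v hl y hy).Rectifiable := by
    have hl1 : LipschitzWith 1 (h.segmentPath v hl y hy).map := hiso.lipschitz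
    unfold CurvePath.Rectifiable CurvePath.length
    have h1 := (hl1.lipschitzOnWith (s := univ)).comp_eVariationOn_le (mapsTo_univ
      (id : Icc (0 : ℝ) l → Icc (0 : ℝ) l) univ)
    have h2 : eVariationOn (id : Icc (0 : ℝ) l → Icc (0 : ℝ) l) univ < ∞ := by
      have h3 : eVariationOn (Subtype.val : Icc (0 : ℝ) l → ℝ) univ < ∞ := by
        have hmono : MonotoneOn (fun x : ℝ => x) (Icc 0 l) := fun _ _ _ _ hxy => hxy
        have h4 := eVariationOn.comp_le_of_monotoneOn (fun x : ℝ => x) (s := Icc 0 l)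
          (t := (univ : Set (Icc (0 : ℝ) l))) Subtype.val (Subtype.mono_coe _ |>.monotoneOn _)
          (fun t _ => t.2)
        refine h4.trans_lt ?_
        have h5 := hmono.eVariationOn_eq (a := 0) (b := l) (left_mem_Icc.2 hl)
          (right_mem_Icc.2 hl)
        rw [inter_self] at h5
        rw [h5]
        exact ENNReal.ofReal_lt_top
      exact h3
    exact h1.trans_lt (ENNReal.mul_lt_top (by simp) h2)
  have := hug _ hrect hnot
  rw [h.pathIntegral_segmentPath hv hl hy] at this
  refine le_trans (le_of_eq ?_) this
  change _ = edist (u (k (y + (0 : ℝ) • v))) (u (k (y + l • v)))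
  rw [zero_smul, add_zero]

end PlanarChart

end Minimality

/-! ### Lower bounds for weak upper gradients on planar pieces. -/

section Minimality

variable {X : Type*} [MetricSpace X] [MeasurableSpace X] [BorelSpace X]

/-- If difference quotients of a Lipschitz function `w` are controlled on an open set by averages
of `r` along segments, then so are its directional derivatives by `r`. -/
theorem ae_enorm_fderiv_apply_le {w : Plane → ℝ} {L : ℝ≥0} (hw : LipschitzWith L w)
    {O : Set Plane} (hO : IsOpen O) {r : Plane → ℝ≥0∞} (hr : Measurable r)
    (hfin : ∫⁻ y, r y ≠ ∞) {v : Plane} (hv : ‖v‖ = 1)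
    (h : ∀ l : ℝ, 0 ≤ l → ∀ᵐ y : Plane, (∀ t ∈ Icc 0 l, y + t • v ∈ O) →
      edist (w y) (w (y + l • v)) ≤ ∫⁻ t in Icc 0 l, r (y + t • v)) :
    ∀ᵐ y ∂(volume.restrict O), ‖fderiv ℝ w y v‖ₑ ≤ r y := by
  have hDm : Measurable fun y => ‖fderiv ℝ w y v‖ₑ := (measurable_fderiv_apply_const ℝ w v).enorm
  -- Fatou's lemma for difference quotients of step `l n`. Segments of that length starting in `K`
  -- stay in the `l n`-thickening of `K`, whose mass with respect to `r` tends to that of `K`.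
  have hcomp : ∀ K : Set Plane, IsCompact K → K ⊆ O →
      ∫⁻ y in K, ‖fderiv ℝ w y v‖ₑ ≤ ∫⁻ y in K, r y := by
    intro K hK hKO
    obtain ⟨δ, hδ, hδO⟩ := hK.exists_cthickening_subset_open hO hKO
    set l : ℕ → ℝ := fun n => 1 / ((n : ℝ) + 1) with hl
    have hl0 : ∀ n, 0 < l n := fun n => by simp only [hl]; positivity
    have hllim : Tendsto l atTop (𝓝 0) := tendsto_one_div_add_atTop_nhds_zero_nat
    have hmeas : ∀ n, Measurable fun y => edist (w y) (w (y + l n • v)) / ENNReal.ofReal (l n) :=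
      fun n => by
        have : Continuous fun y => edist (w y) (w (y + l n • v)) := by
          have := hw.continuous
          fun_prop
        exact this.measurable.div_const _
    have hptw : ∀ᵐ y : Plane, ‖fderiv ℝ w y v‖ₑ ≤
        liminf (fun n => edist (w y) (w (y + l n • v)) / ENNReal.ofReal (l n)) atTop := by
      filter_upwards [hw.ae_differentiableAt] with y hy
      have h1 : Tendsto (fun n => (l n)⁻¹ • (w (y + l n • v) - w y)) atTop
          (𝓝 (fderiv ℝ w y v)) := by
        have h2 := (hy.hasFDerivAt.hasLineDerivAt v).tendsto_slope_zero
        refine h2.comp (tendsto_nhdsWithin_iff.2 ⟨hllim, Eventually.of_forall fun n => ?_⟩)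
        exact (hl0 n).ne'
      have h3 : Tendsto (fun n => edist (w y) (w (y + l n • v)) / ENNReal.ofReal (l n)) atTop
          (𝓝 ‖fderiv ℝ w y v‖ₑ) := by
        refine (h1.enorm).congr fun n => ?_
        rw [enorm_smul, edist_comm, edist_eq_enorm_sub, Real.enorm_eq_ofReal (inv_pos.2 (hl0 n)).le,
          ENNReal.ofReal_inv_of_pos (hl0 n), mul_comm, ENNReal.div_eq_inv_mul, mul_comm]
      rw [h3.liminf_eq]
    have hbound : ∀ᶠ n in atTop, ∫⁻ y in K, edist (w y) (w (y + l n • v)) / ENNReal.ofReal (l n) ≤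
        volume.withDensity r (Metric.cthickening (l n) K) := by
      filter_upwards [hllim.eventually (gt_mem_nhds hδ)] with n hn
      have hseg : ∀ y ∈ K, ∀ t ∈ Icc 0 (l n), y + t • v ∈ Metric.cthickening (l n) K := by
        intro y hy t ht
        refine Metric.mem_cthickening_of_dist_le _ y _ K hy ?_
        rw [dist_eq_norm, add_sub_cancel_left, norm_smul, hv, mul_one, Real.norm_eq_abs,
          abs_of_nonneg ht.1]
        exact ht.2
      have hcm : MeasurableSet (Metric.cthickening (l n) K) :=
        Metric.isClosed_cthickening.measurableSet
      have hrm := hr.indicator hcm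
      obtain ⟨hm, hint⟩ := PlanarChart.lintegral_lintegral_translate hrm v (l n)
      have hl0' : ENNReal.ofReal (l n) ≠ 0 := by simpa using hl0 n
      rw [withDensity_apply _ hcm, ← MeasureTheory.lintegral_indicator hcm]
      have h1 : ∫⁻ y in K, edist (w y) (w (y + l n • v)) ≤
          ENNReal.ofReal (l n) * ∫⁻ y, (Metric.cthickening (l n) K).indicator r y := by
        rw [← hint]
        refine le_trans (lintegral_mono_ae ?_) (setLIntegral_le_lintegral K _)
        filter_upwards [ae_restrict_of_ae (h (l n) (hl0 n).le), ae_restrict_mem hK.measurableSet]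
          with y hy hyK
        refine (hy fun t ht => hδO (Metric.cthickening_mono hn.le K (hseg y hyK t ht))).trans
          (le_of_eq ?_)
        refine setLIntegral_congr_fun measurableSet_Icc fun t ht => ?_
        exact (indicator_of_mem (hseg y hyK t ht) r).symm
      simp only [div_eq_mul_inv]
      rw [lintegral_mul_const' _ _ (ENNReal.inv_ne_top.2 hl0'), ← div_eq_mul_inv]
      exact ENNReal.div_le_of_le_mul' h1
    have hwd : IsFiniteMeasure (volume.withDensity r) := isFiniteMeasure_withDensity hfin
    have hth := tendsto_measure_cthickening_of_isClosed (μ := volume.withDensity r) (s := K)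
      ⟨1, one_pos, measure_ne_top _ _⟩ hK.isClosed
    calc ∫⁻ y in K, ‖fderiv ℝ w y v‖ₑ
        ≤ ∫⁻ y in K, liminf (fun n => edist (w y) (w (y + l n • v)) / ENNReal.ofReal (l n)) atTop :=
          lintegral_mono_ae (ae_restrict_of_ae hptw)
      _ ≤ liminf (fun n => ∫⁻ y in K, edist (w y) (w (y + l n • v)) / ENNReal.ofReal (l n)) atTop :=
          lintegral_liminf_le hmeas
      _ ≤ liminf (fun n => volume.withDensity r (Metric.cthickening (l n) K)) atTop :=
          liminf_le_liminf hbound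
      _ = volume.withDensity r K := (hth.comp hllim).liminf_eq
      _ = ∫⁻ y in K, r y := withDensity_apply _ hK.measurableSet
  have hD : ∀ y, ‖fderiv ℝ w y v‖ₑ ≤ L := by
    intro y
    have h1 : ‖fderiv ℝ w y v‖ ≤ L := by
      refine ((fderiv ℝ w y).le_opNorm v).trans ?_
      rw [hv, mul_one]
      exact norm_fderiv_le_of_lipschitz ℝ hw
    change (‖fderiv ℝ w y v‖₊ : ℝ≥0∞) ≤ L
    exact_mod_cast h1
  -- Local finiteness gives inner regularity by compact sets, which carries the comparison from
  -- compact sets to Borel sets.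
  have hlf : IsLocallyFiniteMeasure
      (volume.withDensity fun y => (‖fderiv ℝ w y v‖ₑ : ℝ≥0∞) : Measure Plane) := by
    refine ⟨fun x => ⟨Metric.ball x 1, Metric.ball_mem_nhds x one_pos, ?_⟩⟩
    rw [withDensity_apply _ Metric.isOpen_ball.measurableSet]
    refine (lintegral_mono hD).trans_lt ?_
    rw [setLIntegral_const]
    exact ENNReal.mul_lt_top ENNReal.coe_lt_top measure_ball_lt_top
  refine ae_le_of_forall_setLIntegral_le_of_sigmaFinite hDm fun s hs _ => ?_
  rw [Measure.restrict_restrict hs, ← withDensity_apply _ (hs.inter hO.measurableSet),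
    (hs.inter hO.measurableSet).measure_eq_iSup_isCompact]
  refine iSup₂_le fun K hKs => iSup_le fun hK => ?_
  rw [withDensity_apply _ hK.measurableSet]
  exact (hcomp K hK (hKs.trans inter_subset_right)).trans (lintegral_mono_set hKs)

/-- Each direction comes with its own exceptional null set, so only countably many directions can be
used at once; a dense sequence determines the norm. -/
theorem enorm_le_of_dense {D : Plane →L[ℝ] ℝ} {c : ℝ≥0∞}
    (s : ℕ → Metric.sphere (0 : Plane) 1) (hs : DenseRange s) (h : ∀ i, ‖D (s i)‖ₑ ≤ c) :
    ‖D‖ₑ ≤ c := by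
  rcases eq_or_ne c ∞ with rfl | hc
  · exact le_top
  lift c to ℝ≥0 using hc
  have hall : ∀ v : Metric.sphere (0 : Plane) 1, ‖D v‖ ≤ c := by
    intro v
    have hcl : IsClosed {v : Metric.sphere (0 : Plane) 1 | ‖D v‖ ≤ c} :=
      isClosed_le (by fun_prop) continuous_const
    refine hs.induction_on (p := fun v => ‖D v‖ ≤ c) v hcl fun i => ?_
    have := h i
    change (‖D (s i)‖₊ : ℝ≥0∞) ≤ c at this
    exact_mod_cast this
  have : ‖D‖ ≤ c := D.opNorm_le_of_unit_norm c.2 fun v hv =>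
    hall ⟨v, by simpa using hv⟩
  change (‖D‖₊ : ℝ≥0∞) ≤ c
  exact_mod_cast this

/-- On an open planar piece every weak upper gradient dominates the norm of the derivative. -/
theorem PlanarChart.ae_enorm_fderiv_le {P : Set X} {j : X → Plane} {k : Plane → X}
    (h : PlanarChart P j k) (hP : MeasurableSet P) (hO : IsOpen (j '' P))
    (hfin : (μHE[2] : Measure X) univ ≠ ∞) {p : ℝ≥0∞} (hp : 1 ≤ p) {u : X → ℝ} {ρ : X → ℝ≥0∞}
    (hu : IsIntegrableWeakUpperGradient p u ρ) {w : Plane → ℝ} {L : ℝ≥0} (hw : LipschitzWith L w)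
    (huw : ∀ x ∈ P, w (j x) = u x) :
    ∀ᵐ x ∂((μHE[2] : Measure X).restrict P), ‖fderiv ℝ w (j x)‖ₑ ≤ ρ x := by
  have hρm : Measurable ρ := hu.1.1
  have hrm := h.measurable_indicator hO.measurableSet hρm
  have hrfin : ∫⁻ y, (j '' P).indicator (ρ ∘ k) y ≠ ∞ := by
    rw [h.lintegral_indicator hO.measurableSet hρm hP]
    have : IsFiniteMeasure (μHE[2] : Measure X) := ⟨hfin.lt_top⟩
    have h1 := eLpNorm_le_eLpNorm_mul_rpow_measure_univ (μ := (μHE[2] : Measure X)) (f := ρ) hp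
      hρm.aestronglyMeasurable
    rw [eLpNorm_one_eq_lintegral_enorm] at h1
    have hexp : 0 ≤ 1 / (1 : ℝ≥0∞).toReal - 1 / p.toReal := by
      rcases eq_or_ne p ∞ with h | h
      · simp [h]
      · have : 1 ≤ p.toReal := by simpa using ENNReal.toReal_mono h hp
        have h2 : 1 / p.toReal ≤ 1 := by rw [div_le_one (by linarith)]; exact this
        simpa using h2
    refine ne_top_of_le_ne_top (ENNReal.mul_ne_top hu.2.ne
      (ENNReal.rpow_ne_top_of_nonneg hexp hfin)) (le_trans ?_ h1)
    exact (setLIntegral_le_lintegral _ _).trans (by simp)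
  have : Nonempty (Metric.sphere (0 : Plane) 1) :=
    (NormedSpace.sphere_nonempty.2 zero_le_one).to_subtype
  obtain ⟨s, hs⟩ := TopologicalSpace.exists_dense_seq (Metric.sphere (0 : Plane) 1)
  have hae : ∀ᵐ y ∂(volume.restrict (j '' P)), ∀ i, ‖fderiv ℝ w y (s i)‖ₑ ≤
      (j '' P).indicator (ρ ∘ k) y := by
    refine ae_all_iff.2 fun i => ?_
    have hsi : ‖(s i : Plane)‖ = 1 := by simp
    refine ae_enorm_fderiv_apply_le hw hO hrm hrfin hsi fun l hl => ?_
    filter_upwards [h.ae_edist_le hP hO.measurableSet hfin hp hu.1 hsi hl] with y hy hseg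
    have h0 := hseg 0 (left_mem_Icc.2 hl)
    rw [zero_smul, add_zero] at h0
    have h1 := hseg l (right_mem_Icc.2 hl)
    have e0 : w y = u (k y) := by
      rw [← huw _ (h.map_mem h0), h.rightInv h0]
    have e1 : w (y + l • (s i : Plane)) = u (k (y + l • (s i : Plane))) := by
      rw [← huw _ (h.map_mem h1), h.rightInv h1]
    rw [e0, e1]
    exact hy hseg
  rw [← map_restrict_of_isometryOn h.continuous h.isometryOn] at hae
  filter_upwards [ae_of_ae_map h.continuous.measurable.aemeasurable hae, ae_restrict_mem hP]
    with x hx hxP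
  refine enorm_le_of_dense s hs fun i => (hx i).trans (le_of_eq ?_)
  simp [indicator_of_mem (mem_image_of_mem j hxP), h.leftInv x hxP]

end Minimality

/-! ### Minimal upper gradients and coarea on piecewise planar spaces. -/

section PiecewisePlanar

variable {X : Type*} [MetricSpace X] [MeasurableSpace X] [BorelSpace X]

theorem PlanarChart.measurableSet_image [PolishSpace X] {Q : Set X} {j : X → Plane} {k : Plane → X}
    (h : PlanarChart Q j k) {E : Set X} (hE : MeasurableSet E) (hEQ : E ⊆ Q) :
    MeasurableSet (j '' E) :=
  hE.image_of_continuousOn_injOn h.continuous.continuousOn (h.isometryOn.injOn.mono hEQ)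

theorem PlanarChart.exists_lipschitz_extension {Q : Set X} {j : X → Plane} {k : Plane → X}
    (h : PlanarChart Q j k) {u : X → ℝ} {L : ℝ≥0} (hu : LipschitzWith L u) :
    ∃ w : Plane → ℝ, LipschitzWith L w ∧ ∀ x ∈ Q, w (j x) = u x := by
  have h1 : LipschitzOnWith L (u ∘ k) (j '' Q) := by
    have := hu.lipschitzOnWith (s := univ) |>.comp h.isometryOn_symm.lipschitzOnWith
      (mapsTo_univ _ _)
    rwa [mul_one] at this
  obtain ⟨w, hw, heq⟩ := h1.extend_real
  exact ⟨w, hw, fun x hx => by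
    rw [← heq (mem_image_of_mem j hx), Function.comp_apply, h.leftInv x hx]⟩

theorem PlanarChart.ae_lipOn_eq [PolishSpace X] {Q : Set X} (hQ : MeasurableSet Q) {j : X → Plane}
    {k : Plane → X} (h : PlanarChart Q j k) {u : X → ℝ} {w : Plane → ℝ} {L : ℝ≥0}
    (hw : LipschitzWith L w) (huw : ∀ x ∈ Q, w (j x) = u x) :
    ∀ᵐ x ∂((μHE[2] : Measure X).restrict Q), lipOn u Q x = ‖fderiv ℝ w (j x)‖ₑ := by
  have h1 := ae_lipOn_eq_enorm_fderiv hw (j '' Q)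
  rw [← map_restrict_of_isometryOn h.continuous h.isometryOn] at h1
  filter_upwards [ae_of_ae_map h.continuous.measurable.aemeasurable h1, ae_restrict_mem hQ]
    with x hx hxQ
  rw [lipOn_eq_lipOn_image h.isometryOn huw hxQ, hx]

/-- The coarea formula on a planar piece. -/
theorem PlanarChart.coarea [PolishSpace X] {Q : Set X} (hQ : MeasurableSet Q) {j : X → Plane}
    {k : Plane → X} (h : PlanarChart Q j k) {u : X → ℝ} {L : ℝ≥0} (hu : LipschitzWith L u)
    {E : Set X} (hE : MeasurableSet E) (hEQ : E ⊆ Q) :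
    AEMeasurable (fun t : ℝ => (μHE[1] : Measure X) (u ⁻¹' {t} ∩ E)) ∧
      ∫⁻ t : ℝ, (μHE[1] : Measure X) (u ⁻¹' {t} ∩ E) = ∫⁻ x in E, lipOn u Q x ∂μHE[2] := by
  obtain ⟨w, hw, huw⟩ := h.exists_lipschitz_extension hu
  have hjE := h.measurableSet_image hE hEQ
  obtain ⟨h1, h2⟩ := coarea_plane hw hjE
  have hsl : ∀ t, (μHE[1] : Measure Plane) (w ⁻¹' {t} ∩ j '' E) =
      (μHE[1] : Measure X) (u ⁻¹' {t} ∩ E) := by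
    intro t
    rw [← ((h.isometryOn.mono hEQ).mono
      (inter_subset_right (s := u ⁻¹' {t}))).euclideanHausdorffMeasure_image]
    congr 1
    ext y
    constructor
    · rintro ⟨hy, x, hx, rfl⟩
      exact ⟨x, ⟨(huw x (hEQ hx)).symm.trans hy, hx⟩, rfl⟩
    · rintro ⟨x, ⟨hxt, hx⟩, rfl⟩
      exact ⟨(huw x (hEQ hx)).trans hxt, x, hx, rfl⟩
  simp only [hsl] at h1 h2
  refine ⟨h1, h2.trans ?_⟩
  have hae : ∀ᵐ x ∂((μHE[2] : Measure X).restrict E), lipOn u Q x = ‖fderiv ℝ w (j x)‖ₑ :=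
    ae_restrict_of_ae_restrict_of_subset hEQ (h.ae_lipOn_eq hQ hw huw)
  rw [lintegral_congr_ae hae, ← map_restrict_of_isometryOn h.continuous (h.isometryOn.mono hEQ),
    lintegral_map (measurable_fderiv ℝ w).enorm h.continuous.measurable]

/-- A space of finite area that consists of a planar closed set `C`, whose points lie on no
nonconstant rectifiable path, of countably many open planar pieces and of a null set. -/
structure IsPiecewisePlanar (C : Set X) (jC : X → Plane) (kC : Plane → X) (P : ℕ → Set X)
    (j : ℕ → X → Plane) (k : ℕ → Plane → X) : Prop where
  finite : (μHE[2] : Measure X) univ < ∞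
  isClosed : IsClosed C
  chart : PlanarChart C jC kC
  isOpen : ∀ i, IsOpen (P i)
  isOpen_image : ∀ i, IsOpen (j i '' P i)
  charts : ∀ i, PlanarChart (P i) (j i) (k i)
  disjoint : ∀ i, Disjoint (P i) C
  null : (μHE[2] : Measure X) (C ∪ ⋃ i, P i)ᶜ = 0
  const : ∀ γ : CurvePath X, γ.Rectifiable → (∃ t, γ.map t ∈ C) → ∀ s t, γ.map s = γ.map t

namespace IsPiecewisePlanar

variable {C : Set X} {jC : X → Plane} {kC : Plane → X} {P : ℕ → Set X}
    {j : ℕ → X → Plane} {k : ℕ → Plane → X}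

/-- No exceptional family is needed: a rectifiable path either meets `C` and is constant, or avoids
`C` and satisfies the inequality for the slope. A competitor dominates the derivative, that is the
slope, on the open pieces, and there is nothing to prove on `C`. The function does not depend on
`p`. -/
theorem isMinimal [PolishSpace X] (h : IsPiecewisePlanar C jC kC P j k) {u : X → ℝ} {L : ℝ≥0}
    (hu : LipschitzWith L u) {p : ℝ≥0∞} (hp : 1 ≤ p) :
    IsMinimalWeakUpperGradient p u (Cᶜ.indicator (lipOn u univ)) := by
  have hCm := h.isClosed.measurableSet
  have hm : Measurable (Cᶜ.indicator (lipOn u univ)) :=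
    (measurable_lipOn_univ hu.continuous).indicator hCm.compl
  refine ⟨⟨⟨hm, ∅, modulus_empty hp, fun γ hγ _ => ?_⟩, ?_⟩, fun ρ' hρ' => ?_⟩
  · by_cases hmeet : ∃ t, γ.map t ∈ C
    · have := h.const γ hγ hmeet ⟨γ.a, left_mem_Icc.2 γ.le⟩ ⟨γ.b, right_mem_Icc.2 γ.le⟩
      rw [CurvePath.source, CurvePath.target, this, edist_self]
      exact bot_le
    · push Not at hmeet
      exact edist_le_pathIntegral_lipOn hu γ hγ hmeet
  · have : IsFiniteMeasure (μHE[2] : Measure X) := ⟨h.finite⟩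
    refine (eLpNorm_mono_enorm (g := fun _ => (L : ℝ)) fun x => ?_).trans_lt
      (memLp_const (L : ℝ)).2
    have hL : ‖(L : ℝ)‖ₑ = L := by simp
    rw [hL]
    by_cases hx : x ∈ Cᶜ
    · rw [indicator_of_mem hx]
      exact lipOn_le_of_lipschitzWith hu univ x
    · rw [indicator_of_notMem hx]
      simp
  · have hP : ∀ᵐ x ∂(μHE[2] : Measure X), ∀ i, x ∈ P i → lipOn u univ x ≤ ρ' x := by
      refine ae_all_iff.2 fun i => ?_
      have hPm := (h.isOpen i).measurableSet
      obtain ⟨w, hw, huw⟩ := (h.charts i).exists_lipschitz_extension hu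
      have h1 := (h.charts i).ae_lipOn_eq hPm hw huw
      have h2 := (h.charts i).ae_enorm_fderiv_le hPm (h.isOpen_image i) h.finite.ne hp hρ' hw huw
      rw [ae_restrict_iff' hPm] at h1 h2
      filter_upwards [h1, h2] with x h1 h2 hx
      rw [lipOn_univ_eq_of_isOpen u (h.isOpen i) hx, h1 hx]
      exact h2 hx
    filter_upwards [hP, measure_eq_zero_iff_ae_notMem.1 h.null] with x hx hxn
    by_cases hxC : x ∈ Cᶜ
    · rw [indicator_of_mem hxC]
      rcases not_notMem.1 hxn with hc | hc
      · exact absurd hc hxC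
      · obtain ⟨i, hi⟩ := mem_iUnion.1 hc
        exact hx i hi
    · rw [indicator_of_notMem hxC]
      exact bot_le

theorem ae_eq_of_isMinimal [PolishSpace X] (h : IsPiecewisePlanar C jC kC P j k) {u : X → ℝ}
    {L : ℝ≥0} (hu : LipschitzWith L u) {p : ℝ≥0∞} (hp : 1 ≤ p) {ρ : X → ℝ≥0∞}
    (hρ : IsMinimalWeakUpperGradient p u ρ) :
    ρ =ᵐ[μHE[2]] Cᶜ.indicator (lipOn u univ) := by
  filter_upwards [hρ.2 _ (h.isMinimal hu hp).1, (h.isMinimal hu hp).2 _ hρ.1] with x h1 h2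
  exact le_antisymm h1 h2

theorem ae_eq_zero [PolishSpace X] (h : IsPiecewisePlanar C jC kC P j k) {u : X → ℝ}
    {L : ℝ≥0} (hu : LipschitzWith L u) {p : ℝ≥0∞} (hp : 1 ≤ p) {ρ : X → ℝ≥0∞}
    (hρ : IsMinimalWeakUpperGradient p u ρ) : ∀ᵐ x ∂(μHE[2] : Measure X).restrict C, ρ x = 0 := by
  filter_upwards [ae_restrict_of_ae (h.ae_eq_of_isMinimal hu hp hρ),
    ae_restrict_mem h.isClosed.measurableSet] with x hx hxC
  rw [hx, indicator_of_notMem (not_not.2 hxC)]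

/-- Apply the planar formula to `E ∩ C` and to disjoint parts of `E` in the open pieces; the null
remainder is invisible to almost every level. On an open piece the slope within the piece is the
full slope, but on `C` it has to be taken within `C`. -/
theorem coarea [PolishSpace X] (h : IsPiecewisePlanar C jC kC P j k) {u : X → ℝ} {L : ℝ≥0}
    (hu : LipschitzWith L u) {E : Set X} (hE : MeasurableSet E) :
    AEMeasurable (fun t : ℝ => (μHE[1] : Measure X) (u ⁻¹' {t} ∩ E)) ∧
      ∫⁻ t : ℝ, (μHE[1] : Measure X) (u ⁻¹' {t} ∩ E) =
        ∫⁻ x in E, C.indicator (lipOn u C) x ∂(μHE[2] : Measure X) +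
        ∫⁻ x in E, Cᶜ.indicator (lipOn u univ) x ∂(μHE[2] : Measure X) := by
  have hCm := h.isClosed.measurableSet
  have hPm : ∀ i, MeasurableSet (P i) := fun i => (h.isOpen i).measurableSet
  have hdm : ∀ i, MeasurableSet (disjointed P i) := MeasurableSet.disjointed hPm
  have hum : ∀ t : ℝ, MeasurableSet (u ⁻¹' {t}) := fun t =>
    hu.continuous.measurable (measurableSet_singleton t)
  set D : ℕ → Set X := fun i => E ∩ disjointed P i with hD
  have hDm : ∀ i, MeasurableSet (D i) := fun i => hE.inter (hdm i)
  have hDP : ∀ i, D i ⊆ P i := fun i => inter_subset_right.trans (disjointed_subset P i)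
  have hDd : Pairwise (Function.onFun Disjoint D) := fun i j hij =>
    (disjoint_disjointed P hij).mono inter_subset_right inter_subset_right
  set N : Set X := E ∩ (C ∪ ⋃ i, P i)ᶜ with hN
  have hN0 : μHE[2] N = 0 := measure_mono_null inter_subset_right h.null
  have hNm : MeasurableSet N := hE.inter (hCm.union (MeasurableSet.iUnion hPm)).compl
  have hsplit : E ∩ Cᶜ = (⋃ i, D i) ∪ N := by
    rw [hD, hN, ← inter_iUnion, iUnion_disjointed, ← inter_union_distrib_left]
    congr 1
    ext x
    have hdis : x ∈ ⋃ i, P i → x ∉ C := by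
      intro hx hxC
      obtain ⟨i, hi⟩ := mem_iUnion.1 hx
      exact Set.disjoint_left.1 (h.disjoint i) hi hxC
    simp only [mem_compl_iff, mem_union]
    tauto
  obtain ⟨hc1, hc2⟩ := h.chart.coarea hCm hu (hE.inter hCm) inter_subset_right
  have hd := fun i => (h.charts i).coarea (hPm i) hu (hDm i) (hDP i)
  have hn := ae_hausdorffMeasure_slice_eq_zero (hu.lipschitzOnWith (s := N)) hN0
  have hae : (fun t : ℝ => (μHE[1] : Measure X) (u ⁻¹' {t} ∩ E)) =ᵐ[volume]
      fun t => μHE[1] (u ⁻¹' {t} ∩ (E ∩ C)) + ∑' i, μHE[1] (u ⁻¹' {t} ∩ D i) := by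
    filter_upwards [hn] with t ht
    have h1 : μHE[1] (u ⁻¹' {t} ∩ E) =
        μHE[1] (u ⁻¹' {t} ∩ (E ∩ C)) + μHE[1] (u ⁻¹' {t} ∩ (E ∩ Cᶜ)) := by
      rw [← measure_inter_add_sdiff (u ⁻¹' {t} ∩ E) hCm, sdiff_eq, inter_assoc, inter_assoc]
    rw [h1, hsplit, inter_union_distrib_left, inter_iUnion]
    congr 1
    have h2 : μHE[1] ((⋃ i, u ⁻¹' {t} ∩ D i) ∪ u ⁻¹' {t} ∩ N) =
        μHE[1] (⋃ i, u ⁻¹' {t} ∩ D i) :=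
      le_antisymm ((measure_union_le _ _).trans (by rw [ht, add_zero]))
        (measure_mono subset_union_left)
    rw [h2, measure_iUnion]
    · exact fun i j hij => (hDd hij).mono inter_subset_right inter_subset_right
    · exact fun i => (hum t).inter (hDm i)
  refine ⟨(hc1.add (AEMeasurable.tsum fun i => (hd i).1)).congr hae.symm, ?_⟩
  rw [lintegral_congr_ae hae, lintegral_add_left' hc1, hc2,
    lintegral_tsum fun i => (hd i).1, setLIntegral_indicator hCm, setLIntegral_indicator hCm.compl,
    inter_comm C E, inter_comm Cᶜ E, hsplit]
  congr 1
  have hnull : ∫⁻ x in (⋃ i, D i) ∪ N, lipOn u univ x ∂μHE[2] =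
      ∫⁻ x in ⋃ i, D i, lipOn u univ x ∂μHE[2] :=
    setLIntegral_congr (union_ae_eq_left_of_ae_eq_empty (ae_eq_empty.2 hN0))
  rw [hnull, lintegral_iUnion hDm hDd]
  refine tsum_congr fun i => ?_
  rw [(hd i).2]
  refine setLIntegral_congr_fun (hDm i) fun x hx => ?_
  exact (lipOn_univ_eq_of_isOpen u (h.isOpen i) (hDP i hx)).symm

theorem isTwoRectifiable (h : IsPiecewisePlanar C jC kC P j k)
    (hC : MeasurableSet (jC '' C)) : IsTwoRectifiable X := by
  have hlip : ∀ {Q : Set X} {j : X → Plane} {k : Plane → X}, PlanarChart Q j k →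
      LipschitzWith 1 (fun y : j '' Q => k y) := fun hc =>
    LipschitzWith.of_dist_le_mul fun x y => by
      have := hc.isometryOn_symm x x.2 y y.2
      rw [this, NNReal.coe_one, one_mul, Subtype.dist_eq]
  have hrange : ∀ {Q : Set X} {j : X → Plane} {k : Plane → X}, PlanarChart Q j k →
      Q ⊆ range (fun y : j '' Q => k y) := fun hc x hx =>
    ⟨⟨_, mem_image_of_mem _ hx⟩, hc.leftInv x hx⟩
  refine ⟨fun n => Nat.casesOn n (jC '' C) fun i => j i '' P i,
    fun n => Nat.casesOn n (fun y => kC y) fun i y => k i y, fun n => ?_, fun n => ⟨1, ?_⟩, ?_⟩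
  · cases n with
    | zero => exact hC
    | succ n => exact (h.isOpen_image n).measurableSet
  · cases n with
    | zero => exact hlip h.chart
    | succ n => exact hlip (h.charts n)
  · refine measure_mono_null (compl_subset_compl.2 (union_subset ?_ (iUnion_subset fun i => ?_)))
      h.null
    · exact subset_iUnion_of_subset 0 (hrange h.chart)
    · exact subset_iUnion_of_subset (i + 1) (hrange (h.charts i))

/-- The indicator of `C` is a counterexample for every `κ` at once, because the minimal upper
gradient vanishes almost everywhere on `C`. -/
theorem coarea_inequality_fails [PolishSpace X] (h : IsPiecewisePlanar C jC kC P j k) {u : X → ℝ}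
    {L : ℝ≥0} (hu : LipschitzWith L u)
    (hpos : 0 < ∫⁻ t : ℝ, (μHE[1] : Measure X) (u ⁻¹' {t} ∩ C)) {p : ℝ≥0∞} (hp : 1 ≤ p)
    {ρ : X → ℝ≥0∞} (hρ : IsMinimalWeakUpperGradient p u ρ) (κ : ℝ≥0) :
    ∃ g : X → ℝ≥0∞, Measurable g ∧
      κ * ∫⁻ x, g x * ρ x ∂(μHE[2] : Measure X) <
        ∫⁻ t : ℝ, ∫⁻ x in u ⁻¹' {t}, g x ∂(μHE[1] : Measure X) := by
  have hCm := h.isClosed.measurableSet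
  refine ⟨C.indicator 1, measurable_one.indicator hCm, ?_⟩
  have h0 : ∫⁻ x, C.indicator 1 x * ρ x ∂(μHE[2] : Measure X) = 0 := by
    have : ∀ x, C.indicator 1 x * ρ x = C.indicator ρ x := by
      intro x
      by_cases hx : x ∈ C <;> simp [hx]
    simp only [this]
    rw [lintegral_indicator hCm, lintegral_congr_ae (h.ae_eq_zero hu hp hρ), lintegral_zero]
  rw [h0, mul_zero]
  convert hpos using 3 with t
  rw [lintegral_indicator_one hCm, Measure.restrict_apply hCm, inter_comm]

theorem ae_lipOn_eq_one [PolishSpace X] (h : IsPiecewisePlanar C jC kC P j k) {u : X → ℝ}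
    (huj : ∀ x ∈ C, u x = jC x 0) :
    ∀ᵐ x ∂(μHE[2] : Measure X).restrict C, lipOn u C x = 1 := by
  let π : Plane →L[ℝ] ℝ := EuclideanSpace.proj 0
  have hπ : ‖π‖ = 1 := by
    apply le_antisymm
    · refine π.opNorm_le_bound zero_le_one fun x => ?_
      rw [one_mul]
      exact PiLp.norm_apply_le x 0
    · have := π.le_opNorm (EuclideanSpace.single 0 1)
      simpa [π] using this
  have h1 := h.chart.ae_lipOn_eq h.isClosed.measurableSet (u := u) π.lipschitz
    (fun x hx => (huj x hx).symm)
  filter_upwards [h1] with x hx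
  rw [hx, π.fderiv]
  have : ‖π‖₊ = 1 := NNReal.eq hπ
  change (‖π‖₊ : ℝ≥0∞) = 1
  rw [this, ENNReal.coe_one]

theorem lintegral_slice_pos [PolishSpace X] (h : IsPiecewisePlanar C jC kC P j k) {u : X → ℝ}
    {L : ℝ≥0} (hu : LipschitzWith L u) (huj : ∀ x ∈ C, u x = jC x 0)
    (hC : 0 < (μHE[2] : Measure X) C) :
    0 < ∫⁻ t : ℝ, (μHE[1] : Measure X) (u ⁻¹' {t} ∩ C) := by
  rw [(h.chart.coarea h.isClosed.measurableSet hu h.isClosed.measurableSet subset_rfl).2,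
    lintegral_congr_ae (h.ae_lipOn_eq_one huj), setLIntegral_const, one_mul]
  exact hC

end IsPiecewisePlanar

end PiecewisePlanar

/-! ### Construction of the surface. -/

namespace TentacleSurface

/-- The parameter space, with the supremum norm. -/
abbrev Param : Type := Fin 2 → ℝ

/-- The expanding folding map of the line. -/
noncomputable def fold (s : ℝ) : ℝ := 16 * (|s| - 1 / 2)

/-- The expanding folding map of the plane; the four components of the preimage of the unit square
inside the unit square are small squares. -/
noncomputable def foldMap (q : Param) : Param := fun i => fold (q i)

/-- A cutoff function supported in the unit square. -/
noncomputable def bump (q : Param) : ℝ := max 0 (min 1 (4 * (1 - ‖q‖)))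

/-- A continuous version of the sign. -/
noncomputable def clampSign (s : ℝ) : ℝ := max (-1) (min 1 (4 * s))

/-- The distance by which a tube of generation `n` is moved in each horizontal direction. -/
noncomputable def shift (n : ℕ) : ℝ := 4 * (1 / 2) ^ n + 6 * (1 / 4) ^ n - 8 * (1 / 16) ^ n

/-- The side lengths of the squares that approximate the large Cantor set. -/
noncomputable def cellSize (n : ℕ) : ℝ := 4 * (1 / 2) ^ n + 2 * (1 / 4) ^ n

/-- The zigzag profile of a tube of generation `n`. -/
noncomputable def zigzag (n : ℕ) (t : ℝ) : ℝ :=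
  shift n * t + 2 * (1 / 2) ^ n * |4 ^ n * t - round (4 ^ n * t)|

/-- The product of the first `k` signs along the folding orbit. -/
noncomputable def signProd (k : ℕ) (s : ℝ) : ℝ := ∏ j ∈ Finset.range k, clampSign (fold^[j] s)

/-- The horizontal displacement of the surface of generation `n`. -/
noncomputable def disp (n : ℕ) (q : Param) (i : Fin 2) : ℝ :=
  ∑' k, signProd k (q i) * zigzag (n + k) (bump (foldMap^[k] q))

/-- The horizontal coordinates of the surface of generation `n`. -/
noncomputable def pos (n : ℕ) (q : Param) (i : Fin 2) : ℝ := (1 / 16) ^ n * q i + disp n q i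

/-- The vertical coordinate of the surface of generation `n`. -/
noncomputable def height (n : ℕ) (q : Param) : ℝ :=
  ∑' k, (1 / 2) ^ (n + k) * bump (foldMap^[k] q)

/-- The parametrization of the surface of generation `n`. -/
noncomputable def surf (n : ℕ) (q : Param) : EuclideanSpace ℝ (Fin 3) :=
  !₂[pos n q 0, pos n q 1, height n q]

/-! ### The building blocks -/

theorem bump_nonneg (q : Param) : 0 ≤ bump q := le_max_left _ _

theorem bump_le_one (q : Param) : bump q ≤ 1 := max_le zero_le_one (min_le_left _ _)

theorem bump_pos_iff {q : Param} : 0 < bump q ↔ ‖q‖ < 1 := by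
  simp [bump]

theorem bump_eq_zero_iff {q : Param} : bump q = 0 ↔ 1 ≤ ‖q‖ := by
  rw [← not_lt, ← bump_pos_iff, not_lt]
  exact ⟨fun h => h.le, fun h => le_antisymm h (bump_nonneg q)⟩

theorem bump_eq_one {q : Param} (h : ‖q‖ ≤ 3 / 4) : bump q = 1 := by
  have : 1 ≤ 4 * (1 - ‖q‖) := by linarith
  simp [bump, this]

theorem continuous_bump : Continuous bump := by unfold bump; fun_prop

theorem continuous_fold : Continuous fold := by unfold fold; fun_prop

theorem continuous_foldMap : Continuous foldMap :=
  continuous_pi fun i => continuous_fold.comp (continuous_apply i)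

theorem continuous_clampSign : Continuous clampSign := by unfold clampSign; fun_prop

theorem abs_clampSign_le (s : ℝ) : |clampSign s| ≤ 1 :=
  abs_le.2 ⟨le_max_left _ _, max_le (by norm_num) (min_le_left _ _)⟩

theorem clampSign_of_pos {s : ℝ} (h : 1 / 4 ≤ s) : clampSign s = 1 := by
  have : 1 ≤ 4 * s := by linarith
  simp [clampSign, this]

theorem clampSign_of_neg {s : ℝ} (h : s ≤ -(1 / 4)) : clampSign s = -1 := by
  have h1 : 4 * s ≤ -1 := by linarith
  unfold clampSign
  rw [max_eq_left]
  exact (min_le_right _ _).trans h1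

theorem abs_apply_le (q : Param) (i : Fin 2) : |q i| ≤ ‖q‖ := norm_le_pi_norm q i

theorem fold_bounds {s : ℝ} (h : |fold s| < 1) : 7 / 16 < |s| ∧ |s| < 9 / 16 := by
  unfold fold at h
  rw [abs_lt] at h
  constructor <;> linarith

theorem abs_clampSign_of_fold {s : ℝ} (h : |fold s| < 1) : |clampSign s| = 1 := by
  have h1 := (fold_bounds h).1
  rcases lt_abs.1 h1 with h2 | h2
  · rw [clampSign_of_pos (by linarith), abs_one]
  · rw [clampSign_of_neg (by linarith), abs_neg, abs_one]

theorem eq_clampSign_mul {s : ℝ} (h : |fold s| < 1) :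
    s = clampSign s * (1 / 2 + fold s / 16) := by
  have h1 := (fold_bounds h).1
  unfold fold
  rcases lt_abs.1 h1 with h2 | h2
  · rw [clampSign_of_pos (by linarith), abs_of_pos (by linarith)]; ring
  · rw [clampSign_of_neg (by linarith), abs_of_neg (by linarith)]; ring

theorem abs_fold_apply_lt {q : Param} (h : ‖foldMap q‖ < 1) (i : Fin 2) : |fold (q i)| < 1 :=
  (abs_apply_le (foldMap q) i).trans_lt h

theorem norm_lt_of_norm_foldMap_lt {q : Param} (h : ‖foldMap q‖ < 1) : ‖q‖ < 9 / 16 :=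
  (pi_norm_lt_iff (by norm_num)).2 fun i => (fold_bounds (abs_fold_apply_lt h i)).2

/-- The small squares lie in `‖q‖ < 9 / 16`, inside the plateau `‖q‖ ≤ 3 / 4`. Hence a tube begins
only where its parent is complete, and at each parameter at most one profile lies strictly between
`0` and `1`. -/
theorem bump_eq_one_of_bump_foldMap_pos {q : Param} (h : 0 < bump (foldMap q)) : bump q = 1 :=
  bump_eq_one ((norm_lt_of_norm_foldMap_lt (bump_pos_iff.1 h)).le.trans (by norm_num))

theorem bump_foldMap_eq_zero {q : Param} (h : bump q < 1) : bump (foldMap q) = 0 := by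
  by_contra hne
  have := bump_eq_one_of_bump_foldMap_pos (lt_of_le_of_ne (bump_nonneg _) (Ne.symm hne))
  linarith

theorem bump_iterate_eq_zero {q : Param} {j k : ℕ} (hjk : j ≤ k)
    (h : bump (foldMap^[j] q) = 0) : bump (foldMap^[k] q) = 0 := by
  induction k, hjk using Nat.le_induction with
  | base => exact h
  | succ k _ ih =>
    rw [Function.iterate_succ_apply']
    exact bump_foldMap_eq_zero (by rw [ih]; exact one_pos)

theorem iterate_foldMap_apply (k : ℕ) (q : Param) (i : Fin 2) :
    foldMap^[k] q i = fold^[k] (q i) := by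
  induction k with
  | zero => rfl
  | succ k ih => rw [Function.iterate_succ_apply', Function.iterate_succ_apply', ← ih]; rfl

theorem abs_signProd_le (k : ℕ) (s : ℝ) : |signProd k s| ≤ 1 := by
  unfold signProd
  rw [Finset.abs_prod]
  exact Finset.prod_le_one (fun _ _ => abs_nonneg _) fun _ _ => abs_clampSign_le _

theorem signProd_succ (k : ℕ) (s : ℝ) : signProd (k + 1) s = clampSign s * signProd k (fold s) := by
  unfold signProd
  rw [Finset.prod_range_succ']
  simp only [Function.iterate_succ_apply, Function.iterate_zero_apply]
  ring

theorem continuous_signProd (k : ℕ) : Continuous (signProd k) :=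
  continuous_finsetProd _ fun j _ => continuous_clampSign.comp (continuous_fold.iterate j)

theorem quarter_pow (n : ℕ) : ((1 / 4 : ℝ)) ^ n = ((1 / 2) ^ n) ^ 2 := by
  rw [← pow_mul, mul_comm, pow_mul]; norm_num

theorem sixteenth_pow (n : ℕ) : ((1 / 16 : ℝ)) ^ n = ((1 / 2) ^ n) ^ 4 := by
  rw [← pow_mul, mul_comm, pow_mul]; norm_num

theorem half_pow_mem (n : ℕ) : 0 < ((1 / 2 : ℝ)) ^ n ∧ ((1 / 2 : ℝ)) ^ n ≤ 1 :=
  ⟨by positivity, pow_le_one₀ (by norm_num) (by norm_num)⟩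

theorem shift_pos (n : ℕ) : 0 < shift n := by
  unfold shift
  rw [quarter_pow, sixteenth_pow]
  obtain ⟨h0, h1⟩ := half_pow_mem n
  have h2 : ((1 / 2 : ℝ) ^ n) ^ 4 ≤ ((1 / 2 : ℝ) ^ n) ^ 2 := pow_le_pow_of_le_one h0.le h1 (by norm_num)
  have h3 : ((1 / 2 : ℝ) ^ n) ^ 2 ≤ ((1 / 2 : ℝ) ^ n) ^ 1 := pow_le_pow_of_le_one h0.le h1 (by norm_num)
  rw [pow_one] at h3
  linarith

theorem shift_le (n : ℕ) : shift n ≤ 10 * (1 / 2) ^ n := by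
  unfold shift
  rw [quarter_pow, sixteenth_pow]
  obtain ⟨h0, h1⟩ := half_pow_mem n
  have h3 : ((1 / 2 : ℝ) ^ n) ^ 2 ≤ ((1 / 2 : ℝ) ^ n) ^ 1 := pow_le_pow_of_le_one h0.le h1 (by norm_num)
  rw [pow_one] at h3
  have : 0 ≤ ((1 / 2 : ℝ) ^ n) ^ 4 := by positivity
  linarith

theorem zigzag_zero (n : ℕ) : zigzag n 0 = 0 := by simp [zigzag]

theorem zigzag_one (n : ℕ) : zigzag n 1 = shift n := by
  have : round ((4 : ℝ) ^ n) = 4 ^ n := by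
    have h := round_intCast (α := ℝ) (4 ^ n)
    push_cast at h
    exact h
  simp [zigzag, this]

theorem zigzag_nonneg (n : ℕ) {t : ℝ} (ht : 0 ≤ t) : 0 ≤ zigzag n t := by
  have := shift_pos n
  unfold zigzag
  positivity

theorem zigzag_le (n : ℕ) {t : ℝ} (ht : t ≤ 1) : zigzag n t ≤ shift n + (1 / 2) ^ n := by
  have h1 := abs_sub_round ((4 : ℝ) ^ n * t)
  have h2 := shift_pos n
  obtain ⟨h0, _⟩ := half_pow_mem n
  unfold zigzag
  nlinarith

theorem abs_zigzag_bump_le (n : ℕ) (q : Param) : |zigzag n (bump q)| ≤ 11 * (1 / 2) ^ n := by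
  rw [abs_of_nonneg (zigzag_nonneg n (bump_nonneg q))]
  have := zigzag_le n (bump_le_one q)
  have := shift_le n
  linarith

/-- The distance to the nearest integer is `1`-Lipschitz. -/
theorem abs_abs_sub_round_sub_le (x y : ℝ) : |abs (x - round x) - abs (y - round y)| ≤ |x - y| := by
  have h1 := round_le x (round y)
  have h2 := round_le y (round x)
  have h3 := abs_sub_abs_le_abs_sub (x - round y) (y - round y)
  have h4 := abs_sub_abs_le_abs_sub (y - round x) (x - round x)
  rw [sub_sub_sub_cancel_right] at h3 h4
  rw [abs_sub_comm y x] at h4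
  exact abs_le.2 ⟨by linarith, by linarith⟩

theorem abs_zigzag_sub_le (n : ℕ) (s t : ℝ) :
    |zigzag n s - zigzag n t| ≤ (shift n + 2 * 2 ^ n) * |s - t| := by
  have h1 := abs_abs_sub_round_sub_le ((4 : ℝ) ^ n * s) (4 ^ n * t)
  rw [← mul_sub, abs_mul, abs_of_pos (by positivity : (0 : ℝ) < 4 ^ n)] at h1
  have h2 : zigzag n s - zigzag n t = shift n * (s - t) + 2 * (1 / 2) ^ n *
      (abs (4 ^ n * s - round (4 ^ n * s)) - abs (4 ^ n * t - round (4 ^ n * t))) := by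
    unfold zigzag; ring
  have h3 : ((1 / 2 : ℝ)) ^ n * 4 ^ n = 2 ^ n := by rw [← mul_pow]; norm_num
  rw [h2]
  refine (abs_add_le _ _).trans ?_
  rw [abs_mul, abs_mul, abs_of_pos (shift_pos n),
    abs_of_pos (by positivity : (0 : ℝ) < 2 * (1 / 2) ^ n), add_mul]
  have h4 : 2 * (1 / 2 : ℝ) ^ n * |abs (4 ^ n * s - round (4 ^ n * s)) -
      abs (4 ^ n * t - round (4 ^ n * t))| ≤ 2 * (1 / 2 : ℝ) ^ n * (4 ^ n * |s - t|) := by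
    gcongr
  have h5 : 2 * (1 / 2 : ℝ) ^ n * (4 ^ n * |s - t|) = 2 * 2 ^ n * |s - t| := by
    rw [← h3]; ring
  linarith

theorem continuous_zigzag (n : ℕ) : Continuous (zigzag n) := by
  have hK : 0 ≤ shift n + 2 * 2 ^ n := by have := shift_pos n; positivity
  have : LipschitzWith ⟨shift n + 2 * 2 ^ n, hK⟩ (zigzag n) :=
    LipschitzWith.of_dist_le_mul fun s t => abs_zigzag_sub_le n s t
  exact this.continuous

/-! ### Series -/

theorem abs_disp_term_le (n k : ℕ) (q : Param) (i : Fin 2) :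
    |signProd k (q i) * zigzag (n + k) (bump (foldMap^[k] q))| ≤
      11 * (1 / 2) ^ n * (1 / 2) ^ k := by
  rw [abs_mul]
  have h1 := abs_signProd_le k (q i)
  have h2 := abs_zigzag_bump_le (n + k) (foldMap^[k] q)
  rw [pow_add, ← mul_assoc] at h2
  exact (mul_le_mul h1 h2 (abs_nonneg _) zero_le_one).trans (one_mul _).le

theorem summable_half (c : ℝ) : Summable fun k : ℕ => c * (1 / 2 : ℝ) ^ k :=
  (summable_geometric_of_lt_one (by norm_num) (by norm_num)).mul_left c

theorem summable_disp (n : ℕ) (q : Param) (i : Fin 2) :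
    Summable fun k => signProd k (q i) * zigzag (n + k) (bump (foldMap^[k] q)) :=
  Summable.of_norm_bounded (summable_half (11 * (1 / 2) ^ n)) fun k => abs_disp_term_le n k q i

theorem abs_height_term_le (n k : ℕ) (q : Param) :
    |(1 / 2) ^ (n + k) * bump (foldMap^[k] q)| ≤ (1 / 2) ^ n * (1 / 2) ^ k := by
  rw [abs_mul, abs_of_nonneg (bump_nonneg _), abs_of_pos (by positivity), ← pow_add]
  exact mul_le_of_le_one_right (by positivity) (bump_le_one _)

theorem summable_height (n : ℕ) (q : Param) :
    Summable fun k => (1 / 2 : ℝ) ^ (n + k) * bump (foldMap^[k] q) :=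
  Summable.of_norm_bounded (summable_half ((1 / 2) ^ n)) fun k => abs_height_term_le n k q

/-- The self-similarity of the construction, on which the inductions over generations rest. -/
theorem disp_succ (n : ℕ) (q : Param) (i : Fin 2) :
    disp n q i = zigzag n (bump q) + clampSign (q i) * disp (n + 1) (foldMap q) i := by
  unfold disp
  rw [(summable_disp n q i).tsum_eq_zero_add, ← tsum_mul_left]
  congr 1
  · simp [signProd]
  · refine tsum_congr fun k => ?_
    rw [signProd_succ, Function.iterate_succ_apply, add_right_comm, add_assoc, mul_assoc]
    rfl

theorem height_succ (n : ℕ) (q : Param) :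
    height n q = (1 / 2) ^ n * bump q + height (n + 1) (foldMap q) := by
  unfold height
  rw [(summable_height n q).tsum_eq_zero_add]
  congr 1
  refine tsum_congr fun k => ?_
  rw [Function.iterate_succ_apply, add_right_comm, add_assoc]

theorem disp_eq_zero {n : ℕ} {q : Param} (h : bump q = 0) (i : Fin 2) : disp n q i = 0 := by
  unfold disp
  have : ∀ k, signProd k (q i) * zigzag (n + k) (bump (foldMap^[k] q)) = 0 := fun k => by
    rw [bump_iterate_eq_zero (Nat.zero_le k) h, zigzag_zero, mul_zero]
  rw [tsum_congr this, tsum_zero]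

theorem height_eq_zero {n : ℕ} {q : Param} (h : bump q = 0) : height n q = 0 := by
  unfold height
  have : ∀ k, (1 / 2 : ℝ) ^ (n + k) * bump (foldMap^[k] q) = 0 := fun k => by
    rw [bump_iterate_eq_zero (Nat.zero_le k) h, mul_zero]
  rw [tsum_congr this, tsum_zero]

theorem continuous_disp (n : ℕ) (i : Fin 2) : Continuous fun q => disp n q i := by
  refine continuous_tsum (fun k => ?_) (summable_half (11 * (1 / 2) ^ n))
    fun k q => abs_disp_term_le n k q i
  exact ((continuous_signProd k).comp (continuous_apply i)).mul ((continuous_zigzag _).comp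
    (continuous_bump.comp (continuous_foldMap.iterate k)))

theorem continuous_pos (n : ℕ) (i : Fin 2) : Continuous fun q => pos n q i :=
  (continuous_const.mul (continuous_apply i)).add (continuous_disp n i)

theorem continuous_height (n : ℕ) : Continuous (height n) := by
  refine continuous_tsum (fun k => ?_) (summable_half ((1 / 2) ^ n))
    fun k q => abs_height_term_le n k q
  exact continuous_const.mul (continuous_bump.comp (continuous_foldMap.iterate k))

theorem continuous_surf (n : ℕ) : Continuous (surf n) := by
  have h0 := continuous_pos n 0
  have h1 := continuous_pos n 1
  have h2 := continuous_height n
  unfold surf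
  fun_prop

theorem pos_of_bump_foldMap_eq_zero {n : ℕ} {q : Param} (h : bump (foldMap q) = 0) (i : Fin 2) :
    pos n q i = (1 / 16) ^ n * q i + zigzag n (bump q) := by
  rw [pos, disp_succ, disp_eq_zero h, mul_zero, add_zero]

theorem height_of_bump_foldMap_eq_zero {n : ℕ} {q : Param} (h : bump (foldMap q) = 0) :
    height n q = (1 / 2) ^ n * bump q := by
  rw [height_succ, height_eq_zero h, add_zero]

/-- A child tube is a reflected translate of the surface of the next generation. The centres of the
small squares have coordinates `± 1 / 2`, which at scale `(1 / 16) ^ n` is `8 * (1 / 16) ^ (n + 1)`.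
-/
theorem pos_of_bump_foldMap_pos {n : ℕ} {q : Param} (h : 0 < bump (foldMap q)) (i : Fin 2) :
    pos n q i = shift n +
      clampSign (q i) * (8 * (1 / 16) ^ (n + 1) + pos (n + 1) (foldMap q) i) := by
  have h1 := eq_clampSign_mul (abs_fold_apply_lt (bump_pos_iff.1 h) i)
  rw [pos, disp_succ, bump_eq_one_of_bump_foldMap_pos h, zigzag_one, pos]
  have h2 : (1 / 16 : ℝ) ^ n * q i =
      (1 / 16 : ℝ) ^ n * (clampSign (q i) * (1 / 2 + fold (q i) / 16)) := by rw [← h1]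
  rw [h2, pow_succ]
  simp only [foldMap]
  ring

theorem height_of_bump_foldMap_pos {n : ℕ} {q : Param} (h : 0 < bump (foldMap q)) :
    height n q = (1 / 2) ^ n + height (n + 1) (foldMap q) := by
  rw [height_succ, bump_eq_one_of_bump_foldMap_pos h, mul_one]

/-! ### Bounds -/

/-- The constants are tuned for this identity: half the side of a cell is the offset of the centres
of its four subcells plus half the side of a subcell. -/
theorem cellSize_succ (n : ℕ) :
    cellSize n = shift (n + 1) + 8 * (1 / 16) ^ (n + 1) + cellSize (n + 1) := by
  unfold cellSize shift
  simp only [pow_succ]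
  ring

/-- The excess is `4 * (1 / 4) ^ n`. It keeps reflected cells apart, yet is so small compared with
the cells that the limit set retains area. -/
theorem cellSize_lt (n : ℕ) : cellSize n < shift n + 8 * (1 / 16) ^ n := by
  unfold cellSize shift
  have : (0 : ℝ) < (1 / 4) ^ n := by positivity
  linarith

theorem abs_disp_le (n : ℕ) (q : Param) (i : Fin 2) : |disp n q i| ≤ 22 * (1 / 2) ^ n := by
  have h := tsum_of_norm_bounded (f := fun k => signProd k (q i) *
    zigzag (n + k) (bump (foldMap^[k] q)))
    ((hasSum_geometric_two).mul_left (11 * (1 / 2) ^ n)) fun k => abs_disp_term_le n k q i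
  rw [Real.norm_eq_abs] at h
  unfold disp
  linarith

/-- A point may have infinitely many generations below it, so the recursion is stopped after `k`
steps with the crude bound `abs_disp_le`. The error, where `31` is chosen generously, tends to zero
with `k`. -/
theorem abs_offset_le {n : ℕ} {q : Param} (hq : ‖q‖ ≤ 1) (i : Fin 2) :
    |8 * (1 / 16) ^ n + pos n q i| ≤ shift n + 8 * (1 / 16) ^ n + cellSize n := by
  have key : ∀ k n : ℕ, ∀ q : Param, ‖q‖ ≤ 1 → |8 * (1 / 16) ^ n + pos n q i| ≤
      shift n + 8 * (1 / 16) ^ n + cellSize n + 31 * (1 / 2) ^ n * (1 / 2) ^ k := by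
    intro k
    induction k with
    | zero =>
      intro n q hq
      have h1 := abs_disp_le n q i
      have h2 : |q i| ≤ 1 := (abs_apply_le q i).trans hq
      have h3 : |8 * (1 / 16) ^ n + pos n q i| ≤ 8 * (1 / 16) ^ n + ((1 / 16) ^ n * 1 +
          22 * (1 / 2) ^ n) := by
        unfold pos
        refine (abs_add_le _ _).trans ?_
        rw [abs_of_pos (by positivity : (0 : ℝ) < 8 * (1 / 16) ^ n)]
        gcongr
        refine (abs_add_le _ _).trans ?_
        rw [abs_mul, abs_of_pos (by positivity : (0 : ℝ) < (1 / 16) ^ n)]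
        gcongr
      have h4 := shift_pos n
      obtain ⟨h5, h6⟩ := half_pow_mem n
      have h7 : (1 / 16 : ℝ) ^ n ≤ (1 / 2) ^ n := by
        gcongr; norm_num
      have h8 : 0 < cellSize n := by unfold cellSize; positivity
      have h9 : (0 : ℝ) < (1 / 16) ^ n := by positivity
      rw [pow_zero, mul_one]
      linarith
    | succ k ih =>
      intro n q hq
      have h5 : (0 : ℝ) < 31 * (1 / 2) ^ n * (1 / 2) ^ (k + 1) := by positivity
      rcases (bump_nonneg (foldMap q)).eq_or_lt with h | h
      · rw [pos_of_bump_foldMap_eq_zero h.symm]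
        have h2 := abs_le.1 ((abs_apply_le q i).trans hq)
        have h3 := zigzag_le n (bump_le_one q)
        have h4 := zigzag_nonneg n (bump_nonneg q)
        have h6 : (0 : ℝ) < (1 / 16) ^ n := by positivity
        have h7 : (1 / 16 : ℝ) ^ n ≤ (1 / 2) ^ n := by
          gcongr; norm_num
        have h8 : 4 * (1 / 2) ^ n ≤ cellSize n := by
          unfold cellSize
          have : (0 : ℝ) < (1 / 4) ^ n := by positivity
          linarith
        rw [abs_of_nonneg (by nlinarith)]
        nlinarith
      · rw [pos_of_bump_foldMap_pos h]
        have h1 := ih (n + 1) (foldMap q) (bump_pos_iff.1 h).le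
        rw [← cellSize_succ] at h1
        have h2 := abs_clampSign_of_fold (abs_fold_apply_lt (bump_pos_iff.1 h) i)
        have h3 := shift_pos n
        rw [← add_assoc]
        refine (abs_add_le _ _).trans ?_
        rw [abs_mul, h2, one_mul, abs_of_pos (by positivity)]
        have h4 : 31 * (1 / 2 : ℝ) ^ (n + 1) * (1 / 2) ^ k = 31 * (1 / 2) ^ n * (1 / 2) ^ (k + 1) := by
          rw [pow_succ, pow_succ]; ring
        rw [h4] at h1
        linarith
  have hlim : Tendsto (fun k : ℕ => shift n + 8 * (1 / 16) ^ n + cellSize n +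
      31 * (1 / 2) ^ n * (1 / 2 : ℝ) ^ k) atTop
      (𝓝 (shift n + 8 * (1 / 16) ^ n + cellSize n + 31 * (1 / 2) ^ n * 0)) :=
    ((tendsto_pow_atTop_nhds_zero_of_lt_one (by norm_num) (by norm_num)).const_mul _).const_add _
  rw [mul_zero, add_zero] at hlim
  exact ge_of_tendsto' hlim fun k => key k n q hq

/-- Children with opposite signs are mirror images; positivity of the unreflected offset puts them
on opposite sides of the mirror. This is what makes the surface embedded. Below a child the estimate
is `cellSize_lt`. -/
theorem offset_pos {n : ℕ} {q : Param} (hq : ‖q‖ ≤ 1) (i : Fin 2) :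
    0 < 8 * (1 / 16) ^ n + pos n q i := by
  rcases (bump_nonneg (foldMap q)).eq_or_lt with h | h
  · rw [pos_of_bump_foldMap_eq_zero h.symm]
    have h2 := abs_le.1 ((abs_apply_le q i).trans hq)
    have h4 := zigzag_nonneg n (bump_nonneg q)
    have h6 : (0 : ℝ) < (1 / 16) ^ n := by positivity
    nlinarith
  · rw [pos_of_bump_foldMap_pos h]
    have h1 := abs_offset_le (n := n + 1) (q := foldMap q) (bump_pos_iff.1 h).le i
    rw [← cellSize_succ] at h1
    have h2 := abs_clampSign_of_fold (abs_fold_apply_lt (bump_pos_iff.1 h) i)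
    have h3 := cellSize_lt n
    have h4 := neg_abs_le (clampSign (q i) * (8 * (1 / 16) ^ (n + 1) + pos (n + 1) (foldMap q) i))
    rw [abs_mul, h2, one_mul] at h4
    linarith

/-! ### Injectivity -/

/-- A later profile is positive only where the earlier ones equal `1`, so the height determines the
profiles one after another. -/
theorem bump_iterate_eq_of_height_eq (k : ℕ) :
    ∀ {n : ℕ} {q q' : Param}, height n q = height n q' →
      bump (foldMap^[k] q) = bump (foldMap^[k] q') := by
  have hnn : ∀ n q, 0 ≤ height n q := fun n q =>
    tsum_nonneg fun k => mul_nonneg (by positivity) (bump_nonneg _)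
  have hpos : ∀ n q, 0 < bump q → 0 < height n q := fun n q h => by
    rw [height_succ]
    have := hnn (n + 1) (foldMap q)
    positivity
  have hstep : ∀ {n : ℕ} {q q' : Param}, height n q = height n q' → bump q = bump q' ∧
      height (n + 1) (foldMap q) = height (n + 1) (foldMap q') := by
    have aux : ∀ {n : ℕ} {q q' : Param}, height n q = height n q' → ¬ bump q < bump q' := by
      intro n q q' h hlt
      have h1 := bump_foldMap_eq_zero (hlt.trans_le (bump_le_one q'))
      rw [height_of_bump_foldMap_eq_zero h1, height_succ] at h
      have := hnn (n + 1) (foldMap q')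
      have h2 : (1 / 2 : ℝ) ^ n * bump q < (1 / 2 : ℝ) ^ n * bump q' := by gcongr
      linarith
    intro n q q' h
    have heq : bump q = bump q' := le_antisymm (not_lt.1 (aux h.symm)) (not_lt.1 (aux h))
    refine ⟨heq, ?_⟩
    rw [height_succ, height_succ n q', heq] at h
    linarith
  induction k with
  | zero => exact fun h => (hstep h).1
  | succ k ih =>
    intro n q q' h
    rw [Function.iterate_succ_apply, Function.iterate_succ_apply]
    exact ih (hstep h).2

/-- Equal heights give equal profiles and hence equal zigzag displacements. The coordinates then
reveal the signs generation by generation, and each common sign improves the bound on `|q i - q' i|`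
by a factor `16`; where the folding stops, the parameters coincide. -/
theorem surf_injOn : InjOn (surf 0) (Metric.closedBall 0 1) := by
  have key : ∀ k n : ℕ, ∀ q q' : Param, ‖q‖ ≤ 1 → ‖q'‖ ≤ 1 →
      (∀ j, bump (foldMap^[j] q) = bump (foldMap^[j] q')) → ∀ i, pos n q i = pos n q' i →
      |q i - q' i| ≤ 2 * (1 / 16) ^ k := by
    intro k
    induction k with
    | zero =>
      intro n q q' hq hq' _ i _
      have h1 := (abs_apply_le q i).trans hq
      have h2 := (abs_apply_le q' i).trans hq'
      have := abs_sub (q i) (q' i)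
      rw [pow_zero]
      linarith
    | succ k ih =>
      intro n q q' hq hq' hb i hpos
      have hb0 := hb 0
      have hb1 := hb 1
      simp only [Function.iterate_zero_apply, Function.iterate_one] at hb0 hb1
      rcases (bump_nonneg (foldMap q)).eq_or_lt with h | h
      · rw [pos_of_bump_foldMap_eq_zero h.symm, pos_of_bump_foldMap_eq_zero (hb1.symm.trans h.symm),
          hb0] at hpos
        have h1 : (1 / 16 : ℝ) ^ n * q i = (1 / 16 : ℝ) ^ n * q' i := by linarith
        have h2 := mul_left_cancel₀ (by positivity) h1
        rw [h2, sub_self, abs_zero]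
        positivity
      · have h' : 0 < bump (foldMap q') := hb1 ▸ h
        have hn := bump_pos_iff.1 h
        have hn' := bump_pos_iff.1 h'
        rw [pos_of_bump_foldMap_pos h, pos_of_bump_foldMap_pos h'] at hpos
        have ha := offset_pos (n := n + 1) hn.le i
        have ha' := offset_pos (n := n + 1) hn'.le i
        have hs := abs_clampSign_of_fold (abs_fold_apply_lt hn i)
        have hs' := abs_clampSign_of_fold (abs_fold_apply_lt hn' i)
        have hmul := add_left_cancel hpos
        have hsame : clampSign (q i) = clampSign (q' i) ∧
            pos (n + 1) (foldMap q) i = pos (n + 1) (foldMap q') i := by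
          -- Opposite signs would equate a positive offset with the negative of another one.
          rcases eq_or_eq_neg_of_abs_eq hs with e | e <;>
          rcases eq_or_eq_neg_of_abs_eq hs' with e' | e' <;> rw [e, e'] at hmul
          · exact ⟨e.trans e'.symm, by linarith⟩
          · linarith
          · linarith
          · exact ⟨e.trans e'.symm, by linarith⟩
        have hi := ih (n + 1) (foldMap q) (foldMap q') hn.le hn'.le (fun j => by
          have := hb (j + 1)
          rwa [Function.iterate_succ_apply, Function.iterate_succ_apply] at this) i hsame.2
        have e1 := eq_clampSign_mul (abs_fold_apply_lt hn i)
        have e2 := eq_clampSign_mul (abs_fold_apply_lt hn' i)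
        have e3 : q i - q' i = clampSign (q i) * ((foldMap q i - foldMap q' i) / 16) := by
          calc q i - q' i = clampSign (q i) * (1 / 2 + fold (q i) / 16) -
                clampSign (q' i) * (1 / 2 + fold (q' i) / 16) := by rw [← e1, ← e2]
            _ = _ := by rw [← hsame.1]; simp only [foldMap]; ring
        rw [e3, abs_mul, hs, one_mul, abs_div, abs_of_pos (by norm_num : (0 : ℝ) < 16), pow_succ]
        linarith
  intro q hq q' hq' h
  rw [mem_closedBall_zero_iff] at hq hq'
  have h0 : ∀ i, pos 0 q i = pos 0 q' i := by
    have e0 : pos 0 q 0 = pos 0 q' 0 := congrArg (fun x : EuclideanSpace ℝ (Fin 3) => x 0) h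
    have e1 : pos 0 q 1 = pos 0 q' 1 := congrArg (fun x : EuclideanSpace ℝ (Fin 3) => x 1) h
    intro i
    fin_cases i
    · exact e0
    · exact e1
  have hh : height 0 q = height 0 q' := congrArg (fun x : EuclideanSpace ℝ (Fin 3) => x 2) h
  ext i
  have hle := fun k => key k 0 q q' hq hq'
    (fun j => bump_iterate_eq_of_height_eq j hh) i (h0 i)
  have hlim : Tendsto (fun k : ℕ => 2 * (1 / 16 : ℝ) ^ k) atTop (𝓝 (2 * 0)) :=
    (tendsto_pow_atTop_nhds_zero_of_lt_one (by norm_num) (by norm_num)).const_mul _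
  rw [mul_zero] at hlim
  have := ge_of_tendsto' hlim hle
  exact sub_eq_zero.1 (abs_eq_zero.1 (le_antisymm this (abs_nonneg _)))

/-! ### The surface and its global parametrization. -/

/-- The surface. -/
def surface : Set (EuclideanSpace ℝ (Fin 3)) := surf 0 '' Metric.ball 0 1

/-- The set of the tips of the infinite chains of tubes. -/
def tips : Set surface := {x | (x : EuclideanSpace ℝ (Fin 3)) 2 = 2}

theorem surf_mem {q : Param} (hq : ‖q‖ < 1) : surf 0 q ∈ surface :=
  mem_image_of_mem _ (mem_ball_zero_iff.2 hq)

/-- Injectivity was proved up to the boundary so that compactness of the closed square can be used.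
-/
theorem isEmbedding_surf : IsEmbedding fun q : Metric.ball (0 : Param) 1 => surf 0 q := by
  have h1 : IsClosedEmbedding fun q : Metric.closedBall (0 : Param) 1 => surf 0 q :=
    ((continuous_surf 0).comp continuous_subtype_val).isClosedEmbedding
      (injOn_iff_injective.1 surf_injOn)
  exact h1.isEmbedding.comp (IsEmbedding.inclusion Metric.ball_subset_closedBall)

/-- The surface is homeomorphic to an open square. -/
noncomputable def surfaceHomeo : Metric.ball (0 : Param) 1 ≃ₜ surface :=
  isEmbedding_surf.toHomeomorph.trans (Homeomorph.setCongr (image_eq_range _ _).symm)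

theorem surfaceHomeo_apply (q : Metric.ball (0 : Param) 1) :
    (surfaceHomeo q : EuclideanSpace ℝ (Fin 3)) = surf 0 q := rfl

instance : PolishSpace surface := by
  have : PolishSpace (Metric.ball (0 : Param) 1) := Metric.isOpen_ball.polishSpace
  exact surfaceHomeo.symm.isClosedEmbedding.polishSpace

theorem isMetricSurface_surface (h : (μHE[2] : Measure surface) univ < ∞) :
    IsMetricSurface surface := by
  refine ⟨fun x => ⟨univ, isOpen_univ, mem_univ x, ?_⟩,
    fun K _ => (measure_mono (subset_univ K)).trans_lt h⟩
  let e : Param ≃ₜ EuclideanSpace ℝ (Fin 2) :=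
    (EuclideanSpace.equiv (Fin 2) ℝ).toHomeomorph.symm
  exact ⟨e '' Metric.ball 0 1, e.isOpenMap _ Metric.isOpen_ball,
    ⟨((Homeomorph.Set.univ surface).trans surfaceHomeo.symm).trans (e.image _)⟩⟩

/-! ### The tips -/

theorem height_le (n : ℕ) (q : Param) : height n q ≤ 2 * (1 / 2) ^ n := by
  have h := tsum_of_norm_bounded (f := fun k => (1 / 2 : ℝ) ^ (n + k) * bump (foldMap^[k] q))
    ((hasSum_geometric_two).mul_left ((1 / 2) ^ n)) fun k => abs_height_term_le n k q
  rw [Real.norm_eq_abs] at h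
  unfold height
  linarith [le_abs_self (∑' k, (1 / 2 : ℝ) ^ (n + k) * bump (foldMap^[k] q))]

theorem bump_eq_one_of_height_eq (k : ℕ) : ∀ {n : ℕ} {q : Param}, height n q = 2 * (1 / 2) ^ n →
    bump (foldMap^[k] q) = 1 := by
  have step : ∀ {n : ℕ} {q : Param}, height n q = 2 * (1 / 2) ^ n → bump q = 1 ∧
      height (n + 1) (foldMap q) = 2 * (1 / 2) ^ (n + 1) := by
    intro n q h
    have h1 := height_le (n + 1) (foldMap q)
    have h2 := bump_le_one q
    obtain ⟨h3, _⟩ := half_pow_mem n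
    rw [height_succ] at h
    rw [pow_succ] at h1 ⊢
    have h4 : bump q = 1 := by
      by_contra hne
      have := lt_of_le_of_ne h2 hne
      nlinarith
    rw [h4] at h
    exact ⟨h4, by linarith⟩
  induction k with
  | zero => exact fun h => (step h).1
  | succ k ih =>
    intro n q h
    rw [Function.iterate_succ_apply]
    exact ih (step h).2

theorem height_eq_two_iff {q : Param} : height 0 q = 2 ↔ ∀ k, bump (foldMap^[k] q) = 1 := by
  constructor
  · exact fun h k => bump_eq_one_of_height_eq (n := 0) k (by rw [h]; norm_num)
  · intro h
    unfold height
    simp only [h, mul_one, zero_add]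
    exact tsum_geometric_two

theorem surf_zero (n : ℕ) (q : Param) : surf n q 0 = pos n q 0 := rfl

theorem surf_one (n : ℕ) (q : Param) : surf n q 1 = pos n q 1 := rfl

theorem surf_two (n : ℕ) (q : Param) : surf n q 2 = height n q := rfl

theorem isClosed_tips : IsClosed tips := by
  have : Continuous fun x : surface => (x : EuclideanSpace ℝ (Fin 3)) 2 := by fun_prop
  exact isClosed_eq this continuous_const

theorem mem_tips_iff {x : surface} : x ∈ tips ↔ ∃ q : Param, (∀ k, bump (foldMap^[k] q) = 1) ∧
    surf 0 q = x := by
  constructor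
  · intro hx
    obtain ⟨q, hq, hqx⟩ := x.2
    refine ⟨q, height_eq_two_iff.1 ?_, hqx⟩
    rw [← surf_two, hqx]
    exact hx
  · rintro ⟨q, hq, hqx⟩
    change (x : EuclideanSpace ℝ (Fin 3)) 2 = 2
    rw [← hqx, surf_two, height_eq_two_iff.2 hq]

/-! ### Coding by signs -/

/-- The sign that belongs to a bit. -/
def bitSign (b : Bool) : ℝ := if b then 1 else -1

theorem abs_bitSign (b : Bool) : |bitSign b| = 1 := by cases b <;> simp [bitSign]

theorem bitSign_mul_self (b : Bool) : bitSign b * bitSign b = 1 := by cases b <;> simp [bitSign]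

theorem bitSign_beq (a b : Bool) : bitSign (a == b) = bitSign a * bitSign b := by
  cases a <;> cases b <;> simp [bitSign]

theorem bitSign_injective : Function.Injective bitSign := by
  intro a b h
  cases a <;> cases b <;> simp [bitSign] at h ⊢ <;> norm_num at h

theorem exists_bitSign_eq {s : ℝ} (h : |s| = 1) : ∃ b, bitSign b = s := by
  rcases eq_or_eq_neg_of_abs_eq h with h | h
  · exact ⟨true, by simp [bitSign, h]⟩
  · exact ⟨false, by simp [bitSign, h]⟩

theorem abs_bitSign_mul_le {r : ℝ} (hr : 0 ≤ r) (d : ℕ → Bool) (k : ℕ) :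
    ‖bitSign (d k) * r ^ k‖ ≤ r ^ k := by
  rw [Real.norm_eq_abs, abs_mul, abs_bitSign, one_mul, abs_of_nonneg (by positivity)]

/-- The signed geometric series with ratio `r`. -/
noncomputable def signSum (r : ℝ) (d : ℕ → Bool) : ℝ := ∑' k, bitSign (d k) * r ^ k

theorem summable_signSum {r : ℝ} (hr : 0 ≤ r) (hr1 : r < 1) (d : ℕ → Bool) : Summable fun k => bitSign (d k) * r ^ k :=
  Summable.of_norm_bounded (summable_geometric_of_lt_one hr hr1) (abs_bitSign_mul_le hr d)

theorem abs_signSum_le {r : ℝ} (hr : 0 ≤ r) (hr1 : r < 1) (d : ℕ → Bool) : |signSum r d| ≤ (1 - r)⁻¹ := by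
  have := tsum_of_norm_bounded (hasSum_geometric_of_lt_one hr hr1) (abs_bitSign_mul_le hr d)
  exact this

theorem signSum_eq {r : ℝ} (hr : 0 ≤ r) (hr1 : r < 1) (d : ℕ → Bool) :
    signSum r d = bitSign (d 0) + r * signSum r fun k => d (k + 1) := by
  unfold signSum
  rw [(summable_signSum hr hr1 d).tsum_eq_zero_add, ← tsum_mul_left]
  congr 1
  · simp
  · exact tsum_congr fun k => by rw [pow_succ]; ring

theorem continuous_signSum {r : ℝ} (hr : 0 ≤ r) (hr1 : r < 1) : Continuous (signSum r) := by
  refine continuous_tsum (fun k => ?_) (summable_geometric_of_lt_one hr hr1)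
    fun k d => abs_bitSign_mul_le hr d k
  exact ((continuous_of_discreteTopology (f := bitSign)).comp (continuous_apply k)).mul continuous_const

/-- If the first bits at which two sequences differ are `false` and `true`, the signed sums are
ordered accordingly. -/
theorem signSum_le_signSum {r : ℝ} (hr : 0 ≤ r) (hr1 : r < 1) (hr2 : r ≤ 1 / 2) (m : ℕ) :
    ∀ {d e : ℕ → Bool}, (∀ k < m, d k = e k) →
    d m = false → e m = true → signSum r d ≤ signSum r e := by
  induction m with
  | zero =>
    intro d e _ hd he
    have h1 := abs_le.1 (abs_signSum_le hr hr1 fun k => d (k + 1))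
    have h2 := abs_le.1 (abs_signSum_le hr hr1 fun k => e (k + 1))
    have h3 : r * (1 - r)⁻¹ ≤ 1 := by
      rw [← div_eq_mul_inv, div_le_one (by linarith)]; linarith
    rw [signSum_eq hr hr1 d, signSum_eq hr hr1 e, hd, he]
    simp only [bitSign, if_true, Bool.false_eq_true, if_false]
    nlinarith
  | succ m ih =>
    intro d e h hd he
    have := ih (d := fun k => d (k + 1)) (e := fun k => e (k + 1))
      (fun k hk => h (k + 1) (by omega)) hd he
    rw [signSum_eq hr hr1 d, signSum_eq hr hr1 e, h 0 (by omega)]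
    gcongr

/-- The sums with ratios `1 / 2` and `1 / 4` both respect the lexicographic order, so their
differences have the same sign and cannot cancel. -/
theorem abs_signSum_sub_le (d e : ℕ → Bool) : 2 * |signSum (1 / 2) d - signSum (1 / 2) e| ≤
    |2 * signSum (1 / 2) d + 3 / 2 * signSum (1 / 4) d -
      (2 * signSum (1 / 2) e + 3 / 2 * signSum (1 / 4) e)| := by
  have key : ∀ m (d e : ℕ → Bool), (∀ k < m, d k = e k) → d m = false → e m = true →
      2 * |signSum (1 / 2) d - signSum (1 / 2) e| ≤
      |2 * signSum (1 / 2) d + 3 / 2 * signSum (1 / 4) d -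
      (2 * signSum (1 / 2) e + 3 / 2 * signSum (1 / 4) e)| := by
    intro m d e h hd he
    have h1 := signSum_le_signSum (r := 1 / 2) (by norm_num) (by norm_num) (by norm_num) m h hd he
    have h2 := signSum_le_signSum (r := 1 / 4) (by norm_num) (by norm_num) (by norm_num) m h hd he
    rw [abs_of_nonpos (by linarith), abs_of_nonpos (by linarith)]
    linarith
  by_cases hde : d = e
  · simp [hde]
  have hex : ∃ m, d m ≠ e m := Function.ne_iff.1 hde
  classical
  have hm := Nat.find_spec hex
  have hlt : ∀ k < Nat.find hex, d k = e k := fun k hk => not_not.1 (Nat.find_min hex hk)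
  set m := Nat.find hex
  cases hd : d m
  · exact key m d e hlt hd (by rw [hd] at hm; simpa using hm.symm)
  · have he : e m = false := by rw [hd] at hm; simpa using hm.symm
    rw [abs_sub_comm, abs_sub_comm (2 * _ + _)]
    exact key m e d (fun k hk => (hlt k hk).symm) he hd

theorem signSum_half_surjOn {t : ℝ} (ht : |t| ≤ 1) : ∃ d, signSum (1 / 2) d = t := by
  -- A binary digit `δ` corresponds to the sign `2 * δ - 1`; summing against `(1 / 2) ^ k` turns a
  -- binary expansion of `x` into `4 * x - 2`.
  have h1 : (t + 2) / 4 ∈ Icc (0 : ℝ) 1 := by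
    have := abs_le.1 ht
    constructor <;> linarith
  obtain ⟨d, hd, hsum⟩ := Real.ofDigits_SurjOn (b := 2) (by norm_num) h1
  refine ⟨fun k => d k == 1, ?_⟩
  have h2 : ∀ k, bitSign (d k == 1) * (1 / 2) ^ k =
      4 * Real.ofDigitsTerm d k - (1 / 2 : ℝ) ^ k := by
    intro k
    have : d k = 0 ∨ d k = 1 := by
      generalize d k = x
      fin_cases x <;> simp
    rcases this with h | h
    · simp [bitSign, h, Real.ofDigitsTerm]
    · simp [bitSign, h, Real.ofDigitsTerm, pow_succ]
      ring
  unfold signSum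
  rw [tsum_congr h2, Summable.tsum_sub, tsum_mul_left, tsum_geometric_two]
  · have : ∑' k, Real.ofDigitsTerm d k = (t + 2) / 4 := hsum
    rw [this]; ring
  · exact Real.summable_ofDigitsTerm.mul_left 4
  · exact summable_geometric_two

/-- The point of the line with a given coding. -/
noncomputable def code (d : ℕ → Bool) : ℝ := 1 / 2 * signSum (1 / 16) d

theorem continuous_code : Continuous code :=
  continuous_const.mul (continuous_signSum (by norm_num) (by norm_num))

theorem abs_code_le (d : ℕ → Bool) : |code d| ≤ 8 / 15 := by
  have := abs_signSum_le (r := 1 / 16) (by norm_num) (by norm_num) d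
  rw [code, abs_mul, abs_of_pos (by norm_num : (0 : ℝ) < 1 / 2)]
  norm_num at this ⊢
  linarith

/-- Folding reflects the negative half of the line and so multiplies all later signs by the first
one; in bits this is comparison with `d 0`. -/
theorem code_eq (d : ℕ → Bool) :
    code d = bitSign (d 0) * (1 / 2 + code (fun k => d 0 == d (k + 1)) / 16) := by
  have h : signSum (1 / 16) (fun k => d 0 == d (k + 1)) =
      bitSign (d 0) * signSum (1 / 16) fun k => d (k + 1) := by
    unfold signSum
    rw [← tsum_mul_left]
    exact tsum_congr fun k => by rw [bitSign_beq, mul_assoc]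
  rw [code, code, h, signSum_eq (by norm_num) (by norm_num)]
  linear_combination (-(1 / 32) * signSum (1 / 16) (fun k => d (k + 1))) * bitSign_mul_self (d 0)

theorem clampSign_code (d : ℕ → Bool) : clampSign (code d) = bitSign (d 0) := by
  have h := abs_le.1 (abs_code_le fun k => d 0 == d (k + 1))
  rw [code_eq]
  generalize code (fun k => d 0 == d (k + 1)) = y at h ⊢
  cases d 0
  · simp only [bitSign, Bool.false_eq_true, if_false]
    exact clampSign_of_neg (by linarith)
  · simp only [bitSign, if_true]
    exact clampSign_of_pos (by linarith)

theorem fold_code (d : ℕ → Bool) : fold (code d) = code fun k => d 0 == d (k + 1) := by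
  have h := abs_le.1 (abs_code_le fun k => d 0 == d (k + 1))
  rw [fold, code_eq, abs_mul, abs_bitSign, one_mul, abs_of_pos (by linarith)]
  ring

theorem abs_iterate_fold_code_le (k : ℕ) : ∀ d, |fold^[k] (code d)| ≤ 8 / 15 := by
  induction k with
  | zero => exact abs_code_le
  | succ k ih => intro d; rw [Function.iterate_succ_apply, fold_code]; exact ih _

/-- The successive reflections cancel in the product of the signs along the orbit, which is why
`disp` is weighted with these products. -/
theorem signProd_code (k : ℕ) : ∀ d, signProd (k + 1) (code d) = bitSign (d k) := by
  induction k with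
  | zero => intro d; rw [signProd_succ, clampSign_code]; simp [signProd]
  | succ k ih =>
    intro d
    rw [signProd_succ, clampSign_code, fold_code, ih, bitSign_beq, ← mul_assoc, bitSign_mul_self,
      one_mul]

theorem code_injective : Function.Injective code := by
  intro d e h
  funext k
  apply bitSign_injective
  rw [← signProd_code, h, signProd_code]

/-- Unrolling the inverse branches of `fold` `n` times leaves a remainder of size at most `(1 / 16)
^ n`. -/
theorem exists_code_eq {s : ℝ} (h : ∀ k, |fold^[k] s| < 1) : ∃ d, code d = s := by
  have h1 : ∀ k, |signProd k s| = 1 := by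
    intro k
    unfold signProd
    rw [Finset.abs_prod]
    exact Finset.prod_eq_one fun j _ => abs_clampSign_of_fold
      (by rw [← Function.iterate_succ_apply' fold]; exact h (j + 1))
  choose d hd using fun k => exists_bitSign_eq (h1 (k + 1))
  refine ⟨d, ?_⟩
  have h2 : ∀ n, s = 1 / 2 * ∑ k ∈ Finset.range n, bitSign (d k) * (1 / 16) ^ k +
      signProd n s * (1 / 16) ^ n * fold^[n] s := by
    intro n
    induction n with
    | zero => simp [signProd]
    | succ n ih =>
      have h3 := eq_clampSign_mul (s := fold^[n] s)
        (by rw [← Function.iterate_succ_apply' fold]; exact h (n + 1))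
      have h4 : signProd (n + 1) s = signProd n s * clampSign (fold^[n] s) := by
        unfold signProd; rw [Finset.prod_range_succ]
      rw [Finset.sum_range_succ, hd, h4, Function.iterate_succ_apply' fold, pow_succ]
      nth_rewrite 1 [ih]
      nth_rewrite 1 [h3]
      ring
  have h3 : Tendsto (fun n => 1 / 2 * ∑ k ∈ Finset.range n, bitSign (d k) * (1 / 16) ^ k)
      atTop (𝓝 (code d)) :=
    (summable_signSum (by norm_num) (by norm_num) d).hasSum.tendsto_sum_nat.const_mul _
  have h4 : Tendsto (fun n => signProd n s * (1 / 16) ^ n * fold^[n] s) atTop (𝓝 0) := by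
    refine squeeze_zero_norm (fun n => ?_)
      (tendsto_pow_atTop_nhds_zero_of_lt_one (r := (1 / 16 : ℝ)) (by norm_num) (by norm_num))
    rw [norm_mul, norm_mul, Real.norm_eq_abs, h1, one_mul, Real.norm_eq_abs, Real.norm_eq_abs,
      abs_of_pos (by positivity)]
    exact mul_le_of_le_one_right (by positivity) (h n).le
  have h5 := h3.add h4
  rw [add_zero] at h5
  exact tendsto_nhds_unique h5 (tendsto_const_nhds.congr h2)

theorem bump_iterate_code (d : Fin 2 → ℕ → Bool) (k : ℕ) :
    bump (foldMap^[k] fun i => code (d i)) = 1 := by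
  refine bump_eq_one ((pi_norm_le_iff_of_nonneg (by norm_num)).2 fun i => ?_)
  rw [iterate_foldMap_apply]
  exact (abs_iterate_fold_code_le k (d i)).trans (by norm_num)

theorem exists_code_of_bump {q : Param} (h : ∀ k, bump (foldMap^[k] q) = 1) :
    ∃ d : Fin 2 → ℕ → Bool, (fun i => code (d i)) = q := by
  choose d hd using fun i => exists_code_eq (s := q i) fun k => by
    rw [← iterate_foldMap_apply]
    exact (abs_apply_le _ i).trans_lt (bump_pos_iff.1 (by rw [h k]; exact one_pos))
  exact ⟨d, funext hd⟩

theorem norm_code_lt (d : Fin 2 → ℕ → Bool) : ‖(fun i => code (d i) : Param)‖ < 1 :=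
  (pi_norm_lt_iff one_pos).2 fun i => (abs_code_le (d i)).trans_lt (by norm_num)

theorem nonempty_tips_homeomorph : Nonempty (tips ≃ₜ (ℕ → Bool)) := by
  obtain ⟨e⟩ : Nonempty (ℕ ≃ Fin 2 × ℕ) := nonempty_equiv_of_countable
  let c : (ℕ → Bool) → Param := fun d i => code fun k => d (e.symm (i, k))
  have hc : Continuous c := continuous_pi fun i => continuous_code.comp (by fun_prop)
  have hlt : ∀ d, ‖c d‖ < 1 := fun d => norm_code_lt fun i k => d (e.symm (i, k))
  let f : (ℕ → Bool) → tips := fun d => ⟨⟨surf 0 (c d), surf_mem (hlt d)⟩,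
    mem_tips_iff.2 ⟨c d, fun k => bump_iterate_code (fun i k => d (e.symm (i, k))) k, rfl⟩⟩
  have hf : Continuous f :=
    (((continuous_surf 0).comp hc).subtype_mk _).subtype_mk _
  have hinj : Function.Injective f := by
    intro d d' h
    have h1 : surf 0 (c d) = surf 0 (c d') := congrArg (fun x : tips => ((x : surface) : EuclideanSpace ℝ (Fin 3))) h
    have h2 := surf_injOn (mem_closedBall_zero_iff.2 (hlt d).le)
      (mem_closedBall_zero_iff.2 (hlt d').le) h1
    funext n
    have h3 := congrFun (code_injective (congrFun h2 (e n).1)) (e n).2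
    simpa using h3
  have hsurj : Function.Surjective f := by
    rintro ⟨x, hx⟩
    obtain ⟨q, hq, hqx⟩ := mem_tips_iff.1 hx
    obtain ⟨d, rfl⟩ := exists_code_of_bump hq
    refine ⟨fun n => d (e n).1 (e n).2, Subtype.ext (Subtype.ext ?_)⟩
    rw [← hqx]
    simp [f, c]
  exact ⟨(hf.homeoOfEquivCompactToT2 (f := Equiv.ofBijective f ⟨hinj, hsurj⟩)).symm⟩

/-- The term `-8 * (1 / 16) ^ n` of `shift` is there to cancel the parameter `code (d i)` itself.
What remains depends on the signs of the `i`-th coordinate alone, so the tips form a product. -/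
theorem pos_code (d : Fin 2 → ℕ → Bool) (i : Fin 2) :
    pos 0 (fun i => code (d i)) i =
      shift 0 + (2 * signSum (1 / 2) (d i) + 3 / 2 * signSum (1 / 4) (d i)) := by
  have h1 : ∀ k, signProd k (code (d i)) * zigzag (0 + k) (bump (foldMap^[k] fun i => code (d i))) =
      signProd k (code (d i)) * shift k := fun k => by
    rw [bump_iterate_code, zigzag_one, zero_add]
  have hs := summable_disp 0 (fun i => code (d i)) i
  simp only [h1] at hs
  have s1 := summable_signSum (r := 1 / 2) (by norm_num) (by norm_num) (d i)
  have s2 := summable_signSum (r := 1 / 4) (by norm_num) (by norm_num) (d i)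
  have s3 := summable_signSum (r := 1 / 16) (by norm_num) (by norm_num) (d i)
  have h2 : ∀ k, signProd (k + 1) (code (d i)) * shift (k + 1) =
      2 * (bitSign (d i k) * (1 / 2) ^ k) + 3 / 2 * (bitSign (d i k) * (1 / 4) ^ k) -
        1 / 2 * (bitSign (d i k) * (1 / 16) ^ k) := by
    intro k
    rw [signProd_code, shift, pow_succ, pow_succ, pow_succ]
    ring
  rw [pos, disp, tsum_congr h1, hs.tsum_eq_zero_add, tsum_congr h2,
    ((s1.mul_left 2).add (s2.mul_left (3 / 2))).tsum_sub (s3.mul_left _),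
    (s1.mul_left 2).tsum_add (s2.mul_left (3 / 2)), tsum_mul_left, tsum_mul_left, tsum_mul_left]
  change _ = shift 0 + (2 * (∑' k, bitSign (d i k) * (1 / 2) ^ k) +
    3 / 2 * (∑' k, bitSign (d i k) * (1 / 4) ^ k))
  simp only [code, signSum, signProd, Finset.range_zero, Finset.prod_empty]
  ring

/-! ### The horizontal chart of the set of tips -/

/-- The horizontal projection. -/
noncomputable def horizontal (x : surface) : Plane :=
  !₂[(x : EuclideanSpace ℝ (Fin 3)) 0, (x : EuclideanSpace ℝ (Fin 3)) 1]

theorem continuous_horizontal : Continuous horizontal := by unfold horizontal; fun_prop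

theorem isometryOn_horizontal : IsometryOn horizontal tips := by
  intro x hx y hy
  change (x : EuclideanSpace ℝ (Fin 3)) 2 = 2 at hx
  change (y : EuclideanSpace ℝ (Fin 3)) 2 = 2 at hy
  rw [Subtype.dist_eq, EuclideanSpace.dist_eq, EuclideanSpace.dist_eq, Fin.sum_univ_three,
    Fin.sum_univ_two, hx, hy]
  simp [horizontal]

theorem planarChart_of_isometryOn {X : Type*} [MetricSpace X] [MeasurableSpace X] [BorelSpace X]
    [Nonempty X] {P : Set X} {j : X → Plane} (hj : Continuous j) (h : IsometryOn j P) :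
    PlanarChart P j (Function.invFunOn j P) :=
  ⟨hj, h, fun _ hx => h.injOn.leftInvOn_invFunOn hx⟩

/-- Every point of the unit disc is a pair of signed sums of ratio `1 / 2`; let `f` choose a tip
with these signs. By `abs_signSum_sub_le` this does not decrease distances, so the tips have at
least the area of the disc. -/
theorem tips_pos : 0 < (μHE[2] : Measure surface) tips := by
  have hsq : ∀ z : Plane, z ∈ Metric.ball (0 : Plane) 1 → ∃ x : surface, x ∈ tips ∧
      ∃ d : Fin 2 → ℕ → Bool, (∀ i, signSum (1 / 2) (d i) = z i) ∧
        (x : EuclideanSpace ℝ (Fin 3)) = surf 0 fun i => code (d i) := by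
    intro z hz
    choose d hd using fun i => signSum_half_surjOn (t := z i)
      ((PiLp.norm_apply_le z i).trans (mem_ball_zero_iff.1 hz).le)
    exact ⟨⟨_, surf_mem (norm_code_lt d)⟩, mem_tips_iff.2 ⟨_, bump_iterate_code d, rfl⟩,
      d, hd, rfl⟩
  obtain ⟨x0, hx0, -⟩ := hsq 0 (by simp)
  have hsq' : ∀ z : Plane, ∃ x : surface, z ∈ Metric.ball (0 : Plane) 1 → x ∈ tips ∧
      ∃ d : Fin 2 → ℕ → Bool, (∀ i, signSum (1 / 2) (d i) = z i) ∧
        (x : EuclideanSpace ℝ (Fin 3)) = surf 0 fun i => code (d i) := by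
    intro z
    by_cases hz : z ∈ Metric.ball (0 : Plane) 1
    · obtain ⟨x, hx⟩ := hsq z hz
      exact ⟨x, fun _ => hx⟩
    · exact ⟨x0, fun h => absurd h hz⟩
  choose f hf using hsq'
  have hdist : ∀ z ∈ Metric.ball (0 : Plane) 1, ∀ w ∈ Metric.ball (0 : Plane) 1,
      dist z w ≤ ((1 : ℝ≥0) : ℝ) * dist (f z) (f w) := by
    intro z hz w hw
    obtain ⟨hz1, d, hd, hzd⟩ := hf z hz
    obtain ⟨hw1, e, he, hwe⟩ := hf w hw
    rw [NNReal.coe_one, one_mul, ← isometryOn_horizontal _ hz1 _ hw1, EuclideanSpace.dist_eq,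
      EuclideanSpace.dist_eq]
    have hi : ∀ i, dist (z i) (w i) ≤ dist (horizontal (f z) i) (horizontal (f w) i) := by
      intro i
      have h1 : horizontal (f z) i = pos 0 (fun i => code (d i)) i := by
        fin_cases i <;> simp [horizontal, hzd, surf]
      have h2 : horizontal (f w) i = pos 0 (fun i => code (e i)) i := by
        fin_cases i <;> simp [horizontal, hwe, surf]
      rw [h1, h2, pos_code, pos_code, Real.dist_eq, Real.dist_eq, ← hd i, ← he i,
        add_sub_add_left_eq_sub]
      have := abs_signSum_sub_le (d i) (e i)
      have := abs_nonneg (signSum (1 / 2) (d i) - signSum (1 / 2) (e i))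
      linarith
    exact Real.sqrt_le_sqrt (Finset.sum_le_sum fun i _ => by gcongr; exact hi i)
  have h1 := euclideanHausdorffMeasure_le_mul_image hdist 2
  have h2 : f '' Metric.ball (0 : Plane) 1 ⊆ tips := by
    rintro _ ⟨z, hz, rfl⟩
    exact (hf z hz).1
  rw [euclideanHausdorffMeasure_two_plane, ENNReal.coe_one, one_pow, one_mul] at h1
  exact (Metric.measure_ball_pos volume 0 one_pos).trans_le (h1.trans (measure_mono h2))

/-! ### Infinite length of paths that leave a tip. -/

/-- The iterated folding of the first coordinate in space. -/
noncomputable def unwind : ℕ → ℝ → ℝ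
  | 0, y => y
  | m + 1, y => |unwind m y - shift m| - 8 * (1 / 16) ^ (m + 1)

theorem abs_unwind_sub_le (m : ℕ) (y z : ℝ) : |unwind m y - unwind m z| ≤ |y - z| := by
  induction m with
  | zero => exact le_rfl
  | succ m ih =>
    have := abs_abs_sub_abs_le_abs_sub (unwind m y - shift m) (unwind m z - shift m)
    rw [sub_sub_sub_cancel_right] at this
    simp only [unwind]
    rw [sub_sub_sub_cancel_right]
    exact this.trans ih

theorem bump_iterate_pos_of_le {q : Param} {m : ℕ} (h : 0 < bump (foldMap^[m] q)) {k : ℕ}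
    (hk : k ≤ m) : 0 < bump (foldMap^[k] q) := by
  by_contra hn
  have h1 := bump_iterate_eq_zero hk (le_antisymm (not_lt.1 hn) (bump_nonneg _))
  exact h.ne' h1

/-- By `offset_pos` the absolute value undoes the reflection. Thus the first coordinate in the frame
of generation `m` is a `1`-Lipschitz function of the first coordinate in space, the same for all
tubes, and jumps in the frame are jumps in space. -/
theorem unwind_pos (m : ℕ) {q : Param} (h : 0 < bump (foldMap^[m] q)) :
    unwind m (pos 0 q 0) = pos m (foldMap^[m] q) 0 := by
  induction m with
  | zero => rfl
  | succ m ih =>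
    have h1 : 0 < bump (foldMap (foldMap^[m] q)) := by
      rwa [Function.iterate_succ_apply'] at h
    have hn := bump_pos_iff.1 h1
    have h2 := abs_clampSign_of_fold (abs_fold_apply_lt hn 0)
    have h3 := offset_pos (n := m + 1) hn.le 0
    rw [unwind, ih (bump_iterate_pos_of_le h (Nat.le_succ m)), pos_of_bump_foldMap_pos h1,
      add_sub_cancel_left, abs_mul, h2, one_mul, abs_of_pos h3, Function.iterate_succ_apply']
    ring

theorem pos_iterate_of_bump_lt {q : Param} {m : ℕ} (h : bump (foldMap^[m] q) < 1) :
    pos m (foldMap^[m] q) 0 = (1 / 16) ^ m * (foldMap^[m] q) 0 + zigzag m (bump (foldMap^[m] q)) :=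
  pos_of_bump_foldMap_eq_zero (bump_foldMap_eq_zero h) 0

/-- The zigzag profile at the multiples of half of the period. -/
theorem zigzag_half_integer (m i : ℕ) : zigzag m (i / (2 * 4 ^ m)) =
    shift m * (i / (2 * 4 ^ m)) + if Even i then 0 else (1 / 2) ^ m := by
  have h4 : (4 : ℝ) ^ m ≠ 0 := by positivity
  have h1 : (4 : ℝ) ^ m * (i / (2 * 4 ^ m)) = i / 2 := by field_simp
  rw [zigzag, h1]
  congr 1
  rcases Nat.even_or_odd' i with ⟨j, rfl | rfl⟩
  · rw [if_pos (even_two_mul j)]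
    have : (((2 * j : ℕ) : ℝ)) / 2 = ((j : ℤ) : ℝ) := by push_cast; ring
    rw [this, round_intCast, sub_self, abs_zero, mul_zero]
  · rw [if_neg (Nat.not_even_iff_odd.2 (odd_two_mul_add_one j))]
    have h2 : (((2 * j + 1 : ℕ) : ℝ)) / 2 = ((j : ℤ) : ℝ) + 1 / 2 := by push_cast; ring
    have h3 : round (((j : ℤ) : ℝ) + 1 / 2) = (j : ℤ) + 1 := by
      rw [round_eq, Int.floor_eq_iff]; push_cast; constructor <;> linarith
    rw [h2, h3]
    push_cast
    have : ((j : ℝ) + 1 / 2 - (j + 1)) = -(1 / 2) := by ring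
    rw [this, abs_neg, abs_of_pos (by norm_num)]
    ring

/-- The first coordinate jumps between two consecutive half periods of the zigzag. -/
theorem half_pow_le_abs_sub {m i : ℕ} (hm : 2 ≤ m) {q q' : Param}
    (hq : bump (foldMap^[m] q) = (i + 1 : ℕ) / (2 * 4 ^ m))
    (hq' : bump (foldMap^[m] q') = (i + 2 : ℕ) / (2 * 4 ^ m)) (hi : i + 2 < 2 * 4 ^ m) :
    1 / 2 * (1 / 2 : ℝ) ^ m ≤ |pos 0 q 0 - pos 0 q' 0| := by
  have h4 : (0 : ℝ) < 2 * 4 ^ m := by positivity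
  have hi' : ((i + 2 : ℕ) : ℝ) < 2 * 4 ^ m := by exact_mod_cast hi
  have b1 : 0 < bump (foldMap^[m] q) := by rw [hq]; positivity
  have b1' : 0 < bump (foldMap^[m] q') := by rw [hq']; positivity
  have b2' : bump (foldMap^[m] q') < 1 := by rw [hq', div_lt_one h4]; exact hi'
  have b2 : bump (foldMap^[m] q) < 1 := by
    rw [hq, div_lt_one h4]; refine lt_trans ?_ hi'; push_cast; linarith
  refine le_trans ?_ (abs_unwind_sub_le m _ _)
  rw [unwind_pos m b1, unwind_pos m b1', pos_iterate_of_bump_lt b2, pos_iterate_of_bump_lt b2',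
    hq, hq', zigzag_half_integer, zigzag_half_integer]
  have hx := abs_le.1 ((abs_apply_le (foldMap^[m] q) 0).trans (bump_pos_iff.1 b1).le)
  have hx' := abs_le.1 ((abs_apply_le (foldMap^[m] q') 0).trans (bump_pos_iff.1 b1').le)
  obtain ⟨hr, -⟩ := half_pow_mem m
  have hs := shift_le m
  have hs0 := shift_pos m
  have hr2 : ((1 / 2 : ℝ)) ^ m ≤ 1 / 4 := by
    calc ((1 / 2 : ℝ)) ^ m ≤ (1 / 2) ^ 2 := pow_le_pow_of_le_one (by norm_num) (by norm_num) hm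
      _ = _ := by norm_num
  have e4 : (((i + 2 : ℕ) : ℝ) / (2 * 4 ^ m)) =
      ((i + 1 : ℕ) : ℝ) / (2 * 4 ^ m) + 1 / 2 * ((1 / 2 : ℝ) ^ m) ^ 2 := by
    rw [← quarter_pow, one_div_pow]; push_cast; field_simp; ring
  rw [e4, sixteenth_pow]
  generalize ((i + 1 : ℕ) : ℝ) / (2 * 4 ^ m) = c
  generalize foldMap^[m] q 0 = x at hx ⊢
  generalize foldMap^[m] q' 0 = x' at hx' ⊢
  generalize shift m = β at hs hs0 ⊢
  generalize (1 / 2 : ℝ) ^ m = r at hr hs hr2 ⊢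
  have hr4 : r ^ 4 ≤ 1 / 64 * r := by
    have : r ^ 3 ≤ (1 / 4) ^ 3 := by gcongr
    nlinarith
  have hr4' : 0 < r ^ 4 := by positivity
  -- Between consecutive half periods the zigzag jumps by `r`. The change of the parameter costs at
  -- most `r / 32` and the drift at most `5 * r / 16`, so more than `r / 2` is left.
  have p1 : |r ^ 4 * (x - x')| ≤ 1 / 32 * r := by
    rw [abs_mul, abs_of_pos hr4']
    have : |x - x'| ≤ 2 := abs_le.2 ⟨by linarith, by linarith⟩
    nlinarith [abs_nonneg (x - x')]
  have p2 : 0 ≤ β * (1 / 2 * r ^ 2) ∧ β * (1 / 2 * r ^ 2) ≤ 5 / 16 * r := by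
    refine ⟨by positivity, ?_⟩
    have hr2' : r ^ 2 ≤ 1 / 16 := by nlinarith
    calc β * (1 / 2 * r ^ 2) ≤ 10 * r * (1 / 2 * (1 / 16)) := by gcongr
      _ = _ := by ring
  have p1' := abs_le.1 p1
  rcases Nat.even_or_odd i with he | ho
  · rw [if_neg (Nat.not_even_iff_odd.2 he.add_one), if_pos (he.add even_two)]
    refine le_trans ?_ (le_abs_self _)
    nlinarith
  · rw [if_pos ho.add_one, if_neg (Nat.not_even_iff_odd.2 (ho.add_even even_two))]
    refine le_trans ?_ (neg_le_abs _)
    nlinarith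

/-- A continuous function that descends from `1` to `0` takes the values in between in a monotone
order. -/
theorem exists_antitone_section {b : ℝ → ℝ} (hb : Continuous b) (h0 : b 0 = 1) (h1 : b 1 = 0) :
    ∃ τ : ℝ → ℝ, AntitoneOn τ (Icc 0 1) ∧ ∀ c ∈ Icc (0 : ℝ) 1, b (τ c) = c := by
  have hbdd : ∀ c, BddAbove {t ∈ Icc (0 : ℝ) 1 | c ≤ b t} := fun c => ⟨1, fun t ht => ht.1.2⟩
  have hne : ∀ c ∈ Icc (0 : ℝ) 1, {t ∈ Icc (0 : ℝ) 1 | c ≤ b t}.Nonempty := fun c hc =>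
    ⟨0, ⟨le_rfl, zero_le_one⟩, by rw [h0]; exact hc.2⟩
  refine ⟨fun c => sSup {t ∈ Icc (0 : ℝ) 1 | c ≤ b t}, fun c hc c' hc' hcc' => ?_, fun c hc => ?_⟩
  · exact csSup_le_csSup (hbdd c) (hne c' hc') fun t ht => ⟨ht.1, hcc'.trans ht.2⟩
  · have hclosed : IsClosed {t ∈ Icc (0 : ℝ) 1 | c ≤ b t} :=
      isClosed_Icc.inter (isClosed_le continuous_const hb)
    have hmem := hclosed.csSup_mem (hne c hc) (hbdd c)
    set τ := sSup {t ∈ Icc (0 : ℝ) 1 | c ≤ b t} with hτ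
    obtain ⟨t, ht, hbt⟩ := intermediate_value_Icc' hmem.1.2 hb.continuousOn
      (show c ∈ Icc (b 1) (b τ) from ⟨by rw [h1]; exact hc.1, hmem.2⟩)
    have : t ≤ τ := le_csSup (hbdd c) ⟨⟨hmem.1.1.trans ht.1, ht.2⟩, hbt.ge⟩
    change b τ = c
    rw [← le_antisymm this ht.1, hbt]

/-- A curve that descends from a tip has infinite length. -/
theorem eVariationOn_eq_top {g : ℝ → surface} (hg : Continuous g) (h0 : g 0 ∈ tips)
    (h1 : g 1 ∉ tips) : eVariationOn g univ = ∞ := by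
  let q : ℝ → Param := fun t => surfaceHomeo.symm (g t)
  have hq : Continuous q := continuous_subtype_val.comp (surfaceHomeo.symm.continuous.comp hg)
  have hgq : ∀ t, (g t : EuclideanSpace ℝ (Fin 3)) = surf 0 (q t) := fun t => by
    rw [← surfaceHomeo_apply, Homeomorph.apply_symm_apply]
  have htip : ∀ t, g t ∈ tips ↔ ∀ k, bump (foldMap^[k] (q t)) = 1 := fun t => by
    rw [← height_eq_two_iff, ← surf_two, ← hgq]; rfl
  rw [htip] at h0 h1
  push Not at h1
  obtain ⟨M, hM⟩ := h1
  have hM' : bump (foldMap^[M + 1] (q 1)) = 0 := by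
    rw [Function.iterate_succ_apply']
    exact bump_foldMap_eq_zero (lt_of_le_of_ne (bump_le_one _) hM)
  -- The profile of generation `m` runs from `1` at the tip to `0`, passing all half periods in
  -- order: `2 * 4 ^ m - 2` jumps of size at least `1 / 2 * (1 / 2) ^ m`.
  have key : ∀ m, max 2 (M + 1) ≤ m → ENNReal.ofReal (2 ^ m - 1) ≤ eVariationOn g univ := by
    intro m hm
    have hm2 : 2 ≤ m := (le_max_left _ _).trans hm
    obtain ⟨τ, hanti, hτ⟩ := exists_antitone_section (b := fun t => bump (foldMap^[m] (q t)))
      (continuous_bump.comp ((continuous_foldMap.iterate m).comp hq)) (h0 m)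
      (bump_iterate_eq_zero ((le_max_right _ _).trans hm) hM')
    have h4 : (0 : ℝ) < 2 * 4 ^ m := by positivity
    have h4n : 16 ≤ 4 ^ m := by
      calc 16 = 4 ^ 2 := by norm_num
        _ ≤ 4 ^ m := Nat.pow_le_pow_right (by norm_num) hm2
    have hc : ∀ i : ℕ, i ≤ 2 * 4 ^ m → (i : ℝ) / (2 * 4 ^ m) ∈ Icc (0 : ℝ) 1 := fun i hi =>
      ⟨by positivity, (div_le_one h4).2 (by exact_mod_cast hi)⟩
    -- Counting downwards makes the times increase. In the range used, the end values `0` and `1` of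
    -- the profile are left out, since the formula for the position needs a value strictly in
    -- between.
    let u : ℕ → ℝ := fun i => τ (((2 * 4 ^ m - 1 - i : ℕ) : ℝ) / (2 * 4 ^ m))
    have hu : Monotone u := by
      intro i j hij
      refine hanti (hc _ (by omega)) (hc _ (by omega)) ?_
      gcongr
    have hsum := eVariationOn.sum_le (f := g) (s := univ) (n := 2 * 4 ^ m - 2) hu fun _ => mem_univ _
    refine le_trans ?_ hsum
    have hterm : ∀ i ∈ Finset.range (2 * 4 ^ m - 2),
        ENNReal.ofReal (1 / 2 * (1 / 2 : ℝ) ^ m) ≤ edist (g (u (i + 1))) (g (u i)) := by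
      intro i hi
      rw [Finset.mem_range] at hi
      obtain ⟨l, hl⟩ : ∃ l, 2 * 4 ^ m - 1 - i = l + 2 := ⟨2 * 4 ^ m - 1 - i - 2, by omega⟩
      have hl' : 2 * 4 ^ m - 1 - (i + 1) = l + 1 := by omega
      have e1 : bump (foldMap^[m] (q (u i))) = (l + 2 : ℕ) / (2 * 4 ^ m) := by
        rw [← hl]; exact hτ _ (hc _ (by omega))
      have e2 : bump (foldMap^[m] (q (u (i + 1)))) = (l + 1 : ℕ) / (2 * 4 ^ m) := by
        rw [← hl']; exact hτ _ (hc _ (by omega))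
      rw [edist_dist]
      refine ENNReal.ofReal_le_ofReal ((half_pow_le_abs_sub hm2 e2 e1 (by omega)).trans ?_)
      rw [Subtype.dist_eq, hgq, hgq, ← surf_zero, ← surf_zero, ← Real.dist_eq]
      exact (PiLp.dist_apply_le _ _ 0)
    refine le_trans ?_ (Finset.sum_le_sum hterm)
    rw [Finset.sum_const, Finset.card_range, nsmul_eq_mul, ← ENNReal.ofReal_natCast,
      ← ENNReal.ofReal_mul (by positivity)]
    refine ENNReal.ofReal_le_ofReal ?_
    rw [Nat.cast_sub (by omega)]
    push_cast
    have h5 : ((4 : ℝ)) ^ m * (1 / 2) ^ m = 2 ^ m := by rw [← mul_pow]; norm_num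
    have h6 := (half_pow_mem m).2
    linarith
  refine ENNReal.eq_top_of_forall_nnreal_le fun r => ?_
  obtain ⟨m, hm⟩ := ((tendsto_pow_atTop_atTop_of_one_lt (r := (2 : ℝ)) (by norm_num)).eventually
    (eventually_ge_atTop ((r : ℝ) + 1)) |>.and (eventually_ge_atTop (max 2 (M + 1)))).exists
  refine le_trans ?_ (key m hm.2)
  rw [← ENNReal.ofReal_coe_nnreal]
  exact ENNReal.ofReal_le_ofReal (by linarith [hm.1])

theorem isTotallyDisconnected_tips : IsTotallyDisconnected tips := by
  obtain ⟨e⟩ := nonempty_tips_homeomorph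
  have h : TotallyDisconnectedSpace tips := ⟨e.isEmbedding.isTotallyDisconnected
    (isTotallyDisconnected_of_totallyDisconnectedSpace _)⟩
  exact totallyDisconnectedSpace_subtype_iff.1 h

/-- The part of the path between a tip and a point off the tips, run in either direction of time,
would have infinite length. So the path stays in the totally disconnected set of tips. -/
theorem rectifiable_path_const (γ : CurvePath surface) (hγ : γ.Rectifiable)
    (hC : ∃ t, γ.map t ∈ tips) (s t : Icc γ.a γ.b) : γ.map s = γ.map t := by
  obtain ⟨t0, ht0⟩ := hC
  have : PreconnectedSpace (Icc γ.a γ.b) := Subtype.preconnectedSpace isPreconnected_Icc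
  have hall : ∀ t, γ.map t ∈ tips := by
    by_contra hne
    push Not at hne
    obtain ⟨t2, ht2⟩ := hne
    let φ : ℝ → Icc γ.a γ.b := fun x => projIcc γ.a γ.b γ.le (t0 + x * (t2 - t0))
    have hφ : Continuous φ := continuous_projIcc.comp (by fun_prop)
    have h0 : φ 0 = t0 := by simp [φ]
    have h1 : φ 1 = t2 := by simp [φ]
    have htop := eVariationOn_eq_top (g := fun x => γ.map (φ x)) (γ.map.continuous.comp hφ)
      (by rw [h0]; exact ht0) (by rw [h1]; exact ht2)
    have hle : eVariationOn (fun x => γ.map (φ x)) univ ≤ γ.length := by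
      rcases le_total (t0 : ℝ) t2 with h | h
      · refine eVariationOn.comp_le_of_monotoneOn (fun t => γ.map t) φ (fun x _ y _ hxy => ?_)
          (mapsTo_univ _ _)
        exact monotone_projIcc _ (by nlinarith)
      · refine eVariationOn.comp_le_of_antitoneOn (fun t => γ.map t) φ (fun x _ y _ hxy => ?_)
          (mapsTo_univ _ _)
        exact monotone_projIcc _ (by nlinarith)
    rw [htop, top_le_iff] at hle
    exact (ne_of_lt hγ) hle
  exact isTotallyDisconnected_tips _ (range_subset_iff.2 hall) (isPreconnected_range γ.map.continuous)
    (mem_range_self s) (mem_range_self t)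

end TentacleSurface

/-- The assignment `f x ↦ g x` is well defined and Lipschitz on `f '' s`, although neither map has
to be injective. -/
theorem euclideanHausdorffMeasure_image_le_image {ι X Y : Type*} [MetricSpace X]
    [MeasurableSpace X] [BorelSpace X] [MetricSpace Y] [MeasurableSpace Y] [BorelSpace Y]
    {f : ι → X} {g : ι → Y} {s : Set ι} {K : ℝ≥0}
    (h : ∀ x ∈ s, ∀ y ∈ s, dist (g x) (g y) ≤ K * dist (f x) (f y)) (d : ℕ) :
    μHE[d] (g '' s) ≤ (K : ℝ≥0∞) ^ d * μHE[d] (f '' s) := by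
  rcases s.eq_empty_or_nonempty with rfl | ⟨x0, hx0⟩
  · simp
  have : Nonempty ι := ⟨x0⟩
  have hinv : ∀ x ∈ s, g (Function.invFunOn f s (f x)) = g x := by
    intro x hx
    have h1 := h _ (Function.invFunOn_mem (f := f) (b := f x) ⟨x, hx, rfl⟩) x hx
    rw [Function.invFunOn_eq (f := f) (b := f x) ⟨x, hx, rfl⟩, dist_self, mul_zero] at h1
    exact dist_le_zero.1 h1
  have hlip : LipschitzOnWith K (fun y => g (Function.invFunOn f s y)) (f '' s) := by
    refine LipschitzOnWith.of_dist_le_mul ?_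
    rintro _ ⟨x, hx, rfl⟩ _ ⟨y, hy, rfl⟩
    rw [hinv x hx, hinv y hy]
    exact h x hx y hy
  have himg : g '' s = (fun y => g (Function.invFunOn f s y)) '' (f '' s) := by
    rw [image_image]
    exact image_congr fun x hx => (hinv x hx).symm
  rw [himg]
  exact hlip.euclideanHausdorffMeasure_image_le d

namespace TentacleSurface

/-! ### Self-similar decomposition of the area. -/

/-- The parameters of the part of generation `k` of the surface that lie over `B`. -/
def exitSet (k : ℕ) (B : Set Param) : Set Param :=
  {q | 0 < bump (foldMap^[k] q) ∧ bump (foldMap^[k + 1] q) = 0 ∧ foldMap^[k] q ∈ B}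

/-- The placement of a tube of generation `n + 1` on a tube of generation `n`. -/
noncomputable def place (n : ℕ) (b : Bool × Bool) (x : EuclideanSpace ℝ (Fin 3)) :
    EuclideanSpace ℝ (Fin 3) :=
  !₂[shift n + bitSign b.1 * (8 * (1 / 16) ^ (n + 1) + x 0),
    shift n + bitSign b.2 * (8 * (1 / 16) ^ (n + 1) + x 1), (1 / 2) ^ n + x 2]

theorem lipschitzWith_place (n : ℕ) (b : Bool × Bool) : LipschitzWith 1 (place n b) := by
  refine LipschitzWith.of_dist_le_mul fun x y => ?_
  rw [NNReal.coe_one, one_mul]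
  refine le_of_eq ?_
  have hb : ∀ (b : Bool) (u v w : ℝ), dist (u + bitSign b * v) (u + bitSign b * w) = dist v w := by
    intro b u v w
    rw [dist_add_left, Real.dist_eq, ← mul_sub, abs_mul, abs_bitSign, one_mul, Real.dist_eq]
  rw [EuclideanSpace.dist_eq, EuclideanSpace.dist_eq, Fin.sum_univ_three, Fin.sum_univ_three]
  simp [place, hb, dist_add_left]

theorem exists_place_eq {n : ℕ} {q : Param} (h : 0 < bump (foldMap q)) :
    ∃ b, surf n q = place n b (surf (n + 1) (foldMap q)) := by
  have hc := fun i => exists_bitSign_eq (abs_clampSign_of_fold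
    (abs_fold_apply_lt (bump_pos_iff.1 h) i))
  choose b hb using hc
  refine ⟨(b 0, b 1), ?_⟩
  unfold place
  rw [surf_zero, surf_one, surf_two, hb 0, hb 1, ← pos_of_bump_foldMap_pos h,
    ← pos_of_bump_foldMap_pos h, ← height_of_bump_foldMap_pos h]
  rfl

/-- Each step down covers the part in question by four isometric placements of the corresponding
part one generation later. -/
theorem measure_surf_exitSet_le (B : Set Param) (k : ℕ) : ∀ n,
    (μHE[2] : Measure (EuclideanSpace ℝ (Fin 3))) (surf n '' exitSet k B) ≤
      4 ^ k * (μHE[2] : Measure (EuclideanSpace ℝ (Fin 3))) (surf (n + k) '' exitSet 0 B) := by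
  induction k with
  | zero => intro n; simp
  | succ k ih =>
    intro n
    have hsub : surf n '' exitSet (k + 1) B ⊆
        ⋃ b, place n b '' (surf (n + 1) '' exitSet k B) := by
      rintro _ ⟨q, ⟨h1, h2, h3⟩, rfl⟩
      have h0 : 0 < bump (foldMap q) := bump_iterate_pos_of_le (k := 1) h1 (Nat.succ_le_succ (Nat.zero_le k))
      obtain ⟨b, hb⟩ := exists_place_eq (n := n) h0
      rw [Function.iterate_succ_apply] at h1 h2 h3
      exact mem_iUnion.2 ⟨b, hb ▸ mem_image_of_mem _ (mem_image_of_mem _ ⟨h1, h2, h3⟩)⟩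
    have hle : ∀ b : Bool × Bool, (μHE[2] : Measure (EuclideanSpace ℝ (Fin 3)))
        (place n b '' (surf (n + 1) '' exitSet k B)) ≤
        4 ^ k * (μHE[2] : Measure (EuclideanSpace ℝ (Fin 3)))
          (surf (n + (k + 1)) '' exitSet 0 B) := by
      intro b
      have h1 := ((lipschitzWith_place n b).lipschitzOnWith
        (s := surf (n + 1) '' exitSet k B)).euclideanHausdorffMeasure_image_le 2
      rw [ENNReal.coe_one, one_pow, one_mul] at h1
      refine h1.trans ((ih (n + 1)).trans_eq ?_)
      rw [add_assoc, add_comm 1 k]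
    calc _ ≤ (μHE[2] : Measure (EuclideanSpace ℝ (Fin 3)))
          (⋃ b, place n b '' (surf (n + 1) '' exitSet k B)) := measure_mono hsub
      _ ≤ ∑ b, (μHE[2] : Measure (EuclideanSpace ℝ (Fin 3)))
          (place n b '' (surf (n + 1) '' exitSet k B)) := measure_iUnion_fintype_le _ _
      _ ≤ ∑ b : Bool × Bool, 4 ^ k * (μHE[2] : Measure (EuclideanSpace ℝ (Fin 3)))
          (surf (n + (k + 1)) '' exitSet 0 B) := Finset.sum_le_sum fun b _ => hle b
      _ = _ := by
        rw [Finset.sum_const, Finset.card_univ, Fintype.card_prod, Fintype.card_bool, nsmul_eq_mul,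
          pow_succ', ← mul_assoc]
        norm_num

/-! ### Areas -/

theorem abs_bump_sub_le (q q' : Param) : |bump q - bump q'| ≤ 4 * |‖q‖ - ‖q'‖| := by
  unfold bump
  have h1 := abs_max_sub_max_le_max 0 (min 1 (4 * (1 - ‖q‖))) 0 (min 1 (4 * (1 - ‖q'‖)))
  have h2 := abs_min_sub_min_le_max 1 (4 * (1 - ‖q‖)) 1 (4 * (1 - ‖q'‖))
  refine h1.trans (max_le (by simp) (h2.trans (max_le (by simp) (le_of_eq ?_))))
  rw [← mul_sub, abs_mul, abs_of_pos (by norm_num : (0 : ℝ) < 4), sub_sub_sub_cancel_left,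
    abs_sub_comm]

/-- Off its children a tube is steep only in the variable `‖q‖`. The zigzag has slope at most `12 *
2 ^ n` and `bump` slope `4`, so the two horizontal coordinates contribute `48` each and the height
`4`. -/
theorem dist_surf_le {n : ℕ} {q q' : Param} (hq : bump (foldMap q) = 0)
    (hq' : bump (foldMap q') = 0) : dist (surf n q) (surf n q') ≤
      (1 / 16) ^ n * (|q 0 - q' 0| + |q 1 - q' 1|) + 100 * 2 ^ n * |‖q‖ - ‖q'‖| := by
  have hb := abs_bump_sub_le q q'
  have hz := abs_zigzag_sub_le n (bump q) (bump q')
  have hs : shift n + 2 * 2 ^ n ≤ 12 * 2 ^ n := by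
    have h1 := shift_le n
    obtain ⟨h2, h3⟩ := half_pow_mem n
    have h4 : (1 : ℝ) ≤ 2 ^ n := one_le_pow₀ (by norm_num)
    linarith
  have hz' : |zigzag n (bump q) - zigzag n (bump q')| ≤ 48 * 2 ^ n * |‖q‖ - ‖q'‖| := by
    refine hz.trans ?_
    calc _ ≤ 12 * 2 ^ n * (4 * |‖q‖ - ‖q'‖|) := by gcongr
      _ = _ := by ring
  have hp : ∀ i, |pos n q i - pos n q' i| ≤
      (1 / 16) ^ n * |q i - q' i| + 48 * 2 ^ n * |‖q‖ - ‖q'‖| := by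
    intro i
    rw [pos_of_bump_foldMap_eq_zero hq, pos_of_bump_foldMap_eq_zero hq']
    have : (1 / 16 : ℝ) ^ n * q i + zigzag n (bump q) - ((1 / 16) ^ n * q' i + zigzag n (bump q')) =
      (1 / 16 : ℝ) ^ n * (q i - q' i) + (zigzag n (bump q) - zigzag n (bump q')) := by ring
    rw [this]
    refine (abs_add_le _ _).trans ?_
    rw [abs_mul, abs_of_pos (by positivity)]
    gcongr
  have hh : |height n q - height n q'| ≤ 4 * 2 ^ n * |‖q‖ - ‖q'‖| := by
    rw [height_of_bump_foldMap_eq_zero hq, height_of_bump_foldMap_eq_zero hq', ← mul_sub, abs_mul,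
      abs_of_pos (by positivity)]
    have h1 : (1 / 2 : ℝ) ^ n ≤ 2 ^ n := by gcongr; norm_num
    calc _ ≤ 2 ^ n * (4 * |‖q‖ - ‖q'‖|) := by gcongr
      _ = _ := by ring
  have hd : dist (surf n q) (surf n q') ≤ |pos n q 0 - pos n q' 0| + |pos n q 1 - pos n q' 1| +
      |height n q - height n q'| := by
    rw [EuclideanSpace.dist_eq, Fin.sum_univ_three, surf_zero, surf_zero, surf_one, surf_one,
      surf_two, surf_two, Real.dist_eq, Real.dist_eq, Real.dist_eq]
    refine Real.sqrt_le_iff.2 ⟨by positivity, ?_⟩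
    have h0 := abs_nonneg (pos n q 0 - pos n q' 0)
    have h1 := abs_nonneg (pos n q 1 - pos n q' 1)
    have h2 := abs_nonneg (height n q - height n q')
    nlinarith [mul_nonneg h0 h1, mul_nonneg h0 h2, mul_nonneg h1 h2]
  have := hp 0
  have := hp 1
  linarith

theorem norm_param (q : Param) : ‖q‖ = max |q 0| |q 1| := by
  refine le_antisymm ((pi_norm_le_iff_of_nonneg (by positivity)).2 fun i => ?_)
    (max_le (abs_apply_le q 0) (abs_apply_le q 1))
  fin_cases i
  · exact le_max_left _ _
  · exact le_max_right _ _

theorem norm_param_eq {q : Param} {i i' : Fin 2} (hii : i ≠ i') (h : |q i'| ≤ |q i|) :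
    ‖q‖ = |q i| := by
  rw [norm_param]
  fin_cases i <;> fin_cases i'
  · exact absurd rfl hii
  · exact max_eq_left h
  · exact max_eq_right h
  · exact absurd rfl hii

theorem sum_param {i i' : Fin 2} (hii : i ≠ i') (f : Fin 2 → ℝ) : f 0 + f 1 = f i + f i' := by
  fin_cases i <;> fin_cases i'
  · exact absurd rfl hii
  · rfl
  · exact add_comm _ _
  · exact absurd rfl hii

theorem abs_add_abs_le_two_mul_dist (z w : Plane) :
    |z 0 - w 0| + |z 1 - w 1| ≤ 2 * dist z w := by
  have h0 := PiLp.dist_apply_le z w 0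
  have h1 := PiLp.dist_apply_le z w 1
  rw [Real.dist_eq] at h0 h1
  linarith

theorem volume_box (a b : ℝ) : volume {z : Plane | |z 0| ≤ a ∧ |z 1| ≤ b} =
    ENNReal.ofReal (2 * a) * ENNReal.ofReal (2 * b) := by
  have h2 : {z : Plane | |z 0| ≤ a ∧ |z 1| ≤ b} =
      (MeasurableEquiv.toLp 2 (Fin 2 → ℝ)).symm ⁻¹' Icc ![-a, -b] ![a, b] := by
    ext z
    simp [abs_le, Pi.le_def, Fin.forall_fin_two]
    tauto
  rw [h2, (EuclideanSpace.volume_preserving_symm_measurableEquiv_toLp (Fin 2)).measure_preimage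
    measurableSet_Icc.nullMeasurableSet, Real.volume_Icc_pi, Fin.prod_univ_two]
  simp [two_mul]

/-- Where one coordinate dominates, `‖q‖` is its absolute value, and the part is a `2`-Lipschitz
image of a set in a box with half sides `101 * 2 ^ n` and `(1 / 16) ^ n`. This is the product of
length and thickness of the tube, of order `8⁻ⁿ`. -/
theorem measure_surf_exitSet_zero_le (n : ℕ) :
    (μHE[2] : Measure (EuclideanSpace ℝ (Fin 3))) (surf n '' exitSet 0 univ) ≤
      ENNReal.ofReal (3232 * (1 / 8) ^ n) := by
  have key : ∀ i i' : Fin 2, i ≠ i' → (μHE[2] : Measure (EuclideanSpace ℝ (Fin 3)))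
      (surf n '' {q ∈ exitSet 0 univ | |q i'| ≤ |q i|}) ≤ ENNReal.ofReal (1616 * (1 / 8) ^ n) := by
    intro i i' hii
    let z : Param → Plane := fun q => !₂[101 * 2 ^ n * q i, (1 / 16) ^ n * q i']
    have hz : ∀ q ∈ {q ∈ exitSet 0 univ | |q i'| ≤ |q i|},
        ∀ q' ∈ {q ∈ exitSet 0 univ | |q i'| ≤ |q i|},
        dist (surf n q) (surf n q') ≤ ((2 : ℝ≥0) : ℝ) * dist (z q) (z q') := by
      rintro q ⟨⟨-, hq, -⟩, hqi⟩ q' ⟨⟨-, hq', -⟩, hqi'⟩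
      refine (dist_surf_le hq hq').trans (le_trans ?_ (abs_add_abs_le_two_mul_dist (z q) (z q')))
      rw [sum_param hii (fun i => |q i - q' i|), norm_param_eq hii hqi, norm_param_eq hii hqi']
      have h1 := abs_abs_sub_abs_le_abs_sub (q i) (q' i)
      have h2 : z q 0 - z q' 0 = 101 * 2 ^ n * (q i - q' i) := by simp [z]; ring
      have h3 : z q 1 - z q' 1 = (1 / 16) ^ n * (q i' - q' i') := by simp [z]; ring
      rw [h2, h3, abs_mul _ (q i - q' i), abs_mul _ (q i' - q' i'), abs_of_pos (by positivity : (0 : ℝ) < 101 * 2 ^ n),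
        abs_of_pos (by positivity : (0 : ℝ) < (1 / 16) ^ n)]
      have h4 : (1 / 16 : ℝ) ^ n ≤ 2 ^ n := by gcongr; norm_num
      have h5 : (1 / 16 : ℝ) ^ n * |q i - q' i| ≤ 2 ^ n * |q i - q' i| := by gcongr
      have h6 : 100 * 2 ^ n * abs (abs (q i) - abs (q' i)) ≤ 100 * 2 ^ n * |q i - q' i| := by gcongr
      linarith
    have h1 := euclideanHausdorffMeasure_image_le_image hz 2
    refine h1.trans ?_
    rw [euclideanHausdorffMeasure_two_plane]
    have hsub : z '' {q ∈ exitSet 0 univ | |q i'| ≤ |q i|} ⊆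
        {z : Plane | |z 0| ≤ 101 * 2 ^ n ∧ |z 1| ≤ (1 / 16) ^ n} := by
      rintro _ ⟨q, ⟨⟨hq, -, -⟩, -⟩, rfl⟩
      have hn := (bump_pos_iff.1 hq).le
      rw [Function.iterate_zero_apply] at hn
      constructor
      · have : z q 0 = 101 * 2 ^ n * q i := by simp [z]
        rw [this, abs_mul, abs_of_pos (by positivity)]
        exact mul_le_of_le_one_right (by positivity) ((abs_apply_le q i).trans hn)
      · have : z q 1 = (1 / 16) ^ n * q i' := by simp [z]
        rw [this, abs_mul, abs_of_pos (by positivity)]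
        exact mul_le_of_le_one_right (by positivity) ((abs_apply_le q i').trans hn)
    refine (mul_le_mul_right (measure_mono hsub) _).trans_eq ?_
    rw [volume_box, ← ENNReal.ofReal_mul (by positivity)]
    have h4 : ((2 : ℝ≥0) : ℝ≥0∞) ^ 2 = ENNReal.ofReal 4 := by norm_num
    rw [h4, ← ENNReal.ofReal_mul (by norm_num)]
    congr 1
    have : (1 / 8 : ℝ) ^ n = 2 ^ n * (1 / 16) ^ n := by rw [← mul_pow]; norm_num
    rw [this]
    ring
  have hsub : surf n '' exitSet 0 univ ⊆ surf n '' {q ∈ exitSet 0 univ | |q 1| ≤ |q 0|} ∪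
      surf n '' {q ∈ exitSet 0 univ | |q 0| ≤ |q 1|} := by
    rw [← image_union]
    refine image_mono fun q hq => ?_
    rcases le_total |q 1| |q 0| with h | h
    · exact Or.inl ⟨hq, h⟩
    · exact Or.inr ⟨hq, h⟩
  refine (measure_mono hsub).trans ((measure_union_le _ _).trans
    ((add_le_add (key 0 1 (by decide)) (key 1 0 (by decide))).trans_eq ?_))
  rw [← ENNReal.ofReal_add (by positivity) (by positivity)]
  congr 1
  ring

theorem measure_surf_exitSet_zero_eq_zero {B : Set Param} (hB : volume B = 0) (n : ℕ) :
    (μHE[2] : Measure (EuclideanSpace ℝ (Fin 3))) (surf n '' exitSet 0 B) = 0 := by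
  let z : Param → Plane := WithLp.toLp 2
  have hz : ∀ q ∈ exitSet 0 B, ∀ q' ∈ exitSet 0 B,
      dist (surf n q) (surf n q') ≤ ((202 * 2 ^ n : ℝ≥0) : ℝ) * dist (z q) (z q') := by
    rintro q ⟨-, hq, -⟩ q' ⟨-, hq', -⟩
    refine (dist_surf_le hq hq').trans ?_
    have h1 := abs_add_abs_le_two_mul_dist (z q) (z q')
    have h2 : |‖q‖ - ‖q'‖| ≤ |q 0 - q' 0| + |q 1 - q' 1| := by
      refine (abs_norm_sub_norm_le q q').trans ?_
      rw [norm_param]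
      exact max_le_add_of_nonneg (abs_nonneg _) (abs_nonneg _)
    change |q 0 - q' 0| + |q 1 - q' 1| ≤ _ at h1
    have h4 : (1 / 16 : ℝ) ^ n ≤ 2 ^ n := by gcongr; norm_num
    calc _ ≤ 2 ^ n * (|q 0 - q' 0| + |q 1 - q' 1|) +
          100 * 2 ^ n * (|q 0 - q' 0| + |q 1 - q' 1|) := by gcongr
      _ = 101 * 2 ^ n * (|q 0 - q' 0| + |q 1 - q' 1|) := by ring
      _ ≤ 101 * 2 ^ n * (2 * dist (z q) (z q')) := by gcongr
      _ = _ := by push_cast; ring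
  have h1 := euclideanHausdorffMeasure_image_le_image hz 2
  have h2 : z '' exitSet 0 B ⊆ (MeasurableEquiv.toLp 2 (Fin 2 → ℝ)).symm ⁻¹' B := by
    rintro _ ⟨q, ⟨-, -, hq⟩, rfl⟩
    exact hq
  have h3 : volume (z '' exitSet 0 B) = 0 := measure_mono_null h2
    ((EuclideanSpace.volume_preserving_symm_measurableEquiv_toLp
      (Fin 2)).quasiMeasurePreserving.preimage_null hB)
  rw [euclideanHausdorffMeasure_two_plane, h3, mul_zero] at h1
  exact le_antisymm h1 zero_le

theorem exists_mem_exitSet {q : Param} (hq : ‖q‖ < 1) (h : ∃ k, bump (foldMap^[k] q) ≠ 1) :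
    ∃ k, 0 < bump (foldMap^[k] q) ∧ bump (foldMap^[k + 1] q) = 0 := by
  classical
  obtain ⟨k, hk⟩ := h
  have hex : ∃ k, bump (foldMap^[k] q) = 0 := ⟨k + 1, by
    rw [Function.iterate_succ_apply']
    exact bump_foldMap_eq_zero (lt_of_le_of_ne (bump_le_one _) hk)⟩
  have h0 : Nat.find hex ≠ 0 := fun h0 => by
    have := Nat.find_spec hex
    rw [h0] at this
    exact (bump_pos_iff.2 hq).ne' this
  obtain ⟨m, hm⟩ := Nat.exists_eq_succ_of_ne_zero h0
  refine ⟨m, lt_of_le_of_ne (bump_nonneg _) (Ne.symm (Nat.find_min hex (by omega))), ?_⟩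
  have := Nat.find_spec hex
  rwa [hm] at this

theorem isometryOn_val (s : Set surface) :
    IsometryOn (Subtype.val : surface → EuclideanSpace ℝ (Fin 3)) s := fun _ _ _ _ => rfl

theorem isCompact_tips : IsCompact tips := by
  obtain ⟨e⟩ := nonempty_tips_homeomorph
  exact isCompact_iff_compactSpace.2 e.symm.compactSpace

/-- The tips are isometric to a compact planar set. Every other point leaves the folding at a finite
generation `k`, and these parts have areas of order `4 ^ k * (1 / 8) ^ k`. -/
theorem measure_surface_lt_top : (μHE[2] : Measure surface) univ < ∞ := by
  have h1 : (μHE[2] : Measure surface) tips < ∞ := by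
    rw [← isometryOn_horizontal.euclideanHausdorffMeasure_image,
      euclideanHausdorffMeasure_two_plane]
    exact (isCompact_tips.image continuous_horizontal).measure_lt_top
  have h2 : (μHE[2] : Measure surface) tipsᶜ < ∞ := by
    rw [← (isometryOn_val _).euclideanHausdorffMeasure_image]
    have hsub : Subtype.val '' tipsᶜ ⊆ ⋃ k, surf 0 '' exitSet k univ := by
      rintro _ ⟨⟨x, q, hq, rfl⟩, hx, rfl⟩
      have : ∃ k, bump (foldMap^[k] q) ≠ 1 := by
        by_contra hne
        push Not at hne
        exact hx (mem_tips_iff.2 ⟨q, hne, rfl⟩)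
      obtain ⟨k, hk1, hk2⟩ := exists_mem_exitSet (mem_ball_zero_iff.1 hq) this
      exact mem_iUnion.2 ⟨k, q, ⟨hk1, hk2, mem_univ _⟩, rfl⟩
    refine (measure_mono hsub).trans_lt ((measure_iUnion_le _).trans_lt ?_)
    have hle : ∀ k, (μHE[2] : Measure (EuclideanSpace ℝ (Fin 3))) (surf 0 '' exitSet k univ) ≤
        ENNReal.ofReal (3232 * (1 / 2) ^ k) := by
      intro k
      refine (measure_surf_exitSet_le univ k 0).trans ?_
      rw [zero_add]
      refine (mul_le_mul_right (measure_surf_exitSet_zero_le k) _).trans_eq ?_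
      have h4 : (4 : ℝ≥0∞) ^ k = ENNReal.ofReal (4 ^ k) := by
        rw [ENNReal.ofReal_pow (by norm_num)]; norm_num
      rw [h4, ← ENNReal.ofReal_mul (by positivity)]
      congr 1
      have : (1 / 2 : ℝ) ^ k = 4 ^ k * (1 / 8) ^ k := by rw [← mul_pow]; norm_num
      rw [this]
      ring
    refine (ENNReal.tsum_le_tsum hle).trans_lt ?_
    rw [← ENNReal.ofReal_tsum_of_nonneg (fun k => by positivity) (summable_half 3232)]
    exact ENNReal.ofReal_lt_top
  rw [← union_compl_self tips]
  exact (measure_union_le _ _).trans_lt (ENNReal.add_lt_top.2 ⟨h1, h2⟩)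

/-! ### Local affinity of the parametrization. -/

/-- `f` agrees with an affine function near `q`. -/
def LocallyAffineAt (f : Param → ℝ) (q : Param) : Prop :=
  ∃ a b c : ℝ, ∀ᶠ q' in 𝓝 q, f q' = a * q' 0 + b * q' 1 + c

namespace LocallyAffineAt

variable {f g : Param → ℝ} {q : Param}

theorem const (c : ℝ) : LocallyAffineAt (fun _ => c) q :=
  ⟨0, 0, c, Eventually.of_forall fun _ => by ring⟩

theorem coord (i : Fin 2) : LocallyAffineAt (fun q' => q' i) q := by
  fin_cases i
  · exact ⟨1, 0, 0, Eventually.of_forall fun _ => by simp⟩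
  · exact ⟨0, 1, 0, Eventually.of_forall fun _ => by simp⟩

theorem add (hf : LocallyAffineAt f q) (hg : LocallyAffineAt g q) :
    LocallyAffineAt (fun q' => f q' + g q') q := by
  obtain ⟨a, b, c, h⟩ := hf
  obtain ⟨a', b', c', h'⟩ := hg
  refine ⟨a + a', b + b', c + c', ?_⟩
  filter_upwards [h, h'] with q' e e'
  rw [e, e']
  ring

theorem const_mul (hf : LocallyAffineAt f q) (r : ℝ) : LocallyAffineAt (fun q' => r * f q') q := by
  obtain ⟨a, b, c, h⟩ := hf
  refine ⟨r * a, r * b, r * c, ?_⟩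
  filter_upwards [h] with q' e
  rw [e]
  ring

theorem congr (hf : LocallyAffineAt f q) (h : ∀ᶠ q' in 𝓝 q, g q' = f q') :
    LocallyAffineAt g q := by
  obtain ⟨a, b, c, h'⟩ := hf
  refine ⟨a, b, c, ?_⟩
  filter_upwards [h, h'] with q' e e'
  rw [e, e']

end LocallyAffineAt

theorem eventually_clampSign_eq {q : Param} (h : 0 < bump (foldMap q)) (i : Fin 2) :
    ∀ᶠ q' in 𝓝 q, clampSign (q' i) = clampSign (q i) ∧ |q' i| = clampSign (q i) * q' i := by
  have hc : Tendsto (fun q' : Param => q' i) (𝓝 q) (𝓝 (q i)) := (continuous_apply i).tendsto q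
  rcases lt_abs.1 (fold_bounds (abs_fold_apply_lt (bump_pos_iff.1 h) i)).1 with h1 | h1
  · filter_upwards [hc.eventually (lt_mem_nhds (show 1 / 4 < q i by linarith))] with q' hq'
    rw [clampSign_of_pos hq'.le, clampSign_of_pos (by linarith), abs_of_pos (by linarith), one_mul]
    exact ⟨rfl, rfl⟩
  · filter_upwards [hc.eventually (gt_mem_nhds (show q i < -(1 / 4) by linarith))] with q' hq'
    rw [clampSign_of_neg hq'.le, clampSign_of_neg (by linarith), abs_of_neg (by linarith),
      neg_one_mul]
    exact ⟨rfl, rfl⟩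

theorem LocallyAffineAt.comp_foldMap {f : Param → ℝ} {q : Param} (h : 0 < bump (foldMap q))
    (hf : LocallyAffineAt f (foldMap q)) : LocallyAffineAt (fun q' => f (foldMap q')) q := by
  obtain ⟨a, b, c, hf⟩ := hf
  refine ⟨16 * a * clampSign (q 0), 16 * b * clampSign (q 1), c - 8 * a - 8 * b, ?_⟩
  filter_upwards [continuous_foldMap.continuousAt.eventually hf, eventually_clampSign_eq h 0,
    eventually_clampSign_eq h 1] with q' e h0 h1
  rw [e]
  simp only [foldMap, fold]
  rw [h0.2, h1.2]
  ring

/-! ### The exceptional lines -/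

/-- The coordinates at which a profile of generation `n` may have a break. -/
def critical (n : ℕ) : Set ℝ := {s | ∃ j : ℤ, 16 * 4 ^ n * (1 - |s|) = j}

/-- The lines along which the surface of generation `n` may be folded. -/
def creases (n : ℕ) : Set Param := {q | |q 0| = |q 1|} ∪ ⋃ i, {q | q i ∈ critical n}

/-- One grid captures every possible break: the half periods of the zigzag in the ring, where the
profile is `4 * (1 - |s|)`, the inner edge `|s| = 3 / 4`, and the edges `7 / 16` and `9 / 16` of the
small squares. -/
theorem countable_critical (n : ℕ) : (critical n).Countable := by
  have : critical n = ⋃ j : ℤ, {s : ℝ | 16 * 4 ^ n * (1 - |s|) = j} := by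
    ext s; simp [critical]
  rw [this]
  refine countable_iUnion fun j => ?_
  refine (Set.toFinite {1 - (j : ℝ) / (16 * 4 ^ n), -(1 - (j : ℝ) / (16 * 4 ^ n))}).countable.mono ?_
  intro s hs
  have h1 : |s| = 1 - (j : ℝ) / (16 * 4 ^ n) := by
    have : (16 * 4 ^ n : ℝ) ≠ 0 := by positivity
    rw [← (show 16 * 4 ^ n * (1 - |s|) = (j : ℝ) from hs)]
    field_simp
    ring
  exact eq_or_eq_neg_of_abs_eq h1

theorem volume_creases (n : ℕ) : volume (creases n) = 0 := by
  have hker : ∀ r : ℝ, volume {q : Param | q 0 = r * q 1} = 0 := by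
    intro r
    have h1 : {q : Param | q 0 = r * q 1} = (LinearMap.ker
        (LinearMap.proj (R := ℝ) (φ := fun _ : Fin 2 => ℝ) 0 - r • LinearMap.proj 1) :
          Set (Fin 2 → ℝ)) := by
      ext q; simp [sub_eq_zero]
    rw [h1]
    refine addHaar_submodule _ _ fun htop => ?_
    have h2 : (![1, 0] : Fin 2 → ℝ) ∈ LinearMap.ker
        (LinearMap.proj (R := ℝ) (φ := fun _ : Fin 2 => ℝ) 0 - r • LinearMap.proj 1) := by
      rw [htop]; trivial
    simp at h2
  refine measure_union_null ?_ (measure_iUnion_null fun i => ?_)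
  · refine measure_mono_null (fun q hq => ?_) (measure_union_null (hker 1) (hker (-1)))
    rcases abs_eq_abs.1 hq with h | h
    · exact Or.inl (by simpa using h)
    · exact Or.inr (by simpa using h)
  · have h1 : {q : Param | q i ∈ critical n} = ⋃ z ∈ critical n, {q : Param | q i = z} := by
      ext q; simp
    rw [h1, measure_biUnion_null_iff (countable_critical n)]
    intro z _
    rw [volume_pi]
    exact Measure.pi_hyperplane (fun _ : Fin 2 => (volume : Measure ℝ)) i z

theorem zigzag_eventually_affine (n : ℕ) {t : ℝ} (ht : ∀ j : ℤ, 2 * 4 ^ n * t ≠ j) :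
    ∃ a c : ℝ, ∀ᶠ s in 𝓝 t, zigzag n s = a * s + c := by
  set k := round ((4 : ℝ) ^ n * t) with hk
  have h1 : |(4 : ℝ) ^ n * t - k| < 1 / 2 := by
    refine lt_of_le_of_ne (abs_sub_round _) fun h => ?_
    rcases eq_or_eq_neg_of_abs_eq h with h | h
    · exact ht (2 * k + 1) (by push_cast; linarith)
    · exact ht (2 * k - 1) (by push_cast; linarith)
  have h2 : (4 : ℝ) ^ n * t - k ≠ 0 := fun h => ht (2 * k) (by push_cast; linarith)
  have hc : Tendsto (fun s : ℝ => (4 : ℝ) ^ n * s - k) (𝓝 t) (𝓝 ((4 : ℝ) ^ n * t - k)) :=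
    Continuous.tendsto (by fun_prop) t
  have hround : ∀ᶠ s in 𝓝 t, round ((4 : ℝ) ^ n * s) = k := by
    filter_upwards [hc.abs.eventually (gt_mem_nhds h1)] with s hs
    rw [abs_lt] at hs
    rw [round_eq, Int.floor_eq_iff]
    constructor <;> linarith
  rcases h2.lt_or_gt with h3 | h3
  · refine ⟨shift n - 2 * (1 / 2) ^ n * 4 ^ n, 2 * (1 / 2) ^ n * k, ?_⟩
    filter_upwards [hround, hc.eventually (gt_mem_nhds h3)] with s hs hs'
    rw [zigzag, hs, abs_of_neg hs']
    ring
  · refine ⟨shift n + 2 * (1 / 2) ^ n * 4 ^ n, -(2 * (1 / 2) ^ n * k), ?_⟩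
    filter_upwards [hround, hc.eventually (lt_mem_nhds h3)] with s hs hs'
    rw [zigzag, hs, abs_of_pos hs']
    ring

theorem eventually_bump_foldMap_eq_zero {n : ℕ} {q : Param} (h0 : bump (foldMap q) = 0)
    (hq : q ∉ creases n) : ∀ᶠ q' in 𝓝 q, bump (foldMap q') = 0 := by
  have hcrit : ∀ i, |fold (q i)| ≠ 1 := by
    intro i h
    refine hq (Or.inr (mem_iUnion.2 ⟨i, ?_⟩))
    rcases eq_or_eq_neg_of_abs_eq h with h | h
    · refine ⟨7 * 4 ^ n, ?_⟩
      have : |q i| = 9 / 16 := by unfold fold at h; linarith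
      rw [this]; push_cast; ring
    · refine ⟨9 * 4 ^ n, ?_⟩
      have : |q i| = 7 / 16 := by unfold fold at h; linarith
      rw [this]; push_cast; ring
  have h1 : 1 < ‖foldMap q‖ := by
    refine lt_of_le_of_ne (bump_eq_zero_iff.1 h0) fun h => ?_
    rw [norm_param] at h
    rcases max_choice |foldMap q 0| |foldMap q 1| with h' | h'
    · exact hcrit 0 (h'.symm.trans h.symm)
    · exact hcrit 1 (h'.symm.trans h.symm)
  filter_upwards [(continuous_norm.comp continuous_foldMap).continuousAt.eventually
    (lt_mem_nhds h1)] with q' hq'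
  exact bump_eq_zero_iff.2 (le_of_lt hq')

theorem locallyAffineAt_bump {n : ℕ} {q : Param} (h : ‖q‖ < 1) (hq : q ∉ creases n) :
    LocallyAffineAt bump q ∧ ∃ a c : ℝ, ∀ᶠ q' in 𝓝 q, zigzag n (bump q') = a * bump q' + c := by
  have hne : |q 0| ≠ |q 1| := fun h => hq (Or.inl h)
  obtain ⟨i, i', hii, hlt⟩ : ∃ i i' : Fin 2, i ≠ i' ∧ |q i'| < |q i| := by
    rcases hne.lt_or_gt with h | h
    · exact ⟨1, 0, by decide, h⟩
    · exact ⟨0, 1, by decide, h⟩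
  have hcrit : ∀ j : ℤ, 16 * 4 ^ n * (1 - |q i|) ≠ j := fun j hj =>
    hq (Or.inr (mem_iUnion.2 ⟨i, j, hj⟩))
  have hqn := norm_param_eq hii hlt.le
  have hc : ∀ l, Tendsto (fun q' : Param => q' l) (𝓝 q) (𝓝 (q l)) := fun l =>
    (continuous_apply l).tendsto q
  have hn : Tendsto (fun q' : Param => ‖q'‖) (𝓝 q) (𝓝 ‖q‖) := continuous_norm.tendsto q
  have hne34 : ‖q‖ ≠ 3 / 4 := fun h34 => hcrit (4 * 4 ^ n) (by
    rw [← hqn, h34]; push_cast; ring)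
  rcases hne34.lt_or_gt with h34 | h34
  · have hev : ∀ᶠ q' in 𝓝 q, bump q' = 1 := by
      filter_upwards [hn.eventually (gt_mem_nhds h34)] with q' hq'
      exact bump_eq_one hq'.le
    refine ⟨(LocallyAffineAt.const 1).congr hev, 0, zigzag n 1, ?_⟩
    filter_upwards [hev] with q' hq'
    rw [hq', zero_mul, zero_add]
  · have hform : ∀ q' : Param, 3 / 4 < ‖q'‖ → ‖q'‖ < 1 → bump q' = 4 * (1 - ‖q'‖) := by
      intro q' h1 h2
      unfold bump
      rw [min_eq_right (by linarith), max_eq_right (by linarith)]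
    have hi0 : q i ≠ 0 := abs_pos.1 ((abs_nonneg _).trans_lt hlt)
    obtain ⟨σ, hσ⟩ : ∃ σ : ℝ, ∀ᶠ q' in 𝓝 q, |q' i| = σ * q' i := by
      rcases hi0.lt_or_gt with h0 | h0
      · refine ⟨-1, ?_⟩
        filter_upwards [(hc i).eventually (gt_mem_nhds h0)] with q' hq'
        rw [abs_of_neg hq', neg_one_mul]
      · refine ⟨1, ?_⟩
        filter_upwards [(hc i).eventually (lt_mem_nhds h0)] with q' hq'
        rw [abs_of_pos hq', one_mul]
    have haff : LocallyAffineAt (fun q' => -(4 * σ) * q' i + 4) q :=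
      ((LocallyAffineAt.coord i).const_mul _).add (LocallyAffineAt.const 4)
    refine ⟨haff.congr ?_, ?_⟩
    · filter_upwards [hσ, hn.eventually (lt_mem_nhds h34), hn.eventually (gt_mem_nhds h),
        (hc i').abs.eventually_lt (hc i).abs hlt] with q' h1 h2 h3 h4
      rw [hform q' h2 h3, norm_param_eq hii h4.le, h1]
      ring
    · obtain ⟨a, c, hac⟩ := zigzag_eventually_affine n (t := bump q) fun j hj => by
        refine hcrit (2 * j) ?_
        rw [hform q h34 h, hqn] at hj
        push_cast
        linarith
      exact ⟨a, c, continuous_bump.continuousAt.eventually hac⟩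

/-- Off the creases, the surface is locally planar. -/
theorem locallyAffineAt_surf (k : ℕ) : ∀ {n : ℕ} {q : Param}, 0 < bump (foldMap^[k] q) →
    bump (foldMap^[k + 1] q) = 0 → foldMap^[k] q ∉ creases (n + k) →
    (∀ i, LocallyAffineAt (fun q' => pos n q' i) q) ∧ LocallyAffineAt (height n) q := by
  induction k with
  | zero =>
    intro n q h1 h2 h3
    have hev := eventually_bump_foldMap_eq_zero (n := n) h2 h3
    obtain ⟨hb, a, c, hz⟩ := locallyAffineAt_bump (bump_pos_iff.1 h1) h3
    constructor
    · intro i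
      have haff := ((LocallyAffineAt.coord (q := q) i).const_mul ((1 / 16) ^ n)).add
        ((hb.const_mul a).add (LocallyAffineAt.const c))
      refine haff.congr ?_
      filter_upwards [hev, hz] with q' e1 e2
      rw [pos_of_bump_foldMap_eq_zero e1, ← e2]
      rfl
    · refine (hb.const_mul ((1 / 2) ^ n)).congr ?_
      filter_upwards [hev] with q' e1
      exact height_of_bump_foldMap_eq_zero e1
  | succ k ih =>
    intro n q h1 h2 h3
    have h0 : 0 < bump (foldMap q) :=
      bump_iterate_pos_of_le (k := 1) h1 (Nat.succ_le_succ (Nat.zero_le k))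
    rw [Function.iterate_succ_apply] at h1 h2 h3
    rw [← add_assoc, add_right_comm] at h3
    obtain ⟨hp, hh⟩ := ih (n := n + 1) h1 h2 h3
    have hev : ∀ᶠ q' in 𝓝 q, 0 < bump (foldMap q') :=
      (continuous_bump.comp continuous_foldMap).continuousAt.eventually (lt_mem_nhds h0)
    constructor
    · intro i
      have haff := (LocallyAffineAt.const (q := q) (shift n)).add
        (((LocallyAffineAt.const (q := q) (8 * (1 / 16) ^ (n + 1))).add
          ((hp i).comp_foldMap h0)).const_mul (clampSign (q i)))
      refine haff.congr ?_
      filter_upwards [hev, eventually_clampSign_eq h0 i] with q' e1 e2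
      rw [pos_of_bump_foldMap_pos e1, e2.1]
    · refine ((LocallyAffineAt.const ((1 / 2) ^ n)).add (hh.comp_foldMap h0)).congr ?_
      filter_upwards [hev] with q' e1
      exact height_of_bump_foldMap_pos e1

/-! ### Planar pieces -/

/-- An open piece of the surface that misses the tips and is isometric to an open set in the
plane. -/
def IsPlanarPiece (P : Set surface) : Prop :=
  IsOpen P ∧ Disjoint P tips ∧
    ∃ j : surface → Plane, Continuous j ∧ IsometryOn j P ∧ IsOpen (j '' P)

theorem isPlanarPiece_empty : IsPlanarPiece ∅ :=
  ⟨isOpen_empty, empty_disjoint _, fun _ => 0, continuous_const, fun _ h => absurd h (notMem_empty _),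
    by simp⟩

/-- Near `q` the surface is the image of an affine map, hence part of a plane in space. The
orthogonal projection to that plane, in orthonormal coordinates, is continuous on the whole surface
and isometric on this part. -/
theorem exists_isPlanarPiece {q : Param} (hq : ‖q‖ < 1) (h0 : LocallyAffineAt (fun q' => pos 0 q' 0) q)
    (h1 : LocallyAffineAt (fun q' => pos 0 q' 1) q) (h2 : LocallyAffineAt (height 0) q)
    (htip : height 0 q ≠ 2) :
    ∃ P, IsPlanarPiece P ∧ (⟨surf 0 q, surf_mem hq⟩ : surface) ∈ P := by
  obtain ⟨a0, b0, c0, h0⟩ := h0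
  obtain ⟨a1, b1, c1, h1⟩ := h1
  obtain ⟨a2, b2, c2, h2⟩ := h2
  let L : Param →ₗ[ℝ] EuclideanSpace ℝ (Fin 3) :=
    { toFun := fun w => !₂[a0 * w 0 + b0 * w 1, a1 * w 0 + b1 * w 1, a2 * w 0 + b2 * w 1]
      map_add' := fun w w' => by
        ext l; fin_cases l <;> simp <;> ring
      map_smul' := fun r w => by
        ext l; fin_cases l <;> simp <;> ring }
  let v : EuclideanSpace ℝ (Fin 3) := !₂[c0, c1, c2]
  have hev : ∀ᶠ q' in 𝓝 q, (surf 0 q' = L q' + v ∧ height 0 q' ≠ 2) ∧ q' ∈ Metric.ball (0 : Param) 1 := by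
    filter_upwards [h0, h1, h2, (continuous_height 0).continuousAt.eventually_ne htip,
      Metric.isOpen_ball.mem_nhds (mem_ball_zero_iff.2 hq)] with q' e0 e1 e2 e3 e4
    refine ⟨⟨?_, e3⟩, e4⟩
    ext l
    fin_cases l
    · exact e0
    · exact e1
    · exact e2
  obtain ⟨U, hU, hUo, hqU⟩ := eventually_nhds_iff.1 hev
  -- A kernel vector `w` would make `surf 0` constant along a short segment in direction `w`,
  -- contradicting injectivity of the surface.
  have hLinj : Function.Injective L := by
    rw [← LinearMap.ker_eq_bot, LinearMap.ker_eq_bot']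
    intro w hw
    have hc : Tendsto (fun ε : ℝ => q + ε • w) (𝓝 0) (𝓝 q) := by
      have : Continuous fun ε : ℝ => q + ε • w := by fun_prop
      simpa using this.tendsto 0
    have hev' : ∀ᶠ ε in 𝓝 (0 : ℝ), q + ε • w ∈ U := hc.eventually (hUo.mem_nhds hqU)
    obtain ⟨ε, hε, hε0⟩ := ((hev'.filter_mono nhdsWithin_le_nhds).and
      (self_mem_nhdsWithin (a := (0 : ℝ)) (s := {0}ᶜ))).exists
    have hs : surf 0 (q + ε • w) = surf 0 q := by
      rw [(hU _ hε).1.1, (hU _ hqU).1.1, map_add, map_smul, hw, smul_zero, add_zero]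
    have := surf_injOn (Metric.ball_subset_closedBall (hU _ hε).2)
      (Metric.ball_subset_closedBall (hU _ hqU).2) hs
    rw [add_eq_left] at this
    exact (smul_eq_zero.1 this).resolve_left hε0
  have hfin : Module.finrank ℝ (LinearMap.range L) = 2 := by
    rw [LinearMap.finrank_range_of_inj hLinj]; simp
  let e : LinearMap.range L ≃ₗᵢ[ℝ] Plane :=
    ((stdOrthonormalBasis ℝ (LinearMap.range L)).reindex (finCongr hfin)).repr
  let T : Param →ₗ[ℝ] Plane := e.toLinearEquiv.toLinearMap ∘ₗ L.rangeRestrict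
  have hTinj : Function.Injective T := by
    refine e.injective.comp fun w w' h => hLinj ?_
    exact congrArg Subtype.val h
  have hTopen : IsOpenMap T := T.isOpenMap_of_finiteDimensional
    ((LinearMap.injective_iff_surjective_of_finrank_eq_finrank (by simp)).1 hTinj)
  let j : surface → Plane := fun x =>
    e ((LinearMap.range L).orthogonalProjectionOnto ((x : EuclideanSpace ℝ (Fin 3)) - v))
  have hj : ∀ q' ∈ U, ∀ x : surface, (x : EuclideanSpace ℝ (Fin 3)) = surf 0 q' → j x = T q' := by
    intro q' hq' x hx
    have h3 : (x : EuclideanSpace ℝ (Fin 3)) - v = L.rangeRestrict q' := by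
      rw [hx, (hU _ hq').1.1, add_sub_cancel_right]; rfl
    simp only [j]
    rw [h3, Submodule.orthogonalProjectionOnto_mem_subspace_eq_self]
    rfl
  let P : Set surface := {x | (surfaceHomeo.symm x : Param) ∈ U}
  have hP : ∀ x ∈ P, ∃ q' ∈ U, (x : EuclideanSpace ℝ (Fin 3)) = surf 0 q' := fun x hx =>
    ⟨surfaceHomeo.symm x, hx, by rw [← surfaceHomeo_apply, Homeomorph.apply_symm_apply]⟩
  have hP' : ∀ q' (h : q' ∈ U), (⟨surf 0 q', mem_image_of_mem _ (hU _ h).2⟩ : surface) ∈ P := by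
    intro q' h
    have : (⟨surf 0 q', mem_image_of_mem _ (hU _ h).2⟩ : surface) =
      surfaceHomeo ⟨q', (hU _ h).2⟩ := rfl
    rw [this]
    change ((surfaceHomeo.symm (surfaceHomeo ⟨q', (hU _ h).2⟩) : Metric.ball (0 : Param) 1) :
      Param) ∈ U
    rw [Homeomorph.symm_apply_apply]
    exact h
  refine ⟨P, ⟨?_, ?_, j, ?_, ?_, ?_⟩, hP' q hqU⟩
  · exact hUo.preimage (continuous_subtype_val.comp surfaceHomeo.symm.continuous)
  · refine disjoint_left.2 fun x hx hxt => ?_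
    obtain ⟨q', hq', hxq⟩ := hP x hx
    refine (hU _ hq').1.2 ?_
    rw [← surf_two, ← hxq]
    exact hxt
  · exact e.continuous.comp ((LinearMap.range L).orthogonalProjectionOnto.continuous.comp
      (continuous_subtype_val.sub continuous_const))
  · intro x hx y hy
    obtain ⟨q', hq', hxq⟩ := hP x hx
    obtain ⟨q'', hq'', hyq⟩ := hP y hy
    rw [hj q' hq' x hxq, hj q'' hq'' y hyq, Subtype.dist_eq, hxq, hyq, (hU _ hq').1.1,
      (hU _ hq'').1.1, dist_add_right]
    exact e.dist_map (L.rangeRestrict q') (L.rangeRestrict q'')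
  · have : j '' P = T '' U := by
      ext z
      constructor
      · rintro ⟨x, hx, rfl⟩
        obtain ⟨q', hq', hxq⟩ := hP x hx
        exact ⟨q', hq', (hj q' hq' x hxq).symm⟩
      · rintro ⟨q', hq', rfl⟩
        exact ⟨_, hP' q' hq', hj q' hq' _ rfl⟩
    rw [this]
    exact hTopen _ hUo

/-- A point that is neither a tip nor in a planar piece leaves the folding at some generation `k`
over a crease. The creases are null sets of parameters, and the parametrization is Lipschitz there.
-/
theorem measure_compl_planar_eq_zero :
    (μHE[2] : Measure surface) {x | x ∉ tips ∧ ¬ ∃ P, IsPlanarPiece P ∧ x ∈ P} = 0 := by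
  rw [← (isometryOn_val _).euclideanHausdorffMeasure_image]
  have hsub : Subtype.val '' {x | x ∉ tips ∧ ¬ ∃ P, IsPlanarPiece P ∧ x ∈ P} ⊆
      ⋃ k, surf 0 '' exitSet k (creases k) := by
    rintro _ ⟨⟨x, q, hq, rfl⟩, ⟨hx, hP⟩, rfl⟩
    have hq1 := mem_ball_zero_iff.1 hq
    have : ∃ k, bump (foldMap^[k] q) ≠ 1 := by
      by_contra hne
      push Not at hne
      exact hx (mem_tips_iff.2 ⟨q, hne, rfl⟩)
    obtain ⟨k, hk1, hk2⟩ := exists_mem_exitSet hq1 this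
    refine mem_iUnion.2 ⟨k, q, ⟨hk1, hk2, ?_⟩, rfl⟩
    by_contra hcr
    obtain ⟨hp, hh⟩ := locallyAffineAt_surf k (n := 0) hk1 hk2 (by rwa [zero_add])
    exact hP (exists_isPlanarPiece hq1 (hp 0) (hp 1) hh hx)
  refine measure_mono_null hsub (measure_iUnion_null fun k => ?_)
  have h1 := measure_surf_exitSet_le (creases k) k 0
  rw [measure_surf_exitSet_zero_eq_zero (volume_creases k), mul_zero] at h1
  exact le_antisymm h1 zero_le

theorem exists_isPiecewisePlanar : ∃ (kC : Plane → surface) (P : ℕ → Set surface)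
    (j : ℕ → surface → Plane) (k : ℕ → Plane → surface),
    IsPiecewisePlanar tips horizontal kC P j k := by
  classical
  have : Nonempty surface := ⟨⟨_, surf_mem (q := 0) (by simp)⟩⟩
  have hex : ∀ x : surface, ∃ P, IsPlanarPiece P ∧ ((∃ P, IsPlanarPiece P ∧ x ∈ P) → x ∈ P) := by
    intro x
    by_cases h : ∃ P, IsPlanarPiece P ∧ x ∈ P
    · obtain ⟨P, hP, hx⟩ := h
      exact ⟨P, hP, fun _ => hx⟩
    · exact ⟨∅, isPlanarPiece_empty, fun h' => absurd h' h⟩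
  choose P hP hxP using hex
  -- By the Lindelöf property countably many pieces suffice. Adding an arbitrary index makes the
  -- family nonempty, so that it can be enumerated by `ℕ`; its piece may be empty.
  obtain ⟨T, hT, hTP⟩ := TopologicalSpace.isOpen_iUnion_countable P fun x => (hP x).1
  obtain ⟨f, hf⟩ := (hT.insert (Classical.arbitrary surface)).exists_eq_range (insert_nonempty _ _)
  choose j hj using fun i : ℕ => (hP (f i)).2.2
  refine ⟨_, fun i => P (f i), j, fun i => Function.invFunOn (j i) (P (f i)),
    measure_surface_lt_top, isClosed_tips,
    planarChart_of_isometryOn continuous_horizontal isometryOn_horizontal, fun i => (hP (f i)).1,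
    fun i => (hj i).2.2, fun i => planarChart_of_isometryOn (hj i).1 (hj i).2.1,
    fun i => (hP (f i)).2.1, ?_, rectifiable_path_const⟩
  refine measure_mono_null (fun x hx => ?_) measure_compl_planar_eq_zero
  rw [mem_compl_iff, mem_union, not_or] at hx
  refine ⟨hx.1, fun h => hx.2 ?_⟩
  have h1 : x ∈ ⋃ y ∈ T, P y := by
    rw [hTP]
    exact mem_iUnion.2 ⟨x, hxP x h⟩
  obtain ⟨y, hy, hxy⟩ := mem_iUnion₂.1 h1
  have h2 : y ∈ range f := by rw [← hf]; exact mem_insert_of_mem _ hy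
  obtain ⟨i, rfl⟩ := h2
  exact mem_iUnion.2 ⟨i, hxy⟩

end TentacleSurface

/-! ### The main theorem. -/

theorem mainTheorem5 :
    ∃ (X : Set (EuclideanSpace ℝ (Fin 3))) (C : Set X),
      -- `X` is a `2`-rectifiable metric surface of finite area
      IsMetricSurface X ∧ IsTwoRectifiable X ∧ (μHE[2] : Measure X) univ < ∞ ∧
      -- `C` is a closed Cantor set of positive area that no nonconstant rectifiable path meets
      IsClosed C ∧ Nonempty (C ≃ₜ (ℕ → Bool)) ∧ 0 < (μHE[2] : Measure X) C ∧
      (∀ γ : CurvePath X, γ.Rectifiable → (∃ t, γ.map t ∈ C) → ∀ s t, γ.map s = γ.map t) ∧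
      -- minimal upper gradients of Lipschitz functions exist and vanish almost everywhere on `C`
      (∀ u : X → ℝ, (∃ L : ℝ≥0, LipschitzWith L u) → ∀ p : ℝ≥0∞, 1 ≤ p →
        (∃ ρ : X → ℝ≥0∞, IsMinimalWeakUpperGradient p u ρ) ∧
        ∀ ρ : X → ℝ≥0∞, IsMinimalWeakUpperGradient p u ρ →
          ∀ᵐ x ∂(μHE[2] : Measure X).restrict C, ρ x = 0) ∧
      -- the exact coarea equality
      (∀ u : X → ℝ, (∃ L : ℝ≥0, LipschitzWith L u) → ∀ E : Set X, MeasurableSet E →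
        AEMeasurable (fun t : ℝ => (μHE[1] : Measure X) (u ⁻¹' {t} ∩ E)) volume ∧
        ∀ p : ℝ≥0∞, 1 ≤ p → ∀ ρ : X → ℝ≥0∞, IsMinimalWeakUpperGradient p u ρ →
          ∫⁻ t : ℝ, (μHE[1] : Measure X) (u ⁻¹' {t} ∩ E) =
            ∫⁻ x in E, C.indicator (lipOn u C) x ∂(μHE[2] : Measure X) +
            ∫⁻ x in E, Cᶜ.indicator ρ x ∂(μHE[2] : Measure X)) ∧
      -- a coordinate projection for which every coarea inequality fails
      ∃ u : X → ℝ, (∀ x : X, u x = (x : EuclideanSpace ℝ (Fin 3)) 0) ∧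
        (∃ L : ℝ≥0, LipschitzWith L u) ∧
        0 < ∫⁻ t : ℝ, (μHE[1] : Measure X) (u ⁻¹' {t} ∩ C) ∧
        (∀ᵐ x ∂(μHE[2] : Measure X).restrict C, lipOn u C x = 1) ∧
        ∀ p : ℝ≥0∞, 1 ≤ p → ∀ ρ : X → ℝ≥0∞, IsMinimalWeakUpperGradient p u ρ →
          ∀ κ : ℝ≥0, ∃ g : X → ℝ≥0∞, Measurable g ∧
            κ * ∫⁻ x, g x * ρ x ∂(μHE[2] : Measure X) <
              ∫⁻ t : ℝ, ∫⁻ x in u ⁻¹' {t}, g x ∂(μHE[1] : Measure X) := by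
  obtain ⟨kC, P, j, k, h⟩ := TentacleSurface.exists_isPiecewisePlanar
  refine ⟨TentacleSurface.surface, TentacleSurface.tips,
    TentacleSurface.isMetricSurface_surface h.finite,
    h.isTwoRectifiable (h.chart.measurableSet_image h.isClosed.measurableSet subset_rfl),
    h.finite, h.isClosed, TentacleSurface.nonempty_tips_homeomorph, TentacleSurface.tips_pos,
    h.const, ?_, ?_, ?_⟩
  · rintro u ⟨L, hu⟩ p hp
    exact ⟨⟨_, h.isMinimal hu hp⟩, fun ρ hρ => h.ae_eq_zero hu hp hρ⟩
  · rintro u ⟨L, hu⟩ E hE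
    obtain ⟨h1, h2⟩ := h.coarea hu hE
    refine ⟨h1, fun p hp ρ hρ => h2.trans ?_⟩
    congr 1
    refine lintegral_congr_ae (ae_restrict_of_ae ?_)
    filter_upwards [h.ae_eq_of_isMinimal hu hp hρ] with x hx
    by_cases hxC : x ∈ TentacleSurface.tips
    · simp [hxC]
    · rw [indicator_of_mem hxC, indicator_of_mem hxC, hx, indicator_of_mem hxC]
  · have hu : LipschitzWith 1 fun x : TentacleSurface.surface =>
        (x : EuclideanSpace ℝ (Fin 3)) 0 := LipschitzWith.of_dist_le_mul fun x y => by
      rw [NNReal.coe_one, one_mul]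
      exact PiLp.dist_apply_le (x : EuclideanSpace ℝ (Fin 3)) y 0
    have huj : ∀ x ∈ TentacleSurface.tips,
        (x : EuclideanSpace ℝ (Fin 3)) 0 = TentacleSurface.horizontal x 0 := fun x _ => rfl
    have hpos := h.lintegral_slice_pos hu huj TentacleSurface.tips_pos
    exact ⟨_, fun _ => rfl, ⟨1, hu⟩, hpos, h.ae_lipOn_eq_one huj,
      fun p hp ρ hρ κ => h.coarea_inequality_fails hu hpos hp hρ κ⟩
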